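/- **Setting.** Let $X$ be a complex Banach space with dual $X'$, and let $\Sigma_\omega=\{z\neq0:|\arg z|<\omega\}$. Let $A$ be a $0$-sectorial operator on $X$: $A$ is closed, has dense range, and for every $\omega\in(0,\pi)$ its spectrum lies in $\overline{\Sigma_\omega}$ and $\|\lambda(\lambda-A)^{-1}\|$ is bounded on $\mathbb C\setminus\overline{\Sigma_\theta}$ for every $\theta>\omega$. With $\rho(z)=z(1+z)^{-2}$, functions $f\in\bigcap_{0<\omega<\pi}H^\infty(\Sigma_\omega)$ have the holomorphic calculus $f(A)=\rho(A)^{-1}(\rho f)(A)$, where $(\rho f)(A)$ is the Cauchy integral $\frac1{2\pi i}\int_{\partial\Sigma_\sigma}\rho(\lambda) f(\lambda)(\lambda-A)^{-1}d\lambda$ and $\rho(A)=A(1+A)^{-2}$; in particular this defines $A^{it}$ for $t\in\mathbb R$. For $\beta>\frac12$ let $\mathcal S^\beta$ be the space of $f:(0,\infty)\to\mathbb C$ with $\|f\|_{\mathcal S^\beta}=\|f\circ\exp\|_{W^\beta_2(\mathbb R)}=\|(1+|t|)^\beta (f\circ\exp)^{\wedge}(t)\|_{L^2(dt)}<\infty$.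 Assume that for some (possibly large) $\beta>\frac12$, $A$ has a bounded $\mathcal S^\beta$ calculus: there is a $C$ such that $f(A)$ is bounded with $\|f(A)\|\le C\|f\|_{\mathcal S^\beta}$ for all $f\in\mathcal S^\beta\cap\bigcap_{0<\omega<\pi}H^\infty(\Sigma_\omega)$. (This holds for instance if $A$ has a bounded Mihlin calculus of some, possibly large, order.) Then $f(A)\in B(X)$ is defined for all $f\in\mathcal S^\beta$ by continuous extension. Fix $\psi\in C_c^\infty(0,\infty)$ with support in $[\frac12,2]$ and $\sum_{n\in\mathbb Z}\psi(2^{-n}t)=1$ for $t>0$, put $\psi_n=\psi(2^{-n}\,\cdot)$, and let $$D_A=\{x\in X:\ \exists N\ \ \psi_n(A)x=0\ \text{ for } |n|\ge N\}.$$ For smooth $f:(0,\infty)\to\mathbb C$ let $f(A)$ be the closure of the operator $D_A\to X$, $x\mapsto\sum_{n\in\mathbb Z}(f\psi_n)(A)x$ (a finite sum). Write $\langle t\rangle=\sqrt{1+t^2}$, and let $M:L^2((0,\infty),\frac{ds}s)\to L^2(\mathbb R,dt)$, $Mf(t)=\int_0^\infty f(s)s^{it}\frac{ds}s$, be the Mellin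 transform (the integral being an $L^2$ limit of its truncations). **Proposition.** Let $\alpha>\frac12$ and let $m\in\mathbb N$ with $m>\alpha-\frac12$. Choose one of the two signs $\mp$ throughout. Put $f_m(z)=\sum_{k=1}^m\binom mk(-1)^{m-k}k^{-z}$ and $$h_\mp(t)=e^{\mp i\frac\pi2(\frac12-\alpha)}\,e^{\pm\frac\pi2t}\,\Gamma(\tfrac12-\alpha+it)\,f_m(\tfrac12-\alpha+it),$$ where a possible removable singularity at $t=0$ is disregarded. Then: 1. For $s>0$, $(sA)^{\frac12-\alpha}(e^{\mp isA}-1)^m$ (that is, $f(A)$ for $f(\lambda)=(s\lambda)^{\frac12-\alpha}(e^{\mp is\lambda}-1)^m$) is a well-defined closed operator whose domain contains $D_A$; and $D_A\subset D(A^{it})$ for all $t\in\mathbb R$. 2. There is a constant $C$ with $|h_\mp(t)|\le C\langle t\rangle^{-\alpha}$ for all $t\in\mathbb R$. 3. Assume that there is a constant $C$ such that for all $x\in D_A$ and $x'\in X'$ $$\big\|t\mapsto\langle t\rangle^{-\alpha}\langle A^{it}x,x'\rangle\big\|_{L^2(\mathbb R,dt)}\le C\|x\|\,\|x'\|,$$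 or that there is a constant $C$ such that for all $x\in D_A$ and $x'\in X'$ $$\big\|s\mapsto\langle(sA)^{\frac12-\alpha}(e^{\mp isA}-1)^mx,x'\rangle\big\|_{L^2((0,\infty),\frac{ds}s)}\le C\|x\|\,\|x'\|.$$ Then for all $x\in D_A$ and $x'\in X'$ the function $s\mapsto\langle(sA)^{\frac12-\alpha}(e^{\mp isA}-1)^mx,x'\rangle$ belongs to $L^2((0,\infty),\frac{ds}s)$, the function $t\mapsto h_\mp(t)\langle A^{-it}x,x'\rangle$ belongs to $L^2(\mathbb R,dt)$, and in $L^2(\mathbb R,dt)$ $$M\big[\langle(sA)^{\frac12-\alpha}(e^{\mp isA}-1)^mx,x'\rangle\big](t)=h_\mp(t)\,\langle A^{-it}x,x'\rangle .$$ -/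

import Mathlib

open MeasureTheory Filter Topology
open scoped ENNReal FourierTransform

noncomputable section

namespace WaveBIP

variable {X : Type*} [NormedAddCommGroup X] [NormedSpace ℂ X]

/-! ### Resolvents and sectorial operators -/

/-- The open sector `{z ≠ 0 : |arg z| < ω}`. -/
def sector (ω : ℝ) : Set ℂ := {z | z ≠ 0 ∧ |z.arg| < ω}

/-- The bounded operator `R` is the inverse `(λ - A)⁻¹` of `λ - A : D(A) → X`. -/
def IsResolventAt (A : X →ₗ.[ℂ] X) (z : ℂ) (R : X →L[ℂ] X) : Prop :=
  (∀ x : X, ∃ h : R x ∈ A.domain, z • R x - A ⟨R x, h⟩ = x) ∧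
    ∀ x : A.domain, R (z • (x : X) - A x) = x

/-- The spectrum of an unbounded operator. -/
def opSpectrum (A : X →ₗ.[ℂ] X) : Set ℂ := {z | ¬ ∃ R, IsResolventAt A z R}

open Classical in
/-- The resolvent `(z - A)⁻¹` (and `0` if `z` is in the spectrum). -/
def resolventOp (A : X →ₗ.[ℂ] X) (z : ℂ) : X →L[ℂ] X :=
  if h : ∃ R, IsResolventAt A z R then h.choose else 0

/-- `ω`-sectorial operators: closed, spectrum in the closed sector, dense range, and
`‖z (z - A)⁻¹‖` bounded outside every larger closed sector. -/
structure IsSectorial (A : X →ₗ.[ℂ] X) (ω : ℝ) : Prop where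
  closed : A.IsClosed
  spectrum_subset : opSpectrum A ⊆ closure (sector ω)
  dense_range : Dense (Set.range A)
  resolvent_bound : ∀ θ : ℝ, ω < θ → ∃ C : ℝ, 0 < C ∧
    ∀ z : ℂ, z ∉ closure (sector θ) → ‖z • resolventOp A z‖ ≤ C

/-- `0`-sectorial operators: `ω`-sectorial for every `ω ∈ (0, π)`. -/
def IsZeroSectorial (A : X →ₗ.[ℂ] X) : Prop :=
  ∀ ω ∈ Set.Ioo (0 : ℝ) Real.pi, IsSectorial A ω

/-! ### Holomorphic functional calculus -/

/-- `f` belongs to `H^∞(Σ_ω)` for every `ω ∈ (0, π)`. -/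
def IsHInf (f : ℂ → ℂ) : Prop :=
  ∀ ω ∈ Set.Ioo (0 : ℝ) Real.pi,
    DifferentiableOn ℂ f (sector ω) ∧ ∃ C : ℝ, ∀ z ∈ sector ω, ‖f z‖ ≤ C

/-- The Cauchy integral `(2πi)⁻¹ ∫_Γ f(z) (z - A)⁻¹ dz`, where `Γ` is the boundary of the sector
`Σ_σ`, oriented counterclockwise: in along the ray of angle `σ`, out along the ray of
angle `-σ`. -/
def cauchyCalc (A : X →ₗ.[ℂ] X) (σ : ℝ) (f : ℂ → ℂ) : X →L[ℂ] X :=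
  (2 * Real.pi * Complex.I)⁻¹ •
    ((∫ r in Set.Ioi (0 : ℝ),
        (Complex.exp (-(σ * Complex.I)) * f (r * Complex.exp (-(σ * Complex.I)))) •
          resolventOp A (r * Complex.exp (-(σ * Complex.I)))) -
      ∫ r in Set.Ioi (0 : ℝ),
        (Complex.exp (σ * Complex.I) * f (r * Complex.exp (σ * Complex.I))) •
          resolventOp A (r * Complex.exp (σ * Complex.I)))

/-- `ρ(z) = z (1 + z)⁻²`. -/
def rho (z : ℂ) : ℂ := z / (1 + z) ^ 2

/-- `ρ(A) = A (1 + A)⁻² = (1 + A)⁻¹ - (1 + A)⁻²`, where `(1 + A)⁻¹ = - (-1 - A)⁻¹`. -/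
def rhoOp (A : X →ₗ.[ℂ] X) : X →L[ℂ] X :=
  -resolventOp A (-1) - resolventOp A (-1) ∘L resolventOp A (-1)

/-- The graph `{(x, y) : (ρ f)(A) x = ρ(A) y}` of `f(A) = ρ(A)⁻¹ (ρ f)(A)`. The functions `f` of
interest are bounded and holomorphic on all sectors, so every contour angle in `(0, π)` gives the
same `(ρ f)(A)`; the angle `π / 2` is used. -/
def holGraph (A : X →ₗ.[ℂ] X) (f : ℂ → ℂ) : Submodule ℂ (X × X) where
  carrier := {p | cauchyCalc A (Real.pi / 2) (fun z => rho z * f z) p.1 = rhoOp A p.2}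
  add_mem' := by
    intro p q hp hq
    simp only [Set.mem_ofPred_eq, Prod.fst_add, Prod.snd_add, map_add] at *
    rw [hp, hq]
  zero_mem' := by simp
  smul_mem' := by
    intro c p hp
    simp only [Set.mem_ofPred_eq, Prod.smul_fst, Prod.smul_snd, map_smul] at *
    rw [hp]

/-- The (extended) holomorphic calculus `f(A) = ρ(A)⁻¹ (ρ f)(A)`, for `f` bounded and holomorphic
on all sectors. -/
def holCalc (A : X →ₗ.[ℂ] X) (f : ℂ → ℂ) : X →ₗ.[ℂ] X := (holGraph A f).toLinearPMap

/-- The imaginary power `A^{it}`. -/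
def imagPow (A : X →ₗ.[ℂ] X) (t : ℝ) : X →ₗ.[ℂ] X :=
  holCalc A (fun z => z ^ (Complex.I * t))

/-! ### Sobolev functional calculus -/

open Classical in
/-- The norm `‖(1 + |t|)^β ĝ(t)‖_{L²}` of the Sobolev space `W^β_2(ℝ)`, with the `L²` Fourier
transform; it is `∞` if `g` is not in the space. -/
def sobNorm (β : ℝ) (g : ℝ → ℂ) : ℝ≥0∞ :=
  if h : MemLp g 2 (volume : Measure ℝ) then
    eLpNorm (fun t : ℝ => (((1 + |t|) ^ β : ℝ) : ℂ) * (𝓕 (h.toLp g) : Lp ℂ 2 (volume : Measure ℝ)) t)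
      2 volume
  else ∞

/-- The norm of the space `{f : (0, ∞) → ℂ : f ∘ exp ∈ W^β_2(ℝ)}`. -/
def logSobNorm (β : ℝ) (f : ℝ → ℂ) : ℝ≥0∞ := sobNorm β (fun x => f (Real.exp x))

/-- `A` has a bounded calculus for the space `{f : f ∘ exp ∈ W^β_2(ℝ)}`: the operators `f(A)` of the
holomorphic calculus are bounded on `X`, with norm at most `C ‖f ∘ exp‖_{W^β_2}`, for all
`f ∈ ⋂_ω H^∞(Σ_ω)` in the space. -/
def HasSobCalc (A : X →ₗ.[ℂ] X) (β : ℝ) : Prop :=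
  ∃ C : ℝ, ∀ f : ℂ → ℂ, IsHInf f → logSobNorm β (fun l => f l) < ∞ →
    ∃ T : X →L[ℂ] X, holCalc A f = (T : X →ₗ[ℂ] X).toPMap ⊤ ∧
      ‖T‖ ≤ C * (logSobNorm β (fun l => f l)).toReal

/-- `T = f(A)` in the sense of continuous extension: `T` is the norm limit of operators `g_k(A)` of
the holomorphic calculus, where `g_k → f` in the norm of `{f : f ∘ exp ∈ W^β_2(ℝ)}`. -/
def IsSobCalc (A : X →ₗ.[ℂ] X) (β : ℝ) (f : ℝ → ℂ) (T : X →L[ℂ] X) : Prop :=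
  ∃ (g : ℕ → ℂ → ℂ) (S : ℕ → X →L[ℂ] X),
    (∀ k, IsHInf (g k)) ∧ (∀ k, logSobNorm β (fun l => g k l) < ∞) ∧
    (∀ k, holCalc A (g k) = (S k : X →ₗ[ℂ] X).toPMap ⊤) ∧
    Tendsto (fun k => logSobNorm β (fun l => g k l - f l)) atTop (𝓝 0) ∧
    Tendsto S atTop (𝓝 T)

open Classical in
/-- The bounded operator `f(A)` for `f ∘ exp ∈ W^β_2(ℝ)`. -/
def sobCalc (A : X →ₗ.[ℂ] X) (β : ℝ) (f : ℝ → ℂ) : X →L[ℂ] X :=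
  if h : ∃ T, IsSobCalc A β f T then h.choose else 0

/-- `ψ` generates a dyadic partition of unity: `ψ ∈ C_c^∞`, `supp ψ ⊆ [1/2, 2]` and
`∑_{n ∈ ℤ} ψ(2⁻ⁿ t) = 1` for `t > 0`. -/
structure IsDyadic (ψ : ℝ → ℂ) : Prop where
  smooth : ContDiff ℝ (⊤ : ℕ∞) ψ
  supp : tsupport ψ ⊆ Set.Icc (1 / 2) 2
  sum_eq_one : ∀ t : ℝ, 0 < t → HasSum (fun n : ℤ => ψ ((2 : ℝ) ^ (-n) * t)) 1

/-- The `n`-th member `ψ_n = ψ(2⁻ⁿ ·)` of the partition. -/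
def dyad (ψ : ℝ → ℂ) (n : ℤ) (l : ℝ) : ℂ := ψ ((2 : ℝ) ^ (-n) * l)

/-- The calculus core `D_A = {x : ∃ N, ψ_n(A) x = 0 for |n| ≥ N}`. -/
def calcCore (A : X →ₗ.[ℂ] X) (β : ℝ) (ψ : ℝ → ℂ) : Submodule ℂ X where
  carrier := {x | ∃ N : ℕ, ∀ n : ℤ, (N : ℤ) ≤ |n| → sobCalc A β (dyad ψ n) x = 0}
  add_mem' := by
    rintro x y ⟨N, hN⟩ ⟨M, hM⟩
    refine ⟨max N M, fun n hn => ?_⟩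
    push_cast at hn
    rw [map_add, hN n (le_trans (le_max_left _ _) hn), hM n (le_trans (le_max_right _ _) hn),
      add_zero]
  zero_mem' := ⟨0, fun n _ => map_zero _⟩
  smul_mem' := by
    rintro c x ⟨N, hN⟩
    exact ⟨N, fun n hn => by rw [map_smul, hN n hn, smul_zero]⟩

/-- The graph of the operator `D_A → X`, `x ↦ ∑_{n ∈ ℤ} (f ψ_n)(A) x` (a finite sum). -/
def coreGraph (A : X →ₗ.[ℂ] X) (β : ℝ) (ψ : ℝ → ℂ) (f : ℝ → ℂ) : Submodule ℂ (X × X) where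
  carrier := {p | p.1 ∈ calcCore A β ψ ∧ ∃ N : ℕ, ∀ K : ℕ, N ≤ K →
    ∑ n ∈ Finset.Icc (-(K : ℤ)) K, sobCalc A β (fun l => f l * dyad ψ n l) p.1 = p.2}
  add_mem' := by
    rintro p q ⟨hp, N, hN⟩ ⟨hq, M, hM⟩
    refine ⟨add_mem hp hq, max N M, fun K hK => ?_⟩
    simp only [Prod.fst_add, Prod.snd_add, map_add, Finset.sum_add_distrib]
    rw [hN K (le_trans (le_max_left _ _) hK), hM K (le_trans (le_max_right _ _) hK)]
  zero_mem' := ⟨zero_mem _, 0, fun K _ => by simp⟩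
  smul_mem' := by
    rintro c p ⟨hp, N, hN⟩
    refine ⟨Submodule.smul_mem _ c hp, N, fun K hK => ?_⟩
    simp only [Prod.smul_fst, Prod.smul_snd, map_smul, ← Finset.smul_sum]
    rw [hN K hK]

/-- The unbounded operator `f(A)`, for `f ∘ exp` locally in `W^β_2`: the closure of
`D_A → X`, `x ↦ ∑_{n ∈ ℤ} (f ψ_n)(A) x`. -/
def unbddCalc (A : X →ₗ.[ℂ] X) (β : ℝ) (ψ : ℝ → ℂ) (f : ℝ → ℂ) : X →ₗ.[ℂ] X :=
  (coreGraph A β ψ f).topologicalClosure.toLinearPMap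

open Classical in
/-- The value `P x` of an unbounded operator, with value `0` outside of the domain. -/
def opVal (P : X →ₗ.[ℂ] X) (x : X) : X := if h : x ∈ P.domain then P ⟨x, h⟩ else 0

/-- The function `l ↦ (s l)^{1/2 - α} (e^{ε i s l} - 1)^m` on `(0, ∞)`. -/
def waveFun (ε α : ℝ) (m : ℕ) (s l : ℝ) : ℂ :=
  (((s * l) ^ (1 / 2 - α) : ℝ) : ℂ) * (Complex.exp (ε * Complex.I * s * l) - 1) ^ m

/-- The regularized wave operator `(sA)^{1/2 - α} (e^{ε i s A} - 1)^m`. -/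
def waveOp (A : X →ₗ.[ℂ] X) (β : ℝ) (ψ : ℝ → ℂ) (ε α : ℝ) (m : ℕ) (s : ℝ) : X →ₗ.[ℂ] X :=
  unbddCalc A β ψ (waveFun ε α m s)

/-! ### Mellin transform -/

/-- The measure `ds / s` on `(0, ∞)`. -/
def haarPos : Measure ℝ :=
  (volume.restrict (Set.Ioi 0)).withDensity (fun s => ENNReal.ofReal s⁻¹)

/-- `G = M F` for the Mellin transform `M : L²((0, ∞), ds/s) → L²(ℝ, dt)`,
`(M F)(t) = ∫_0^∞ F(s) s^{it} ds/s`; the integral is the `L²`-limit of its truncations to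
`(R⁻¹, R]`. -/
structure IsMellinL2 (F G : ℝ → ℂ) : Prop where
  memLp_left : MemLp F 2 haarPos
  memLp_right : MemLp G 2 volume
  tendsto : Tendsto (fun R : ℝ => eLpNorm (fun t : ℝ =>
    mellin ((Set.Ioc R⁻¹ R).indicator F) (Complex.I * t) - G t) 2 volume) atTop (𝓝 0)

/-- The bracket `⟨t⟩ = √(1 + t²)`. -/
def bracket (t : ℝ) : ℝ := Real.sqrt (1 + t ^ 2)

/-- `f_m(z) = ∑_{k=1}^m C(m,k) (-1)^{m-k} k^{-z}`. -/
def fSum (m : ℕ) (z : ℂ) : ℂ :=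
  ∑ k ∈ Finset.Icc 1 m, (m.choose k : ℂ) * (-1) ^ (m - k) * (k : ℂ) ^ (-z)

/-- The function `h` belonging to `e^{ε i s A}`, `ε = ±1`. With `z = 1/2 - α + it`, the product
`Γ(z) f_m(z)` is only to be read as its continuous extension if `t = 0` and `α - 1/2` is an
integer (a removable singularity); the value there is irrelevant for the `L²` identity, and Lean's
value is `0`. -/
def hFun (ε α : ℝ) (m : ℕ) (t : ℝ) : ℂ :=
  Complex.exp (ε * Complex.I * (Real.pi / 2) * (1 / 2 - α)) *
    Complex.exp (-(ε * (Real.pi / 2) * t)) *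
    Complex.Gamma (1 / 2 - α + Complex.I * t) * fSum m (1 / 2 - α + Complex.I * t)

end WaveBIP

end

/-!
In the coordinate `x = log λ` dilations become translations, `A^{it}` becomes multiplication by
`e^{itx}`, and the theorem becomes a statement on Fourier transforms: with `w(s) = s^{1/2-α}
(e^{εis} - 1)^m` and `W = w ∘ exp`, the operators `w(sA)`, `s = e^y`, are superpositions `W(y + ·)
= ∫ Ŵ(ξ) e^{2πiξ(y + ·)} dξ` of imaginary powers, so the Fourier transform in `y` of `⟨w(e^y A) x,
x'⟩` should be `Ŵ(ξ) ⟨A^{2πiξ} x, x'⟩`, and `Ŵ` is the function `h` up to scaling.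

*The calculus.* All contours are the imaginary axis, and the only contour argument is Cauchy's
theorem for the right half plane (`axisInt_eq_zero`). It gives `ρ(A)` as a Cauchy integral
(`cauchyCalc_rho`) and the product rule `ρ(A/b) f(A) = (ρ(·/b) f)(A)` for the single functions
`ρ(·/b)` (`rhoDil_mul_cauchyCalc`). This is enough, because the translates of `κ = ρ ∘ exp` span a
dense subspace of the Sobolev space (`topologicalClosure_span_kappa`): the Fourier transform of
`κ` is the beta integral `Γ(1 - 2πiξ) Γ(1 + 2πiξ)`, which has no zeros (`fourier_kappa_ne_zero`).
Hence the bounded Sobolev calculus yields a multiplicative, Sobolev-continuous map `Φ` on Schwartz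
functions (`exists_isSobRep`). A vector `x` of the core is fixed by `Φ(φ)` for some `φ` of compact
support, a finite sum of members of the partition of unity, and therefore `w(e^y A) x = Φ(W(y + ·)
φ) x` and `A^{2πiξ} x = Φ(e^{2πiξ·} φ) x` (`IsSobRep.exists_localization`,
`IsSobRep.exists_core_rep`). In the same way `Φ(η) f(A) x = Φ(η (f ∘ exp)) x` for `η` of compact
support, and since these `Φ(η)` separate the points of `X`, the operators `f(A)` are closable on
the core (`IsSobRep.unbddCalc_single`).

*The function `h`.* Euler's integral, continued analytically, gives the Mellin transform of the
damped function `e^{-δs} (e^{εis} - 1)^m` (`mellin_damped`), and the limit `δ → 0` identifies `h`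
as the Mellin transform of `w` (`mellin_wave`, `mellin_wave_eq_hFun`); as `α > 1/2` and `m > α -
1/2`, the function `W` is integrable and `Ŵ(ξ) = h(-2πξ)` for `ξ ≠ 0` (`fourier_waveLog`). The
decay of `h` is Stirling's bound `|Γ(σ + it)| ≤ C |t|^{σ-1/2} e^{-π|t|/2}`. On `Re z = 1/2` it
follows from the reflection formula (`norm_Gamma_half_le`), on `Re z = 3/2` from the functional
equation, between these lines from the Phragmén–Lindelöf principle (`norm_Gamma_strip_le`), and
further to the left again from the functional equation (`exists_norm_Gamma_le`,
`exists_norm_hFun_le`).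

*The Fourier pair.* Fix `x` and `x'`. The functional `L(η) = ⟨Φ(η) x, x'⟩` is continuous for the
Sobolev norm, hence `L(η) = ∫ η̂ v` with a function `v` of at most weighted `L²` growth
(`exists_density`), and `L` may be interchanged with integrals. Testing against functions of
compact support in `y`, one finds that `F(y) = L(W(y + ·) φ)` and `H(ξ) = Ŵ(ξ) L(e^{2πiξ·} φ)`
form a Fourier pair in the sense of distributions (`integral_mul_functional_family`). Either of
the two weak `L²` bounds puts one of them into `L²`, the first one by the decay of `h`; then both
are in `L²` and form a Fourier pair there (`fourier_pair_of_memLp`). By Plancherel's theorem the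
truncated Mellin integrals converge in `L²` to `H`, after the change of variables `t = -2πξ`
(`isMellinL2_of_fourier`).
-/

namespace WaveBIP

/-! ### Integrals over the imaginary axis -/

section AxisIntegral

variable {E : Type*} [NormedAddCommGroup E]

/-- The closed right half plane without the origin. -/
def halfPlane : Set ℂ := {z | 0 ≤ z.re ∧ z ≠ 0}

/-- The imaginary axis without the origin. -/
def punctAxis : Set ℂ := {z | z.re = 0 ∧ z ≠ 0}

theorem punctAxis_subset_halfPlane : punctAxis ⊆ halfPlane := fun _ hz => ⟨hz.1.ge, hz.2⟩

/-- Integrability with respect to arc length over the imaginary axis. -/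
def AxisIntegrable (g : ℂ → E) : Prop :=
  IntegrableOn (fun r : ℝ => g (r * Complex.I)) (Set.Ioi 0) ∧
    IntegrableOn (fun r : ℝ => g (-(r * Complex.I))) (Set.Ioi 0)

theorem ofReal_mul_I_mem_punctAxis {r : ℝ} (hr : 0 < r) : (r * Complex.I : ℂ) ∈ punctAxis := by
  constructor
  · simp
  · simp [hr.ne']

theorem neg_ofReal_mul_I_mem_punctAxis {r : ℝ} (hr : 0 < r) :
    (-(r * Complex.I) : ℂ) ∈ punctAxis := by
  constructor
  · simp
  · simp [hr.ne']

theorem AxisIntegrable.sub {f g : ℂ → E} (hf : AxisIntegrable f) (hg : AxisIntegrable g) :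
    AxisIntegrable (fun z => f z - g z) := ⟨hf.1.sub hg.1, hf.2.sub hg.2⟩

theorem axisIntegrable_of_bound {g : ℂ → E} (hc : ContinuousOn g punctAxis) {C : ℝ}
    (hb : ∀ z ∈ punctAxis, ‖g z‖ ≤ C / (1 + ‖z‖ ^ 2)) : AxisIntegrable g := by
  have key : ∀ u : ℝ → ℂ, Continuous u → (∀ r, 0 < r → u r ∈ punctAxis ∧ ‖u r‖ = r) →
      IntegrableOn (fun r => g (u r)) (Set.Ioi 0) := by
    intro u hu hur
    have hint : IntegrableOn (fun r : ℝ => C * (1 + r ^ 2)⁻¹) (Set.Ioi 0) :=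
      (integrable_inv_one_add_sq.const_mul C).integrableOn
    refine Integrable.mono' hint ?_ ?_
    · refine ContinuousOn.aestronglyMeasurable ?_ measurableSet_Ioi
      exact hc.comp hu.continuousOn fun r hr => (hur r hr).1
    · refine (ae_restrict_iff' measurableSet_Ioi).2 (ae_of_all _ fun r hr => ?_)
      have := hb _ (hur r hr).1
      rwa [(hur r hr).2, div_eq_mul_inv] at this
  refine ⟨key _ (by fun_prop) fun r hr => ⟨ofReal_mul_I_mem_punctAxis hr, ?_⟩,
    key _ (by fun_prop) fun r hr => ⟨neg_ofReal_mul_I_mem_punctAxis hr, ?_⟩⟩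
  · simp [abs_of_pos hr]
  · simp [abs_of_pos hr]

variable [NormedSpace ℂ E]

theorem integral_Ioi_eq_integral_exp (g : ℝ → E) :
    ∫ r in Set.Ioi (0 : ℝ), g r = ∫ x : ℝ, Real.exp x • g (Real.exp x) := by
  have h := integral_image_eq_integral_abs_deriv_smul (s := Set.univ) (f := Real.exp)
    (f' := Real.exp) MeasurableSet.univ (fun x _ => (Real.hasDerivAt_exp x).hasDerivWithinAt)
    Real.exp_injective.injOn g
  rw [Set.image_univ, Real.range_exp] at h
  simpa [abs_of_pos (Real.exp_pos _)] using h

theorem integrableOn_Ioi_iff_integrable_exp (g : ℝ → E) :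
    IntegrableOn g (Set.Ioi 0) ↔ Integrable fun x : ℝ => Real.exp x • g (Real.exp x) := by
  have h := integrableOn_image_iff_integrableOn_abs_deriv_smul (s := Set.univ) (f := Real.exp)
    (f' := Real.exp) MeasurableSet.univ (fun x _ => (Real.hasDerivAt_exp x).hasDerivWithinAt)
    Real.exp_injective.injOn g
  rw [Set.image_univ, Real.range_exp] at h
  simpa [abs_of_pos (Real.exp_pos _), integrableOn_univ] using h

/-- The integral of `g` with respect to arc length over the imaginary axis. -/
noncomputable def axisInt (g : ℂ → E) : E :=
  (∫ r in Set.Ioi (0 : ℝ), g (r * Complex.I)) + ∫ r in Set.Ioi (0 : ℝ), g (-(r * Complex.I))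

theorem axisInt_congr {f g : ℂ → E} (h : ∀ z ∈ punctAxis, f z = g z) :
    axisInt f = axisInt g := by
  unfold axisInt
  congr 1
  · exact setIntegral_congr_fun measurableSet_Ioi fun r hr => h _ (ofReal_mul_I_mem_punctAxis hr)
  · exact setIntegral_congr_fun measurableSet_Ioi fun r hr =>
      h _ (neg_ofReal_mul_I_mem_punctAxis hr)

theorem axisInt_add {f g : ℂ → E} (hf : AxisIntegrable f) (hg : AxisIntegrable g) :
    axisInt (fun z => f z + g z) = axisInt f + axisInt g := by
  unfold axisInt
  rw [integral_add hf.1 hg.1, integral_add hf.2 hg.2]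
  abel

theorem axisInt_sub {f g : ℂ → E} (hf : AxisIntegrable f) (hg : AxisIntegrable g) :
    axisInt (fun z => f z - g z) = axisInt f - axisInt g := by
  unfold axisInt
  rw [integral_sub hf.1 hg.1, integral_sub hf.2 hg.2]
  abel

theorem axisInt_smul (c : ℂ) (f : ℂ → E) : axisInt (fun z => c • f z) = c • axisInt f := by
  unfold axisInt
  rw [integral_smul, integral_smul, smul_add]

theorem axisInt_comp_neg (f : ℂ → E) : axisInt (fun z => f (-z)) = axisInt f := by
  unfold axisInt
  simp only [neg_neg]
  abel

theorem axisInt_clm {F : Type*} [NormedAddCommGroup F] [NormedSpace ℂ F] [CompleteSpace E]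
    [CompleteSpace F] (T : E →L[ℂ] F) {f : ℂ → E} (hf : AxisIntegrable f) :
    axisInt (fun z => T (f z)) = T (axisInt f) := by
  unfold axisInt
  rw [map_add, ← T.integral_comp_comm hf.1, ← T.integral_comp_comm hf.2]

theorem AxisIntegrable.clm {F : Type*} [NormedAddCommGroup F] [NormedSpace ℂ F]
    (T : E →L[ℂ] F) {f : ℂ → E} (hf : AxisIntegrable f) :
    AxisIntegrable (fun z => T (f z)) :=
  ⟨T.integrable_comp hf.1, T.integrable_comp hf.2⟩

theorem exp_div_one_add_exp_sq_le (x : ℝ) :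
    Real.exp x / (1 + Real.exp x ^ 2) ≤ Real.exp (-|x|) := by
  rw [div_le_iff₀ (by positivity)]
  rcases abs_cases x with ⟨h, _⟩ | ⟨h, _⟩ <;> rw [h]
  · have h1 : Real.exp (-x) * Real.exp x = 1 := by rw [← Real.exp_add]; simp
    have : Real.exp (-x) * (1 + Real.exp x ^ 2) = Real.exp (-x) + Real.exp x := by
      linear_combination Real.exp x * h1
    rw [this]
    linarith [Real.exp_pos (-x)]
  · rw [neg_neg]
    nlinarith [Real.exp_pos x, pow_pos (Real.exp_pos x) 3]

/-- Cauchy's theorem for the right half plane. In the coordinate `w = log z` it is the limit of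
Cauchy's theorem for the rectangles `|Re w| ≤ T`, `|Im w| ≤ π / 2`. -/
theorem axisInt_eq_zero [CompleteSpace E] {g : ℂ → E} (hc : ContinuousOn g halfPlane)
    (hd : DifferentiableOn ℂ g {z | 0 < z.re}) {C : ℝ}
    (hb : ∀ z ∈ halfPlane, ‖g z‖ ≤ C / (1 + ‖z‖ ^ 2)) : axisInt g = 0 := by
  set G : ℂ → E := fun w => Complex.exp w • g (Complex.exp w) with hG
  have hint := axisIntegrable_of_bound (hc.mono punctAxis_subset_halfPlane)
    fun z hz => hb z (punctAxis_subset_halfPlane hz)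
  have hC : 0 ≤ C := by
    have h1 := (norm_nonneg _).trans (hb 1 ⟨by simp, one_ne_zero⟩)
    norm_num at h1
    linarith
  -- the strip is mapped to the half plane
  have hmem : ∀ w : ℂ, |w.im| ≤ Real.pi / 2 → Complex.exp w ∈ halfPlane := by
    intro w hw
    refine ⟨?_, Complex.exp_ne_zero _⟩
    rw [Complex.exp_re]
    exact mul_nonneg (Real.exp_pos _).le (Real.cos_nonneg_of_mem_Icc (abs_le.1 hw))
  have hmem' : ∀ w : ℂ, |w.im| < Real.pi / 2 → 0 < (Complex.exp w).re := by
    intro w hw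
    rw [Complex.exp_re]
    exact mul_pos (Real.exp_pos _) (Real.cos_pos_of_mem_Ioo (abs_lt.1 hw))
  have hGb : ∀ w : ℂ, |w.im| ≤ Real.pi / 2 → ‖G w‖ ≤ C * Real.exp (-|w.re|) := by
    intro w hw
    have h1 := hb _ (hmem w hw)
    rw [Complex.norm_exp] at h1
    rw [hG, norm_smul, Complex.norm_exp]
    calc Real.exp w.re * ‖g (Complex.exp w)‖
        ≤ Real.exp w.re * (C / (1 + Real.exp w.re ^ 2)) := by gcongr
      _ = C * (Real.exp w.re / (1 + Real.exp w.re ^ 2)) := by ring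
      _ ≤ _ := by gcongr; exact exp_div_one_add_exp_sq_le _
  have hpi : -(Real.pi / 2) ≤ Real.pi / 2 := by linarith [Real.pi_pos]
  have hrect : ∀ T : ℝ, 0 ≤ T →
      (∫ x : ℝ in -T..T, G (x + (-(Real.pi / 2) : ℝ) * Complex.I)) -
        (∫ x : ℝ in -T..T, G (x + (Real.pi / 2 : ℝ) * Complex.I)) +
        Complex.I • (∫ y : ℝ in -(Real.pi / 2)..(Real.pi / 2), G ((T : ℝ) + y * Complex.I)) -
        Complex.I • (∫ y : ℝ in -(Real.pi / 2)..(Real.pi / 2), G ((-T : ℝ) + y * Complex.I))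
        = 0 := by
    intro T hT
    have h := Complex.integral_boundary_rect_eq_zero_of_continuousOn_of_differentiableOn G
      (⟨-T, -(Real.pi / 2)⟩ : ℂ) (⟨T, Real.pi / 2⟩ : ℂ) ?_ ?_
    · simpa only using h
    · have : Set.MapsTo Complex.exp
          (Set.uIcc (-T) T ×ℂ Set.uIcc (-(Real.pi / 2)) (Real.pi / 2)) halfPlane := by
        intro w hw
        rw [Complex.mem_reProdIm, Set.uIcc_of_le hpi] at hw
        exact hmem w (abs_le.2 hw.2)
      exact Complex.continuous_exp.continuousOn.smul
        (hc.comp Complex.continuous_exp.continuousOn this)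
    · have : Set.MapsTo Complex.exp (Set.Ioo (min (-T) T) (max (-T) T) ×ℂ
          Set.Ioo (min (-(Real.pi / 2)) (Real.pi / 2)) (max (-(Real.pi / 2)) (Real.pi / 2)))
          {z | 0 < z.re} := by
        intro w hw
        rw [Complex.mem_reProdIm, min_eq_left hpi, max_eq_right hpi] at hw
        exact hmem' w (abs_lt.2 hw.2)
      exact Complex.differentiable_exp.differentiableOn.smul
        (hd.comp Complex.differentiable_exp.differentiableOn this)
  have hvert : ∀ T : ℝ, ‖∫ y : ℝ in -(Real.pi / 2)..(Real.pi / 2), G ((T : ℝ) + y * Complex.I)‖ ≤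
      C * Real.exp (-|T|) * Real.pi := by
    intro T
    have := intervalIntegral.norm_integral_le_of_norm_le_const
      (f := fun y : ℝ => G ((T : ℝ) + y * Complex.I)) (a := -(Real.pi / 2)) (b := Real.pi / 2)
      (C := C * Real.exp (-|T|)) ?_
    · refine this.trans (le_of_eq ?_)
      rw [sub_neg_eq_add, add_halves, abs_of_pos Real.pi_pos]
    · intro y hy
      rw [Set.uIoc_of_le hpi] at hy
      have := hGb (T + y * Complex.I) (by simpa [abs_le] using ⟨hy.1.le, hy.2⟩)
      simpa using this
  have hexp : Tendsto (fun T : ℝ => C * Real.exp (-|T|) * Real.pi) atTop (𝓝 0) := by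
    have h0 : Tendsto (fun T : ℝ => Real.exp (-|T|)) atTop (𝓝 0) :=
      Real.tendsto_exp_neg_atTop_nhds_zero.comp tendsto_abs_atTop_atTop
    simpa using (h0.const_mul C).mul_const Real.pi
  have hv1 := squeeze_zero_norm hvert hexp
  have hv2 : Tendsto (fun T : ℝ => ∫ y : ℝ in -(Real.pi / 2)..(Real.pi / 2),
      G ((-T : ℝ) + y * Complex.I)) atTop (𝓝 0) :=
    squeeze_zero_norm (fun T => by simpa using hvert (-T)) hexp
  -- on the sides `Im x = ± π / 2` of the rectangle, `exp` takes its values on the imaginary axis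
  have hexpI : ∀ x : ℝ, Complex.exp (x + (Real.pi / 2 : ℝ) * Complex.I) =
      Real.exp x * Complex.I := by
    intro x
    rw [Complex.exp_add, Complex.exp_mul_I]
    simp
  have hexpI' : ∀ x : ℝ, Complex.exp (x + (-(Real.pi / 2) : ℝ) * Complex.I) =
      -(Real.exp x * Complex.I) := by
    intro x
    rw [Complex.exp_add, Complex.exp_mul_I]
    simp
  have hint1 := (integrableOn_Ioi_iff_integrable_exp _).1 hint.1
  have hint2 := (integrableOn_Ioi_iff_integrable_exp _).1 hint.2
  have hG1 : ∀ x : ℝ, G (x + (Real.pi / 2 : ℝ) * Complex.I) =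
      Complex.I • (Real.exp x • g (Real.exp x * Complex.I)) := by
    intro x
    simp only [hG]
    rw [hexpI, ← Complex.coe_smul, smul_smul, mul_comm]
  have hG2 : ∀ x : ℝ, G (x + (-(Real.pi / 2) : ℝ) * Complex.I) =
      (-Complex.I) • (Real.exp x • g (-(Real.exp x * Complex.I))) := by
    intro x
    simp only [hG]
    rw [hexpI', ← Complex.coe_smul, smul_smul]
    congr 1
    ring
  have hl1 := intervalIntegral_tendsto_integral (hint1.smul Complex.I)
    tendsto_neg_atTop_atBot tendsto_id
  have hl2 := intervalIntegral_tendsto_integral (hint2.smul (-Complex.I))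
    tendsto_neg_atTop_atBot tendsto_id
  have hlim := ((hl2.sub hl1).add (hv1.const_smul Complex.I)).sub (hv2.const_smul Complex.I)
  simp only [hG1, hG2] at hrect
  have h0 : (0 : E) = _ := tendsto_nhds_unique (tendsto_const_nhds.congr' (by
    filter_upwards [eventually_ge_atTop 0] with T hT
    exact (hrect T hT).symm)) hlim
  simp only [Pi.smul_apply, integral_smul] at h0
  rw [← integral_Ioi_eq_integral_exp (fun r : ℝ => g (r * Complex.I)),
    ← integral_Ioi_eq_integral_exp (fun r : ℝ => g (-(r * Complex.I)))] at h0
  have h1 : (-Complex.I) • axisInt g = 0 := by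
    rw [h0, axisInt, smul_add]
    simp only [smul_zero, add_zero, sub_zero, neg_smul]
    abel
  simpa using h1

end AxisIntegral

/-! ### Resolvents -/

section Resolvent

variable {X : Type*} [NormedAddCommGroup X] [NormedSpace ℂ X] {A : X →ₗ.[ℂ] X}

/-- The resolvent identity. -/
theorem IsResolventAt.sub_eq {z w : ℂ} {R S : X →L[ℂ] X} (hR : IsResolventAt A z R)
    (hS : IsResolventAt A w S) : R - S = (w - z) • (R * S) := by
  ext x
  obtain ⟨h, hx⟩ := hS.1 x
  have h1 := hR.2 ⟨S x, h⟩
  have h2 : z • S x - A ⟨S x, h⟩ = x - (w - z) • S x := by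
    have h3 : w • S x - A ⟨S x, h⟩ - (w - z) • S x = x - (w - z) • S x := by rw [hx]
    rw [← h3]
    module
  simp only at h1
  rw [h2, map_sub, map_smul] at h1
  simp only [sub_apply, smul_apply, mul_apply_eq_comp]
  rw [sub_eq_iff_eq_add, add_comm]
  exact sub_eq_iff_eq_add.1 h1

theorem sector_subset {ω : ℝ} (hω : ω ≤ Real.pi) :
    closure (sector ω) ⊆ {z | ‖z‖ * Real.cos ω ≤ z.re} := by
  refine closure_minimal ?_ (isClosed_le (by fun_prop) (by fun_prop))
  rintro z ⟨hz, hz'⟩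
  have h1 : Real.cos ω ≤ Real.cos z.arg := by
    rw [← Real.cos_abs z.arg]
    exact Real.cos_le_cos_of_nonneg_of_le_pi (abs_nonneg _) hω hz'.le
  have h2 : z.re = ‖z‖ * Real.cos z.arg := by
    rw [Complex.cos_arg hz]
    field_simp [norm_ne_zero_iff.2 hz]
  rw [Set.mem_ofPred_eq, h2]
  gcongr

theorem notMem_closure_sector {z : ℂ} (hz : z.re ≤ 0) (hz0 : z ≠ 0) {ω : ℝ} (h0 : 0 ≤ ω)
    (hω : ω < Real.pi / 2) : z ∉ closure (sector ω) := by
  intro h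
  have h1 := sector_subset (by linarith [Real.pi_pos]) h
  have h2 : 0 < Real.cos ω := Real.cos_pos_of_mem_Ioo ⟨by linarith [Real.pi_pos], hω⟩
  have h3 : 0 < ‖z‖ := norm_pos_iff.2 hz0
  have : 0 < ‖z‖ * Real.cos ω := by positivity
  simp only [Set.mem_ofPred_eq] at h1
  linarith

theorem IsZeroSectorial.isResolventAt (hA : IsZeroSectorial A) {z : ℂ} (hz : z.re ≤ 0)
    (hz0 : z ≠ 0) : IsResolventAt A z (resolventOp A z) := by
  have h1 := (hA (Real.pi / 4) ⟨by positivity, by linarith [Real.pi_pos]⟩).spectrum_subset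
  have h2 : z ∉ opSpectrum A := fun h =>
    notMem_closure_sector hz hz0 (by positivity) (by linarith [Real.pi_pos]) (h1 h)
  have h3 : ∃ R, IsResolventAt A z R := by simpa [opSpectrum] using h2
  rw [resolventOp, dif_pos h3]
  exact h3.choose_spec

theorem IsZeroSectorial.exists_bound (hA : IsZeroSectorial A) :
    ∃ C : ℝ, 0 < C ∧ ∀ z : ℂ, z.re ≤ 0 → z ≠ 0 → ‖resolventOp A z‖ ≤ C / ‖z‖ := by
  obtain ⟨C, hC, h⟩ := (hA (Real.pi / 8) ⟨by positivity, by linarith [Real.pi_pos]⟩).resolvent_bound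
    (Real.pi / 4) (by linarith [Real.pi_pos])
  refine ⟨C, hC, fun z hz hz0 => ?_⟩
  have := h z (notMem_closure_sector hz hz0 (by positivity) (by linarith [Real.pi_pos]))
  rwa [norm_smul, mul_comm, ← le_div_iff₀ (norm_pos_iff.2 hz0)] at this

theorem IsZeroSectorial.resolvent_sub (hA : IsZeroSectorial A) {z w : ℂ} (hz : z.re ≤ 0)
    (hz0 : z ≠ 0) (hw : w.re ≤ 0) (hw0 : w ≠ 0) :
    resolventOp A z - resolventOp A w = (w - z) • (resolventOp A z * resolventOp A w) :=
  (hA.isResolventAt hz hz0).sub_eq (hA.isResolventAt hw hw0)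

theorem IsZeroSectorial.resolvent_commute (hA : IsZeroSectorial A) {z w : ℂ} (hz : z.re ≤ 0)
    (hz0 : z ≠ 0) (hw : w.re ≤ 0) (hw0 : w ≠ 0) :
    Commute (resolventOp A z) (resolventOp A w) := by
  rcases eq_or_ne z w with rfl | hne
  · exact Commute.refl _
  have h1 := hA.resolvent_sub hz hz0 hw hw0
  have h2 := hA.resolvent_sub hw hw0 hz hz0
  have h3 : (w - z) • (resolventOp A z * resolventOp A w) =
      (w - z) • (resolventOp A w * resolventOp A z) := by
    rw [← h1, ← neg_sub, h2, ← neg_smul, neg_sub]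
  exact smul_right_injective _ (sub_ne_zero.2 hne.symm) h3

theorem IsZeroSectorial.continuousOn_resolvent (hA : IsZeroSectorial A) :
    ContinuousOn (resolventOp A) {z | z.re ≤ 0 ∧ z ≠ 0} := by
  obtain ⟨C, hC, hb⟩ := hA.exists_bound
  intro w hw
  have hw0 : 0 < ‖w‖ := norm_pos_iff.2 hw.2
  rw [ContinuousWithinAt, tendsto_iff_norm_sub_tendsto_zero]
  have hlim : Tendsto (fun z : ℂ => ‖w - z‖ * (C / ‖z‖ * (C / ‖w‖)))
      (𝓝[{z | z.re ≤ 0 ∧ z ≠ 0}] w) (𝓝 0) := by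
    have : ContinuousAt (fun z : ℂ => ‖w - z‖ * (C / ‖z‖ * (C / ‖w‖))) w := by
      have : ‖w‖ ≠ 0 := hw0.ne'
      fun_prop (disch := assumption)
    simpa using this.tendsto.mono_left nhdsWithin_le_nhds
  refine squeeze_zero' (Eventually.of_forall fun _ => norm_nonneg _) ?_ hlim
  filter_upwards [self_mem_nhdsWithin] with z hz
  rw [hA.resolvent_sub hz.1 hz.2 hw.1 hw.2, norm_smul]
  gcongr
  refine (norm_mul_le _ _).trans ?_
  gcongr
  · exact hb z hz.1 hz.2
  · exact hb w hw.1 hw.2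

theorem IsZeroSectorial.hasDerivAt_resolvent (hA : IsZeroSectorial A) {w : ℂ} (hw : w.re < 0) :
    HasDerivAt (resolventOp A) (-(resolventOp A w * resolventOp A w)) w := by
  have hw0 : ∀ z : ℂ, z.re < 0 → z ≠ 0 := by
    rintro z hz rfl
    simp at hz
  have hopen : {z : ℂ | z.re < 0} ∈ 𝓝 w :=
    (isOpen_lt Complex.continuous_re continuous_const).mem_nhds hw
  have hcont : ContinuousAt (resolventOp A) w := by
    refine hA.continuousOn_resolvent.continuousAt ?_
    filter_upwards [hopen] with z hz using ⟨hz.le, hw0 z hz⟩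
  rw [hasDerivAt_iff_tendsto_slope]
  have hlim : Tendsto (fun z => -(resolventOp A z * resolventOp A w)) (𝓝[≠] w)
      (𝓝 (-(resolventOp A w * resolventOp A w))) :=
    ((hcont.tendsto.mul_const _).neg).mono_left nhdsWithin_le_nhds
  refine hlim.congr' ?_
  filter_upwards [mem_nhdsWithin_of_mem_nhds hopen, self_mem_nhdsWithin] with z hz hne
  rw [slope_def_module, hA.resolvent_sub (le_of_lt hz) (hw0 z hz) hw.le (hw0 w hw), smul_smul]
  have : z - w ≠ 0 := sub_ne_zero.2 hne
  rw [show (z - w)⁻¹ * (w - z) = -1 by field_simp; ring, neg_one_smul]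

theorem IsZeroSectorial.resolvent_injective (hA : IsZeroSectorial A) {z : ℂ} (hz : z.re ≤ 0)
    (hz0 : z ≠ 0) {x : X} (hx : resolventOp A z x = 0) : x = 0 := by
  obtain ⟨h, h'⟩ := (hA.isResolventAt hz hz0).1 x
  have : (⟨resolventOp A z x, h⟩ : A.domain) = 0 := Subtype.ext hx
  rw [this, hx] at h'
  simpa using h'.symm

/-- A `0`-sectorial operator is injective: `λ (λ + A)⁻¹` tends strongly to `0` on the dense range
of `A` as `λ → 0+`, and fixes the kernel of `A`. -/
theorem IsZeroSectorial.injective (hA : IsZeroSectorial A) {x : A.domain} (hx : A x = 0) :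
    (x : X) = 0 := by
  obtain ⟨C, hC, hb⟩ := hA.exists_bound
  have hre : ∀ l : ℝ, 0 < l → (-(l : ℂ)).re ≤ 0 := fun l hl => by simpa using hl.le
  have hne : ∀ l : ℝ, 0 < l → (-(l : ℂ)) ≠ 0 := fun l hl => by simpa using hl.ne'
  have hbl : ∀ l : ℝ, 0 < l → ‖resolventOp A (-(l : ℂ))‖ * l ≤ C := by
    intro l hl
    have := hb _ (hre l hl) (hne l hl)
    rwa [norm_neg, Complex.norm_real, Real.norm_of_nonneg hl.le, le_div_iff₀ hl] at this
  -- `x` is an eigenvector of `l (l + A)⁻¹`, with eigenvalue `1`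
  have hker : ∀ l : ℝ, 0 < l → (l : ℂ) • resolventOp A (-(l : ℂ)) x = -(x : X) := by
    intro l hl
    have h := (hA.isResolventAt (hre l hl) (hne l hl)).2 x
    rw [hx, sub_zero, neg_smul, map_neg, map_smul] at h
    exact (neg_eq_iff_eq_neg.1 h)
  -- whereas `l (l + A)⁻¹ y` is of size `O(l)` if `y` is in the range
  have hran : ∀ z : A.domain, ∀ l : ℝ, 0 < l →
      ‖(l : ℂ) • resolventOp A (-(l : ℂ)) (A z)‖ ≤ l * ((C + 1) * ‖(z : X)‖) := by
    intro z l hl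
    have h := (hA.isResolventAt (hre l hl) (hne l hl)).2 z
    rw [map_sub, neg_smul, map_neg, map_smul] at h
    have h2 : resolventOp A (-(l : ℂ)) (A z) =
        -((l : ℂ) • resolventOp A (-(l : ℂ)) z) - z := by
      rw [eq_sub_iff_add_eq, ← eq_sub_iff_add_eq']
      exact h.symm
    rw [norm_smul, Complex.norm_real, Real.norm_of_nonneg hl.le, h2]
    gcongr
    refine (norm_sub_le _ _).trans ?_
    rw [norm_neg, norm_smul, Complex.norm_real, Real.norm_of_nonneg hl.le, add_mul, one_mul]
    refine add_le_add_left ?_ _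
    calc l * ‖resolventOp A (-(l : ℂ)) z‖ ≤ l * (‖resolventOp A (-(l : ℂ))‖ * ‖(z : X)‖) := by
          gcongr
          exact ContinuousLinearMap.le_opNorm _ _
      _ = ‖resolventOp A (-(l : ℂ))‖ * l * ‖(z : X)‖ := by ring
      _ ≤ _ := by gcongr; exact hbl l hl
  have hdense := (hA (Real.pi / 4) ⟨by positivity, by linarith [Real.pi_pos]⟩).dense_range
  rw [← norm_le_zero_iff]
  refine le_of_forall_pos_le_add fun ε hε => ?_
  obtain ⟨_, ⟨z, rfl⟩, hz⟩ := hdense.exists_dist_lt (x : X) (show 0 < ε / (2 * C) by positivity)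
  set l : ℝ := ε / (2 * ((C + 1) * ‖(z : X)‖ + 1)) with hl
  have hlpos : 0 < l := by positivity
  have h1 : -(x : X) = (l : ℂ) • resolventOp A (-(l : ℂ)) (x - A z) +
      (l : ℂ) • resolventOp A (-(l : ℂ)) (A z) := by
    rw [← smul_add, ← map_add, sub_add_cancel, hker l hlpos]
  rw [zero_add, ← norm_neg, h1]
  refine (norm_add_le _ _).trans ?_
  have h2 : ‖(l : ℂ) • resolventOp A (-(l : ℂ)) (x - A z)‖ ≤ ε / 2 := by
    rw [norm_smul, Complex.norm_real, Real.norm_of_nonneg hlpos.le]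
    calc l * ‖resolventOp A (-(l : ℂ)) (x - A z)‖
        ≤ l * (‖resolventOp A (-(l : ℂ))‖ * ‖(x : X) - A z‖) := by
          gcongr
          exact ContinuousLinearMap.le_opNorm _ _
      _ = ‖resolventOp A (-(l : ℂ))‖ * l * ‖(x : X) - A z‖ := by ring
      _ ≤ C * (ε / (2 * C)) := by
          gcongr
          · exact hbl l hlpos
          · rw [← dist_eq_norm]; exact hz.le
      _ = ε / 2 := by field_simp
  have h3 : l * ((C + 1) * ‖(z : X)‖) ≤ ε / 2 := by
    rw [hl, div_mul_eq_mul_div, div_le_div_iff₀ (by positivity) (by norm_num)]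
    nlinarith [norm_nonneg (z : X)]
  linarith [hran z l hlpos]

theorem IsZeroSectorial.rhoOp_injective (hA : IsZeroSectorial A) {x y : X}
    (h : rhoOp A x = rhoOp A y) : x = y := by
  suffices ∀ x, rhoOp A x = 0 → x = 0 by
    rw [← sub_eq_zero]
    exact this _ (by rw [map_sub, h, sub_self])
  intro x hx
  have hre : (-1 : ℂ).re ≤ 0 := by simp
  have hne : (-1 : ℂ) ≠ 0 := by simp
  have h1 : resolventOp A (-1) (x + resolventOp A (-1) x) = 0 := by
    have h2 : -(resolventOp A (-1) (x + resolventOp A (-1) x)) = 0 := by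
      rw [← hx, rhoOp, map_add]
      simp only [sub_apply, neg_apply, ContinuousLinearMap.comp_apply]
      abel
    exact neg_eq_zero.1 h2
  have h3 := hA.resolvent_injective hre hne h1
  obtain ⟨h, h'⟩ := (hA.isResolventAt hre hne).1 x
  have h4 : resolventOp A (-1) x = -x := by
    rw [eq_neg_iff_add_eq_zero, add_comm]
    exact h3
  have h5 : A ⟨resolventOp A (-1) x, h⟩ = 0 := by
    have h6 : (-1 : ℂ) • resolventOp A (-1) x = x := by rw [h4]; simp
    rw [h6] at h'
    simpa using h'
  have h6 := hA.injective h5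
  simp only at h6
  rw [h4] at h6
  simpa using h6

end Resolvent

/-! ### The Cauchy integral over the imaginary axis -/

section CauchyCalc

variable {X : Type*} [NormedAddCommGroup X] [NormedSpace ℂ X] {A : X →ₗ.[ℂ] X}

/-- Functions on the right half plane, holomorphic in the interior and continuous up to the
boundary, which decay like `|z|` at `0` and like `1 / |z|` at `∞`. -/
structure IsDecaying (f : ℂ → ℂ) : Prop where
  continuousOn : ContinuousOn f halfPlane
  differentiableOn : DifferentiableOn ℂ f {z | 0 < z.re}
  bound : ∃ C : ℝ, 0 < C ∧ ∀ z ∈ halfPlane, ‖f z‖ ≤ C * (‖z‖ / (1 + ‖z‖ ^ 2))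

/-- For the contour angle `π / 2` the Cauchy integral runs over the imaginary axis. -/
theorem cauchyCalc_eq (A : X →ₗ.[ℂ] X) (f : ℂ → ℂ) :
    cauchyCalc A (Real.pi / 2) f =
      (-(2 * Real.pi : ℂ)⁻¹) • axisInt (fun z => f z • resolventOp A z) := by
  have h1 : Complex.exp (((Real.pi / 2 : ℝ) : ℂ) * Complex.I) = Complex.I := by
    rw [Complex.exp_mul_I]; simp
  have h2 : Complex.exp (-(((Real.pi / 2 : ℝ) : ℂ) * Complex.I)) = -Complex.I := by
    rw [Complex.exp_neg, h1, Complex.inv_I]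
  unfold cauchyCalc axisInt
  simp only [h1, h2, mul_neg, neg_mul, neg_smul, mul_smul]
  rw [integral_neg, integral_smul, integral_smul]
  have h3 : (2 * Real.pi * Complex.I : ℂ)⁻¹ = -((2 * Real.pi : ℂ)⁻¹ * Complex.I) := by
    rw [mul_inv, Complex.inv_I]; ring
  rw [h3, ← smul_neg, ← smul_sub, smul_smul,
    show -((2 * Real.pi : ℂ)⁻¹ * Complex.I) * Complex.I = (2 * Real.pi : ℂ)⁻¹ by
      rw [neg_mul, mul_assoc, Complex.I_mul_I]; ring, ← smul_neg]
  congr 1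
  abel

theorem norm_add_pos_sq {z : ℂ} (hz : 0 ≤ z.re) {b : ℝ} (hb : 0 ≤ b) :
    b ^ 2 + ‖z‖ ^ 2 ≤ ‖z + b‖ ^ 2 := by
  rw [Complex.sq_norm, Complex.sq_norm, Complex.normSq_apply, Complex.normSq_apply]
  simp only [Complex.add_re, Complex.ofReal_re, Complex.add_im, Complex.ofReal_im, add_zero]
  nlinarith [mul_nonneg hz hb]

theorem le_norm_add {z : ℂ} (hz : 0 ≤ z.re) {b : ℝ} (hb : 0 ≤ b) : b ≤ ‖z + b‖ := by
  have := norm_add_pos_sq hz hb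
  nlinarith [norm_nonneg (z + b), sq_nonneg ‖z‖]

theorem norm_le_norm_add {z : ℂ} (hz : 0 ≤ z.re) {b : ℝ} (hb : 0 ≤ b) : ‖z‖ ≤ ‖z + b‖ := by
  have := norm_add_pos_sq hz hb
  nlinarith [norm_nonneg (z + b), norm_nonneg z, sq_nonneg b]

theorem add_ofReal_ne_zero {z : ℂ} (hz : 0 ≤ z.re) {b : ℝ} (hb : 0 < b) : z + b ≠ 0 :=
  norm_pos_iff.1 (hb.trans_le (le_norm_add hz hb.le))

theorem IsDecaying.div_add {f : ℂ → ℂ} (hf : IsDecaying f) {b : ℝ} (hb : 0 < b) :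
    IsDecaying (fun z => f z / (z + b)) where
  continuousOn := hf.continuousOn.div (by fun_prop) fun z hz => add_ofReal_ne_zero hz.1 hb
  differentiableOn := hf.differentiableOn.div (by fun_prop) fun z hz =>
    add_ofReal_ne_zero (le_of_lt hz) hb
  bound := by
    obtain ⟨C, hC, h⟩ := hf.bound
    refine ⟨C / b, by positivity, fun z hz => ?_⟩
    rw [norm_div]
    calc ‖f z‖ / ‖z + b‖ ≤ (C * (‖z‖ / (1 + ‖z‖ ^ 2))) / b := by
          gcongr
          · exact h z hz
          · exact le_norm_add hz.1 hb.le
      _ = _ := by ring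

theorem IsDecaying.axisInt_div_add {f : ℂ → ℂ} (hf : IsDecaying f) {b : ℝ} (hb : 0 < b) :
    AxisIntegrable (fun z => f z / (z + b)) ∧ axisInt (fun z => f z / (z + b)) = 0 := by
  have hd := hf.div_add hb
  obtain ⟨C, hC, h⟩ := hf.bound
  have hbd : ∀ z ∈ halfPlane, ‖f z / (z + b)‖ ≤ C / (1 + ‖z‖ ^ 2) := by
    intro z hz
    rw [norm_div, div_le_iff₀ (norm_pos_iff.2 (add_ofReal_ne_zero hz.1 hb))]
    refine (h z hz).trans ?_
    rw [mul_div_assoc', div_mul_eq_mul_div]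
    gcongr
    exact norm_le_norm_add hz.1 hb.le
  exact ⟨axisIntegrable_of_bound (hd.continuousOn.mono punctAxis_subset_halfPlane)
    fun z hz => hbd z (punctAxis_subset_halfPlane hz),
    axisInt_eq_zero hd.continuousOn hd.differentiableOn hbd⟩

theorem IsDecaying.smul {f : ℂ → ℂ} (hf : IsDecaying f) (c : ℂ) :
    IsDecaying (fun z => c * f z) where
  continuousOn := hf.continuousOn.const_smul c
  differentiableOn := hf.differentiableOn.const_smul c
  bound := by
    obtain ⟨C, hC, h⟩ := hf.bound
    refine ⟨(‖c‖ + 1) * C, by positivity, fun z hz => ?_⟩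
    rw [norm_mul, mul_assoc]
    have : 0 ≤ ‖z‖ / (1 + ‖z‖ ^ 2) := by positivity
    gcongr
    · linarith
    · exact h z hz

theorem continuousOn_resolvent_axis (hA : IsZeroSectorial A) :
    ContinuousOn (resolventOp A) punctAxis :=
  hA.continuousOn_resolvent.mono fun _ hz => ⟨hz.1.le, hz.2⟩

theorem IsDecaying.axisIntegrable {f : ℂ → ℂ} (hf : IsDecaying f) (hA : IsZeroSectorial A) :
    AxisIntegrable (fun z => f z • resolventOp A z) := by
  obtain ⟨C, hC, h⟩ := hf.bound
  obtain ⟨D, hD, k⟩ := hA.exists_bound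
  refine axisIntegrable_of_bound (C := C * D) ?_ fun z hz => ?_
  · exact (hf.continuousOn.mono punctAxis_subset_halfPlane).smul (continuousOn_resolvent_axis hA)
  · rw [norm_smul]
    have hz0 : ‖z‖ ≠ 0 := norm_ne_zero_iff.2 hz.2
    calc ‖f z‖ * ‖resolventOp A z‖ ≤ C * (‖z‖ / (1 + ‖z‖ ^ 2)) * (D / ‖z‖) := by
          gcongr
          · exact h z (punctAxis_subset_halfPlane hz)
          · exact k z hz.1.le hz.2
      _ = _ := by field_simp

theorem cauchyCalc_add (hA : IsZeroSectorial A) {f g : ℂ → ℂ} (hf : IsDecaying f)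
    (hg : IsDecaying g) : cauchyCalc A (Real.pi / 2) (fun z => f z + g z) =
      cauchyCalc A (Real.pi / 2) f + cauchyCalc A (Real.pi / 2) g := by
  simp only [cauchyCalc_eq, add_smul]
  rw [axisInt_add (hf.axisIntegrable hA) (hg.axisIntegrable hA), smul_add]

theorem cauchyCalc_smul (c : ℂ) (f : ℂ → ℂ) :
    cauchyCalc A (Real.pi / 2) (fun z => c * f z) = c • cauchyCalc A (Real.pi / 2) f := by
  simp only [cauchyCalc_eq, mul_smul]
  rw [axisInt_smul, smul_comm]

theorem cauchyCalc_congr {f g : ℂ → ℂ} (h : ∀ z ∈ punctAxis, f z = g z) :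
    cauchyCalc A (Real.pi / 2) f = cauchyCalc A (Real.pi / 2) g := by
  simp only [cauchyCalc_eq]
  rw [axisInt_congr fun z hz => by rw [h z hz]]

/-- The operator `ρ(A / b) = b (b + A)⁻¹ - b² (b + A)⁻²`. -/
noncomputable def rhoDil (A : X →ₗ.[ℂ] X) (b : ℝ) : X →L[ℂ] X :=
  -((b : ℂ) • resolventOp A (-b)) -
    ((b : ℂ) ^ 2) • (resolventOp A (-b) * resolventOp A (-b))

theorem rhoDil_one : rhoDil A 1 = rhoOp A := by
  simp [rhoDil, rhoOp, ContinuousLinearMap.mul_def]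

theorem rhoDil_commute (hA : IsZeroSectorial A) {b c : ℝ} (hb : 0 < b) (hc : 0 < c) :
    Commute (rhoDil A b) (rhoDil A c) := by
  have h := hA.resolvent_commute (z := -b) (w := -c) (by simpa using hb.le) (by simpa using hb.ne')
    (by simpa using hc.le) (by simpa using hc.ne')
  unfold rhoDil
  have h1 : Commute (resolventOp A (-b)) (resolventOp A (-c) * resolventOp A (-c)) :=
    h.mul_right h
  have h2 := h.mul_left h
  have h3 := h1.mul_left h1
  exact (((h.smul_left _).neg_left.smul_right _).neg_right.sub_right
    ((h1.smul_left _).neg_left.smul_right _)).sub_left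
    (((h2.smul_left _).smul_right _).neg_right.sub_right ((h3.smul_left _).smul_right _))

theorem norm_rho_le {z : ℂ} (hz : 0 ≤ z.re) : ‖rho z‖ ≤ ‖z‖ / (1 + ‖z‖ ^ 2) := by
  rw [rho, norm_div, norm_pow]
  have := norm_add_pos_sq hz zero_le_one
  rw [Complex.ofReal_one, add_comm z, one_pow] at this
  gcongr

/-- If `f` is bounded and holomorphic on all sectors, then `ρ f` is integrable against the
resolvent. -/
theorem IsHInf.isDecaying {f : ℂ → ℂ} (hf : IsHInf f) : IsDecaying (fun z => rho z * f z) := by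
  obtain ⟨hd, C, hC⟩ := hf (3 * Real.pi / 4) ⟨by positivity, by linarith [Real.pi_pos]⟩
  have hsub : halfPlane ⊆ sector (3 * Real.pi / 4) := fun z hz =>
    ⟨hz.2, (Complex.abs_arg_le_pi_div_two_iff.2 hz.1).trans_lt (by linarith [Real.pi_pos])⟩
  have hrd : ∀ z : ℂ, 0 ≤ z.re → DifferentiableAt ℂ rho z := by
    intro z hz
    have h1 : (1 + z) ^ 2 ≠ 0 := by
      have := add_ofReal_ne_zero hz one_pos
      rw [Complex.ofReal_one, add_comm] at this
      exact pow_ne_zero 2 this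
    unfold rho
    fun_prop (disch := assumption)
  refine ⟨?_, ?_, |C| + 1, by positivity, fun z hz => ?_⟩
  · have h : ContinuousOn rho halfPlane := fun z hz =>
      (hrd z hz.1).continuousAt.continuousWithinAt
    exact h.mul (hd.continuousOn.mono hsub)
  · have h : DifferentiableOn ℂ rho {z | 0 < z.re} := fun z hz =>
      (hrd z (le_of_lt hz)).differentiableWithinAt
    exact h.mul (hd.mono fun z hz => hsub ⟨le_of_lt hz, fun h => by simp [h] at hz⟩)
  · rw [norm_mul, mul_comm]
    gcongr
    · exact (hC z (hsub hz)).trans ((le_abs_self C).trans (by linarith))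
    · exact norm_rho_le hz.1

variable [CompleteSpace X]

/-- `-(b + A)⁻¹ f(A) = -(f / (· + b))(A)`, by the resolvent identity; the remaining term is a
multiple of the scalar integral of `f(z) / (z + b)`, which vanishes by Cauchy's theorem. -/
theorem resolvent_mul_cauchyCalc (hA : IsZeroSectorial A) {f : ℂ → ℂ} (hf : IsDecaying f) {b : ℝ}
    (hb : 0 < b) : resolventOp A (-b) * cauchyCalc A (Real.pi / 2) f =
      -cauchyCalc A (Real.pi / 2) (fun z => f z / (z + b)) := by
  obtain ⟨hi, hzero⟩ := hf.axisInt_div_add hb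
  have hi2 := (hf.div_add hb).axisIntegrable hA
  have hre : (-(b : ℂ)).re ≤ 0 := by simpa using hb.le
  have hne : -(b : ℂ) ≠ 0 := by simpa using hb.ne'
  have h1 := axisInt_clm (ContinuousLinearMap.mul ℂ (X →L[ℂ] X) (resolventOp A (-b)))
    (hf.axisIntegrable hA)
  have h2 : axisInt (fun z => ContinuousLinearMap.mul ℂ (X →L[ℂ] X) (resolventOp A (-b))
      (f z • resolventOp A z)) = axisInt (fun z => (f z / (z + b)) • resolventOp A (-b) -
        (f z / (z + b)) • resolventOp A z) := by
    refine axisInt_congr fun z hz => ?_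
    have h3 := hA.resolvent_sub hre hne hz.1.le hz.2
    rw [← smul_sub, h3, sub_neg_eq_add, smul_smul,
      div_mul_cancel₀ _ (add_ofReal_ne_zero hz.1.ge hb)]
    simp
  have h4 : axisInt (fun z => (f z / (z + b)) • resolventOp A (-b)) = 0 := by
    have := axisInt_clm ((ContinuousLinearMap.id ℂ ℂ).smulRight (resolventOp A (-b))) hi
    simpa [hzero] using this
  have hi3 : AxisIntegrable (fun z => (f z / (z + b)) • resolventOp A (-b)) := by
    simpa using hi.clm ((ContinuousLinearMap.id ℂ ℂ).smulRight (resolventOp A (-b)))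
  rw [axisInt_sub hi3 hi2, h4, zero_sub] at h2
  rw [cauchyCalc_eq, cauchyCalc_eq, mul_smul_comm, ← smul_neg, ← h2, h1]
  simp

/-- The part of the product rule of the holomorphic calculus that the Sobolev calculus needs: one
factor is a dilate of `ρ`. -/
theorem rhoDil_mul_cauchyCalc (hA : IsZeroSectorial A) {f : ℂ → ℂ} (hf : IsDecaying f) {b : ℝ}
    (hb : 0 < b) : rhoDil A b * cauchyCalc A (Real.pi / 2) f =
      cauchyCalc A (Real.pi / 2) (fun z => rho (z / b) * f z) := by
  have h1 := resolvent_mul_cauchyCalc hA hf hb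
  have h2 := resolvent_mul_cauchyCalc hA (hf.div_add hb) hb
  have hfun : cauchyCalc A (Real.pi / 2) (fun z => rho (z / b) * f z) =
      cauchyCalc A (Real.pi / 2) (fun z => (b : ℂ) * (f z / (z + b)) +
        (-(b : ℂ) ^ 2) * (f z / (z + b) / (z + b))) := by
    refine cauchyCalc_congr fun z hz => ?_
    have h3 := add_ofReal_ne_zero hz.1.ge hb
    have h4 : (b : ℂ) ≠ 0 := by exact_mod_cast hb.ne'
    have h5 : 1 + z / b ≠ 0 := by
      rw [one_add_div h4, add_comm]
      exact div_ne_zero h3 h4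
    have h6 : (1 + z / b) = (z + b) / b := by field_simp; ring
    rw [rho, h6]
    field_simp
    ring
  rw [hfun, cauchyCalc_add hA ((hf.div_add hb).smul _) (((hf.div_add hb).div_add hb).smul _),
    cauchyCalc_smul, cauchyCalc_smul, rhoDil, sub_mul, neg_mul, smul_mul_assoc, smul_mul_assoc,
    mul_assoc, h1, mul_neg, h2]
  simp [sub_eq_add_neg]

end CauchyCalc

/-! ### The operators of the holomorphic calculus -/

section HolCalc

variable {X : Type*} [NormedAddCommGroup X] [NormedSpace ℂ X] {A : X →ₗ.[ℂ] X}

theorem sector_subset_slitPlane {ω : ℝ} (hω : ω < Real.pi) : sector ω ⊆ Complex.slitPlane := by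
  intro z hz
  rw [Complex.mem_slitPlane_iff_arg]
  exact ⟨fun h => by have := hz.2; rw [h, abs_of_pos Real.pi_pos] at this; linarith, hz.1⟩

theorem norm_one_add_sq_ge {z : ℂ} {ω : ℝ} (hω : ω < Real.pi) (hz : z ∈ sector ω) :
    (1 + ‖z‖) ^ 2 * ((1 + Real.cos ω) / 2) ≤ ‖1 + z‖ ^ 2 := by
  have h1 := sector_subset hω.le (subset_closure hz)
  simp only [Set.mem_ofPred_eq] at h1
  have h2 : ‖1 + z‖ ^ 2 = 1 + 2 * z.re + ‖z‖ ^ 2 := by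
    rw [Complex.sq_norm, Complex.sq_norm, Complex.normSq_apply, Complex.normSq_apply]
    simp
    ring
  rw [h2]
  nlinarith [mul_nonneg (sub_nonneg.2 (Real.cos_le_one ω)) (sq_nonneg (1 - ‖z‖))]

theorem isHInf_rho : IsHInf rho := by
  intro ω hω
  have hcos : 0 < (1 + Real.cos ω) / 2 := by
    have : Real.cos Real.pi < Real.cos ω :=
      Real.cos_lt_cos_of_nonneg_of_le_pi hω.1.le le_rfl hω.2
    rw [Real.cos_pi] at this
    linarith
  have hpos : ∀ z ∈ sector ω, 0 < ‖1 + z‖ ^ 2 := fun z hz =>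
    lt_of_lt_of_le (by positivity) (norm_one_add_sq_ge hω.2 hz)
  refine ⟨fun z hz => ?_, ((1 + Real.cos ω) / 2)⁻¹, fun z hz => ?_⟩
  · have h1 : (1 + z) ^ 2 ≠ 0 := by
      have := (hpos z hz).ne'
      rw [← norm_pow, norm_ne_zero_iff] at this
      exact this
    unfold rho
    have : DifferentiableAt ℂ (fun z : ℂ => z / (1 + z) ^ 2) z := by
      fun_prop (disch := assumption)
    exact this.differentiableWithinAt
  · rw [rho, norm_div, norm_pow, div_le_iff₀ (hpos z hz)]
    have := norm_one_add_sq_ge hω.2 hz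
    rw [← div_eq_inv_mul, le_div_iff₀ hcos]
    refine le_trans ?_ this
    gcongr
    nlinarith [norm_nonneg z]

theorem IsHInf.comp_div {f : ℂ → ℂ} (hf : IsHInf f) {b : ℝ} (hb : 0 < b) :
    IsHInf (fun z => f (z / b)) := by
  intro ω hω
  obtain ⟨hd, C, hC⟩ := hf ω hω
  have hmaps : Set.MapsTo (fun z : ℂ => z / b) (sector ω) (sector ω) := by
    intro z hz
    refine ⟨div_ne_zero hz.1 (by exact_mod_cast hb.ne'), ?_⟩
    simp only
    have : z / (b : ℂ) = ((b⁻¹ : ℝ) : ℂ) * z := by push_cast; ring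
    rw [this, Complex.arg_real_mul _ (by positivity)]
    exact hz.2
  exact ⟨hd.comp (by fun_prop) hmaps, C, fun z hz => hC _ (hmaps hz)⟩

theorem IsHInf.mul {f g : ℂ → ℂ} (hf : IsHInf f) (hg : IsHInf g) :
    IsHInf (fun z => f z * g z) := by
  intro ω hω
  obtain ⟨hd, C, hC⟩ := hf ω hω
  obtain ⟨hd', D, hD⟩ := hg ω hω
  refine ⟨hd.mul hd', C * D, fun z hz => ?_⟩
  rw [norm_mul]
  exact mul_le_mul (hC z hz) (hD z hz) (norm_nonneg _) ((norm_nonneg _).trans (hC z hz))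

theorem IsHInf.add {f g : ℂ → ℂ} (hf : IsHInf f) (hg : IsHInf g) :
    IsHInf (fun z => f z + g z) := by
  intro ω hω
  obtain ⟨hd, C, hC⟩ := hf ω hω
  obtain ⟨hd', D, hD⟩ := hg ω hω
  exact ⟨hd.add hd', C + D, fun z hz =>
    (norm_add_le _ _).trans (add_le_add (hC z hz) (hD z hz))⟩

theorem isHInf_const (c : ℂ) : IsHInf fun _ => c :=
  fun _ _ => ⟨differentiableOn_const _, ‖c‖, fun _ _ => le_rfl⟩

theorem IsHInf.smul {f : ℂ → ℂ} (hf : IsHInf f) (c : ℂ) : IsHInf (fun z => c * f z) :=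
  (isHInf_const c).mul hf

theorem isHInf_cpow (t : ℝ) : IsHInf fun z => z ^ (Complex.I * t) := by
  intro ω hω
  refine ⟨fun z hz => ?_, Real.exp (ω * |t|), fun z hz => ?_⟩
  · exact (differentiableAt_id.cpow (differentiableAt_const _)
      (sector_subset_slitPlane hω.2 hz)).differentiableWithinAt
  · rw [Complex.norm_cpow_of_ne_zero hz.1]
    simp only [Complex.mul_re, Complex.I_re, Complex.ofReal_re, zero_mul, Complex.I_im,
      Complex.ofReal_im, mul_zero, sub_self, Real.rpow_zero, Complex.mul_im, one_mul, zero_add]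
    rw [one_div, ← Real.exp_neg]
    gcongr
    calc -(z.arg * t) ≤ |z.arg * t| := neg_le_abs _
      _ = |z.arg| * |t| := abs_mul _ _
      _ ≤ ω * |t| := by gcongr; exact hz.2.le

theorem mem_holGraph {f : ℂ → ℂ} {p : X × X} : p ∈ holGraph A f ↔
    cauchyCalc A (Real.pi / 2) (fun z => rho z * f z) p.1 = rhoOp A p.2 := Iff.rfl

theorem IsZeroSectorial.holGraph_single (hA : IsZeroSectorial A) (f : ℂ → ℂ) :
    ∀ p ∈ holGraph A f, p.1 = 0 → p.2 = 0 := by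
  intro p hp h0
  rw [mem_holGraph, h0, map_zero] at hp
  exact hA.rhoOp_injective (by rw [← hp, map_zero])

/-- For bounded `T`, `f(A) = T` is an identity of bounded operators, since `ρ(A)` is injective. -/
theorem IsZeroSectorial.holCalc_eq_iff (hA : IsZeroSectorial A) (f : ℂ → ℂ) (T : X →L[ℂ] X) :
    holCalc A f = (T : X →ₗ[ℂ] X).toPMap ⊤ ↔
      cauchyCalc A (Real.pi / 2) (fun z => rho z * f z) = rhoOp A * T := by
  have hg : (holCalc A f).graph = holGraph A f :=
    Submodule.toLinearPMap_graph_eq _ (hA.holGraph_single f)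
  have hT : ∀ p : X × X, p ∈ ((T : X →ₗ[ℂ] X).toPMap ⊤).graph ↔ T p.1 = p.2 := by
    intro p
    rw [LinearPMap.mem_graph_iff]
    constructor
    · rintro ⟨y, hy, hy'⟩
      rw [← hy, ← hy']
      rfl
    · intro h
      exact ⟨⟨p.1, trivial⟩, rfl, h⟩
  constructor
  · intro h
    ext x
    have h1 : (x, T x) ∈ ((T : X →ₗ[ℂ] X).toPMap ⊤).graph := (hT _).2 rfl
    rw [← h, hg, mem_holGraph] at h1
    exact h1
  · intro h
    apply LinearPMap.eq_of_eq_graph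
    rw [hg]
    ext p
    rw [hT, mem_holGraph, h]
    exact ⟨fun h' => hA.rhoOp_injective h', fun h' => by rw [← h']; rfl⟩

theorem IsZeroSectorial.opVal_holCalc (hA : IsZeroSectorial A) {f : ℂ → ℂ} {x y : X}
    (h : cauchyCalc A (Real.pi / 2) (fun z => rho z * f z) x = rhoOp A y) :
    x ∈ (holCalc A f).domain ∧ opVal (holCalc A f) x = y := by
  have hg : (holCalc A f).graph = holGraph A f :=
    Submodule.toLinearPMap_graph_eq _ (hA.holGraph_single f)
  have h1 : (x, y) ∈ (holCalc A f).graph := by rw [hg]; exact h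
  obtain ⟨z, hz, hz'⟩ := (LinearPMap.mem_graph_iff _).1 h1
  simp only at hz hz'
  have hx : x ∈ (holCalc A f).domain := hz ▸ z.2
  refine ⟨hx, ?_⟩
  rw [opVal, dif_pos hx, ← hz']
  congr 1
  exact Subtype.ext hz.symm

variable [CompleteSpace X]

/-- The residue of `ρ(z) (z - A)⁻¹` at `-1`: subtracting scalar functions with the same principal
part leaves a function which is holomorphic in the left half plane and decays quadratically, so that
its integral over the imaginary axis vanishes. -/
theorem cauchyCalc_rho (hA : IsZeroSectorial A) :
    cauchyCalc A (Real.pi / 2) rho = rhoOp A := by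
  set S : X →L[ℂ] X := resolventOp A (-1) with hS
  obtain ⟨C, hC, hb⟩ := hA.exists_bound
  have hneg : ∀ z ∈ halfPlane, (-z).re ≤ 0 ∧ -z ≠ 0 := fun z hz =>
    ⟨by simpa using hz.1, neg_ne_zero.2 hz.2⟩
  have hz1 : ∀ z ∈ halfPlane, (1 : ℂ) + z ≠ 0 := by
    intro z hz
    have := add_ofReal_ne_zero hz.1 one_pos
    rwa [Complex.ofReal_one, add_comm] at this
  set g : ℂ → X →L[ℂ] X := fun z => (-(1 + z)⁻¹) • S + ((-z - 2) / (1 + z)) • (S * S) +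
    (-z) • (S * S * resolventOp A (-z)) with hg
  -- `g` is `ρ(-z) (-z - A)⁻¹` minus its principal part at `z = 1`, made integrable at `∞`
  have hform : ∀ z ∈ halfPlane, z ≠ 1 → g z = rho (-z) • resolventOp A (-z) -
      (2 / (1 - z ^ 2)) • (S + S * S) + (1 / (1 - z) ^ 2) • S := by
    intro z hz hz1'
    have h1 : (1 : ℂ) - z ≠ 0 := sub_ne_zero.2 hz1'.symm
    have h2 := hz1 z hz
    have h3 : (1 : ℂ) - z ^ 2 = (1 - z) * (1 + z) := by ring
    have hr1 : resolventOp A (-z) = S - (1 - z) • (S * resolventOp A (-z)) := by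
      have := hA.resolvent_sub (z := -1) (w := -z) (by simp) (by simp) (hneg z hz).1 (hneg z hz).2
      rw [← hS, show -z - -1 = (1 : ℂ) - z by ring] at this
      rw [← this]
      abel
    have hr2 : resolventOp A (-z) = S - (1 - z) • (S * S) +
        (1 - z) ^ 2 • (S * S * resolventOp A (-z)) := by
      conv_lhs => rw [hr1, hr1]
      rw [mul_sub, smul_sub, mul_smul_comm, smul_smul, mul_assoc]
      rw [pow_two]
      abel
    have h4 : rho (-z) • resolventOp A (-z) = rho (-z) • S - (rho (-z) * (1 - z)) • (S * S) +
        (rho (-z) * (1 - z) ^ 2) • (S * S * resolventOp A (-z)) := by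
      conv_lhs => rw [hr2]
      rw [smul_add, smul_sub, smul_smul, smul_smul]
    rw [h4, hg]
    have e1 : rho (-z) * (1 - z) ^ 2 = -z := by
      rw [rho, ← sub_eq_add_neg]; field_simp
    have e2 : rho (-z) * (1 - z) = -z / (1 - z) := by
      rw [rho, ← sub_eq_add_neg]; field_simp
    have e3 : rho (-z) - 2 / (1 - z ^ 2) + 1 / (1 - z) ^ 2 = -(1 + z)⁻¹ := by
      rw [rho, h3, ← sub_eq_add_neg]; field_simp; ring
    have e4 : -(-z / (1 - z)) - 2 / (1 - z ^ 2) = (-z - 2) / (1 + z) := by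
      rw [h3]; field_simp; ring
    simp only
    rw [e1, e2, ← e3, ← e4]
    module
  have hbound : ∃ K : ℝ, ∀ z ∈ halfPlane, ‖g z‖ ≤ K / (1 + ‖z‖ ^ 2) := by
    set M : ℝ := ‖S‖ + ‖S * S‖ with hM
    have hM0 : 0 ≤ M := by positivity
    refine ⟨10 * (5 * M + C * M) + (9 * C + 9 * M), fun z hz => ?_⟩
    rw [le_div_iff₀ (by positivity)]
    have hz0 : 0 < ‖z‖ := norm_pos_iff.2 hz.2
    have hn1 : 1 ≤ ‖1 + z‖ := by
      have := le_norm_add hz.1 zero_le_one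
      rwa [Complex.ofReal_one, add_comm z] at this
    have hn2 : ‖z‖ ≤ ‖1 + z‖ := by
      have := norm_le_norm_add hz.1 zero_le_one
      rwa [Complex.ofReal_one, add_comm z] at this
    have hRz : ‖resolventOp A (-z)‖ ≤ C / ‖z‖ := by
      simpa using hb (-z) (hneg z hz).1 (hneg z hz).2
    rcases le_total ‖z‖ 3 with h3 | h3
    · have t1 : ‖(-(1 + z)⁻¹) • S‖ ≤ ‖S‖ := by
        rw [norm_smul, norm_neg, norm_inv]
        exact mul_le_of_le_one_left (norm_nonneg _) (inv_le_one_of_one_le₀ hn1)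
      have t2 : ‖((-z - 2) / (1 + z)) • (S * S)‖ ≤ 5 * ‖S * S‖ := by
        rw [norm_smul, norm_div]
        gcongr
        rw [div_le_iff₀ (by linarith)]
        have : ‖-z - 2‖ ≤ ‖z‖ + 2 := by
          refine (norm_sub_le _ _).trans ?_
          rw [norm_neg]; simp
        linarith
      have t3 : ‖(-z) • (S * S * resolventOp A (-z))‖ ≤ C * ‖S * S‖ := by
        rw [norm_smul, norm_neg]
        calc ‖z‖ * ‖S * S * resolventOp A (-z)‖ ≤ ‖z‖ * (‖S * S‖ * (C / ‖z‖)) := by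
              gcongr
              exact (norm_mul_le _ _).trans (by gcongr)
          _ = _ := by field_simp
      have t4 : ‖g z‖ ≤ 5 * M + C * M := by
        refine (norm_add₃_le).trans ?_
        have : C * ‖S * S‖ ≤ C * M := by gcongr; rw [hM]; linarith [norm_nonneg S]
        rw [hM] at this ⊢
        linarith [norm_nonneg S]
      calc ‖g z‖ * (1 + ‖z‖ ^ 2) ≤ (5 * M + C * M) * (1 + 3 ^ 2) := by gcongr
        _ ≤ _ := by nlinarith
    · have hne : z ≠ 1 := by rintro rfl; norm_num at h3
      have hd : 2 / 3 * ‖z‖ ≤ ‖1 - z‖ := by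
        have := norm_sub_norm_le z 1
        rw [norm_one, norm_sub_rev] at this
        linarith
      have t1 : ‖rho (-z) • resolventOp A (-z)‖ ≤ 9 / 4 * C / ‖z‖ ^ 2 := by
        rw [norm_smul, rho, norm_div, norm_neg, norm_pow, ← sub_eq_add_neg]
        calc ‖z‖ / ‖1 - z‖ ^ 2 * ‖resolventOp A (-z)‖
            ≤ ‖z‖ / (2 / 3 * ‖z‖) ^ 2 * (C / ‖z‖) := by gcongr
          _ = _ := by field_simp; norm_num
      have t2 : ‖(2 / (1 - z ^ 2)) • (S + S * S)‖ ≤ 3 * M / ‖z‖ ^ 2 := by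
        rw [norm_smul, norm_div, show (1 : ℂ) - z ^ 2 = (1 - z) * (1 + z) by ring, norm_mul]
        calc ‖(2 : ℂ)‖ / (‖1 - z‖ * ‖1 + z‖) * ‖S + S * S‖
            ≤ 2 / ((2 / 3 * ‖z‖) * ‖z‖) * M := by
              gcongr
              · simp
              · exact norm_add_le _ _
          _ = _ := by field_simp
      have t3 : ‖(1 / (1 - z) ^ 2) • S‖ ≤ 9 / 4 * M / ‖z‖ ^ 2 := by
        rw [norm_smul, norm_div, norm_one, norm_pow]
        calc 1 / ‖1 - z‖ ^ 2 * ‖S‖ ≤ 1 / (2 / 3 * ‖z‖) ^ 2 * M := by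
              gcongr
              rw [hM]; linarith [norm_nonneg (S * S)]
          _ = _ := by field_simp; ring
      rw [hform z hz hne]
      have t4 : ‖rho (-z) • resolventOp A (-z) - (2 / (1 - z ^ 2)) • (S + S * S) +
          (1 / (1 - z) ^ 2) • S‖ ≤ (9 / 4 * C + 21 / 4 * M) / ‖z‖ ^ 2 := by
        refine (norm_add_le _ _).trans ((add_le_add_left (norm_sub_le _ _) _).trans ?_)
        refine (add_le_add (add_le_add t1 t2) t3).trans (le_of_eq ?_)
        ring
      calc _ ≤ (9 / 4 * C + 21 / 4 * M) / ‖z‖ ^ 2 * (‖z‖ ^ 2 / 9 + ‖z‖ ^ 2) := by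
            gcongr
            nlinarith
        _ = (9 / 4 * C + 21 / 4 * M) * (10 / 9) := by field_simp; norm_num
        _ ≤ _ := by nlinarith [mul_nonneg hC.le hM0]
  obtain ⟨K, hK⟩ := hbound
  have hmapsneg : Set.MapsTo (fun z : ℂ => -z) halfPlane {z | z.re ≤ 0 ∧ z ≠ 0} := hneg
  have hz0 : axisInt g = 0 := by
    refine axisInt_eq_zero ?_ ?_ hK
    · refine ContinuousOn.add (ContinuousOn.add ?_ ?_) ?_
      · exact (ContinuousOn.inv₀ (by fun_prop) hz1).neg.smul continuousOn_const
      · exact (ContinuousOn.div (by fun_prop) (by fun_prop) hz1).smul continuousOn_const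
      · exact (by fun_prop : ContinuousOn (fun z : ℂ => -z) halfPlane).smul
          (continuousOn_const.mul (hA.continuousOn_resolvent.comp (by fun_prop) hmapsneg))
    · intro z hz
      have h1 := hz1 z ⟨le_of_lt hz, fun h => by simp [h] at hz⟩
      have h2 : DifferentiableAt ℂ (fun z => resolventOp A (-z)) z :=
        (hA.hasDerivAt_resolvent (w := -z) (by simpa using hz)).differentiableAt.comp z
          differentiable_neg.differentiableAt
      refine DifferentiableAt.differentiableWithinAt ?_
      have h3 : DifferentiableAt ℂ (fun z : ℂ => -(1 + z)⁻¹) z := by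
        fun_prop (disch := assumption)
      have h4 : DifferentiableAt ℂ (fun z : ℂ => (-z - 2) / (1 + z)) z := by
        fun_prop (disch := assumption)
      exact ((h3.smul_const S).add (h4.smul_const (S * S))).add
        (differentiable_neg.differentiableAt.smul ((differentiableAt_const (S * S)).mul h2))
  have hone : ∀ z ∈ punctAxis, z ≠ 1 := by
    rintro z hz rfl
    simpa using hz.1
  have hrd : IsDecaying rho := by simpa using (isHInf_const 1).isDecaying
  -- the double pole of the principal part does not contribute to the integral
  have hbd2 : ∀ z ∈ halfPlane, ‖1 / (1 + z) ^ 2‖ ≤ 1 / (1 + ‖z‖ ^ 2) := by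
    intro z hz
    have := norm_add_pos_sq hz.1 zero_le_one
    rw [Complex.ofReal_one, add_comm z, one_pow] at this
    rw [norm_div, norm_one, norm_pow]
    gcongr
  have hcont2 : ContinuousOn (fun z : ℂ => 1 / (1 + z) ^ 2) halfPlane :=
    ContinuousOn.div (by fun_prop) (by fun_prop) fun z hz => pow_ne_zero 2 (hz1 z hz)
  have hi3' := axisIntegrable_of_bound (hcont2.mono punctAxis_subset_halfPlane)
    fun z hz => hbd2 z (punctAxis_subset_halfPlane hz)
  have hI3 : axisInt (fun z : ℂ => 1 / (1 - z) ^ 2) = 0 := by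
    have h1 := axisInt_comp_neg (fun z : ℂ => 1 / (1 + z) ^ 2)
    simp only [← sub_eq_add_neg] at h1
    rw [h1]
    refine axisInt_eq_zero hcont2 (fun z hz => ?_) hbd2
    have h2 : (1 + z) ^ 2 ≠ 0 := pow_ne_zero 2 (hz1 z ⟨le_of_lt hz, fun h => by simp [h] at hz⟩)
    refine DifferentiableAt.differentiableWithinAt ?_
    fun_prop (disch := assumption)
  have hi3 : AxisIntegrable (fun z : ℂ => 1 / (1 - z) ^ 2) := by
    refine ⟨?_, ?_⟩
    · simpa [sub_eq_add_neg] using hi3'.2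
    · simpa [sub_eq_add_neg] using hi3'.1
  have haux : ∀ r : ℝ, (2 : ℂ) / (1 - (r * Complex.I) ^ 2) = ((2 * (1 + r ^ 2)⁻¹ : ℝ) : ℂ) := by
    intro r
    rw [mul_pow, Complex.I_sq]
    push_cast
    rw [div_eq_mul_inv]
    ring_nf
  have hi2 : AxisIntegrable (fun z : ℂ => 2 / (1 - z ^ 2)) := by
    have : IntegrableOn (fun r : ℝ => ((2 * (1 + r ^ 2)⁻¹ : ℝ) : ℂ)) (Set.Ioi 0) :=
      (integrable_inv_one_add_sq.const_mul 2).ofReal.integrableOn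
    refine ⟨by simpa only [haux] using this, ?_⟩
    simpa only [neg_sq, haux] using this
  have hI2 : axisInt (fun z : ℂ => 2 / (1 - z ^ 2)) = (2 * Real.pi : ℂ) := by
    unfold axisInt
    simp only [neg_sq]
    simp only [haux]
    rw [integral_complex_ofReal, integral_const_mul, integral_Ioi_inv_one_add_sq]
    simp
    ring
  have hi1 : AxisIntegrable (fun z => rho (-z) • resolventOp A (-z)) := by
    have := hrd.axisIntegrable hA
    exact ⟨this.2, by simpa using this.1⟩
  have hi2' := hi2.clm ((ContinuousLinearMap.id ℂ ℂ).smulRight (S + S * S))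
  have hi3'' := hi3.clm ((ContinuousLinearMap.id ℂ ℂ).smulRight S)
  have hI2' := axisInt_clm ((ContinuousLinearMap.id ℂ ℂ).smulRight (S + S * S)) hi2
  have hI3' := axisInt_clm ((ContinuousLinearMap.id ℂ ℂ).smulRight S) hi3
  simp only [ContinuousLinearMap.smulRight_apply, ContinuousLinearMap.id_apply]
    at hi2' hi3'' hI2' hI3'
  rw [axisInt_congr fun z hz => hform z (punctAxis_subset_halfPlane hz) (hone z hz),
    axisInt_add (hi1.sub hi2') hi3'', axisInt_sub hi1 hi2', hI2', hI3', hI2, hI3,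
    axisInt_comp_neg (fun z => rho z • resolventOp A z), zero_smul, add_zero, sub_eq_zero] at hz0
  rw [cauchyCalc_eq, hz0, smul_smul]
  have hpi : (2 * Real.pi : ℂ) ≠ 0 := by
    simp [Real.pi_ne_zero]
  rw [neg_mul, inv_mul_cancel₀ hpi, rhoOp, ← hS, ContinuousLinearMap.mul_def]
  module

end HolCalc

/-! ### Weighted Fourier transforms of Schwartz functions -/

section Weight

open scoped SchwartzMap

/-- The weight `(1 + |t|)^β`. -/
noncomputable def wt (β t : ℝ) : ℝ := (1 + |t|) ^ β

theorem wt_pos (β t : ℝ) : 0 < wt β t := by unfold wt; positivity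

theorem continuous_wt (β : ℝ) : Continuous (wt β) := by
  unfold wt
  refine Continuous.rpow_const (by fun_prop) fun t => Or.inl ?_
  positivity

/-- Peetre's inequality. -/
theorem wt_add_le {β : ℝ} (hβ : 0 ≤ β) (s t : ℝ) : wt β (s + t) ≤ wt β s * wt β t := by
  unfold wt
  rw [← Real.mul_rpow (by positivity) (by positivity)]
  gcongr
  nlinarith [abs_add_le s t, mul_nonneg (abs_nonneg s) (abs_nonneg t)]

theorem exists_wt_mul_le (β : ℝ) (f : 𝓢(ℝ, ℂ)) :
    ∃ C : ℝ, ∀ t, wt β t * ‖f t‖ ≤ C * (1 + t ^ 2)⁻¹ := by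
  obtain ⟨n, hn⟩ := exists_nat_ge β
  refine ⟨2 ^ (n + 2) * (Finset.Iic (n + 2, 0)).sup
    (fun m => SchwartzMap.seminorm ℝ m.1 m.2) f, fun t => ?_⟩
  have h := SchwartzMap.one_add_le_sup_seminorm_apply (𝕜 := ℝ) (m := (n + 2, 0)) le_rfl le_rfl f t
  rw [norm_iteratedFDeriv_zero] at h
  simp only at h
  rw [← div_eq_mul_inv, le_div_iff₀ (by positivity)]
  refine le_trans ?_ h
  have h1 : wt β t ≤ (1 + ‖t‖) ^ n := by
    rw [wt, Real.norm_eq_abs, ← Real.rpow_natCast]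
    exact Real.rpow_le_rpow_of_exponent_le (by linarith [abs_nonneg t]) hn
  have h2 : 1 + t ^ 2 ≤ (1 + ‖t‖) ^ 2 := by
    rw [Real.norm_eq_abs, ← sq_abs]; nlinarith [abs_nonneg t]
  calc wt β t * ‖f t‖ * (1 + t ^ 2) = wt β t * (1 + t ^ 2) * ‖f t‖ := by ring
    _ ≤ (1 + ‖t‖) ^ n * (1 + ‖t‖) ^ 2 * ‖f t‖ := by gcongr
    _ = _ := by ring

theorem integrable_wt_mul (β : ℝ) (f : 𝓢(ℝ, ℂ)) : Integrable fun t => wt β t * ‖f t‖ := by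
  obtain ⟨C, hC⟩ := exists_wt_mul_le β f
  refine Integrable.mono' (integrable_inv_one_add_sq.const_mul C) ?_ (ae_of_all _ fun t => ?_)
  · exact ((continuous_wt β).mul f.continuous.norm).aestronglyMeasurable
  · rw [Real.norm_of_nonneg (mul_nonneg (wt_pos _ _).le (norm_nonneg _))]
    exact hC t

theorem memLp_wt_mul (β : ℝ) (f : 𝓢(ℝ, ℂ)) :
    MemLp (fun t => ((wt β t : ℝ) : ℂ) * f t) 2 volume := by
  obtain ⟨C, hC⟩ := exists_wt_mul_le β f
  have hcont : Continuous fun t => ((wt β t : ℝ) : ℂ) * f t :=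
    (Complex.continuous_ofReal.comp (continuous_wt β)).mul f.continuous
  rw [memLp_two_iff_integrable_sq_norm hcont.aestronglyMeasurable]
  refine Integrable.mono' (integrable_inv_one_add_sq.const_mul (C ^ 2)) ?_ (ae_of_all _ fun t => ?_)
  · exact (hcont.norm.pow 2).aestronglyMeasurable
  · have h1 := hC t
    have h0 : 0 ≤ wt β t * ‖f t‖ := mul_nonneg (wt_pos _ _).le (norm_nonneg _)
    rw [Real.norm_of_nonneg (by positivity), norm_mul, Complex.norm_real,
      Real.norm_of_nonneg (wt_pos β t).le]
    calc (wt β t * ‖f t‖) ^ 2 ≤ (C * (1 + t ^ 2)⁻¹) ^ 2 := by gcongr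
      _ = C ^ 2 * ((1 + t ^ 2)⁻¹ * (1 + t ^ 2)⁻¹) := by ring
      _ ≤ C ^ 2 * ((1 + t ^ 2)⁻¹ * 1) := by
        gcongr
        exact inv_le_one_of_one_le₀ (by nlinarith)
      _ = _ := by ring

/-- The isometry `η ↦ (1 + |·|)^β 𝓕 η` from Schwartz functions with the norm of the Sobolev space
`W^β_2` to `L²`. -/
noncomputable def sobEmb (β : ℝ) : 𝓢(ℝ, ℂ) →ₗ[ℂ] Lp ℂ 2 (volume : Measure ℝ) where
  toFun η := (memLp_wt_mul β (𝓕 η)).toLp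
  map_add' η θ := by
    rw [← MemLp.toLp_add]
    refine MemLp.toLp_congr _ _ (ae_of_all _ fun t => ?_)
    simp only [FourierTransform.fourier_add, Pi.add_apply, add_apply]
    ring
  map_smul' c η := by
    rw [RingHom.id_apply, ← MemLp.toLp_const_smul]
    refine MemLp.toLp_congr _ _ (ae_of_all _ fun t => ?_)
    simp only [FourierTransform.fourier_smul, Pi.smul_apply, smul_apply, smul_eq_mul]
    ring

theorem coeFn_sobEmb (β : ℝ) (η : 𝓢(ℝ, ℂ)) :
    sobEmb β η =ᵐ[volume] fun t => ((wt β t : ℝ) : ℂ) * 𝓕 η t :=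
  (memLp_wt_mul β (𝓕 η)).coeFn_toLp

theorem logSobNorm_eq {β : ℝ} {f : ℝ → ℂ} {η : 𝓢(ℝ, ℂ)} (h : ∀ x, f (Real.exp x) = η x) :
    logSobNorm β f = ENNReal.ofReal ‖sobEmb β η‖ := by
  have hf : (fun x => f (Real.exp x)) = η := funext h
  have hm : MemLp (fun x => f (Real.exp x)) 2 volume := hf ▸ η.memLp 2
  rw [logSobNorm, sobNorm, dif_pos hm, Lp.norm_def, ENNReal.ofReal_toReal (Lp.eLpNorm_ne_top _)]
  have h1 : hm.toLp = η.toLp 2 := MemLp.toLp_congr _ _ (ae_of_all _ h)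
  rw [h1, SchwartzMap.toLp_fourier_eq]
  refine eLpNorm_congr_ae ?_
  filter_upwards [coeFn_sobEmb β η, SchwartzMap.coeFn_toLp (𝓕 η) 2] with t h2 h3
  rw [h2, h3, wt]

/-- The pointwise product of Schwartz functions. -/
noncomputable def mulS (η θ : 𝓢(ℝ, ℂ)) : 𝓢(ℝ, ℂ) :=
  SchwartzMap.pairing (ContinuousLinearMap.mul ℂ ℂ) η θ

@[simp]
theorem mulS_apply (η θ : 𝓢(ℝ, ℂ)) (x : ℝ) : mulS η θ x = η x * θ x := rfl

theorem fourierInv_eq_neg (η : 𝓢(ℝ, ℂ)) (x : ℝ) : 𝓕⁻ η x = 𝓕 η (-x) := by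
  rw [SchwartzMap.fourierInv_coe, SchwartzMap.fourier_coe, Real.fourierInv_eq_fourier_neg]

theorem fourier_mulS (η θ : 𝓢(ℝ, ℂ)) (ξ : ℝ) :
    𝓕 (mulS η θ) ξ = ∫ τ, 𝓕 η τ * 𝓕 θ (ξ - τ) := by
  have h := SchwartzMap.convolution_apply (ContinuousLinearMap.mul ℂ ℂ) (𝓕⁻ η) (𝓕⁻ θ) (-ξ)
  have h2 : SchwartzMap.convolution (ContinuousLinearMap.mul ℂ ℂ) (𝓕⁻ η) (𝓕⁻ θ) =
      𝓕⁻ (mulS η θ) := by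
    rw [← FourierTransform.fourierInv_fourier_eq (F := 𝓢(ℝ, ℂ))
      (SchwartzMap.convolution (ContinuousLinearMap.mul ℂ ℂ) (𝓕⁻ η) (𝓕⁻ θ)),
      SchwartzMap.fourier_convolution, FourierTransform.fourier_fourierInv_eq,
      FourierTransform.fourier_fourierInv_eq]
    rfl
  rw [h2, fourierInv_eq_neg, neg_neg] at h
  rw [h, convolution]
  simp only [ContinuousLinearMap.mul_apply', fourierInv_eq_neg]
  rw [← integral_neg_eq_self]
  refine integral_congr_ae (ae_of_all _ fun τ => ?_)
  simp only [neg_neg]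
  congr 2
  ring

/-- Young's inequality for `L¹ * L² ⊆ L²`. -/
theorem lintegral_convolution_sq_le {a b : ℝ → ℝ≥0∞} (ha : Measurable a) (hb : Measurable b) :
    ∫⁻ ξ, (∫⁻ τ, a τ * b (ξ - τ)) ^ 2 ≤ (∫⁻ τ, a τ) ^ 2 * ∫⁻ ξ, b ξ ^ 2 := by
  have hpt : ∀ ξ, (∫⁻ τ, a τ * b (ξ - τ)) ^ 2 ≤ (∫⁻ τ, a τ) * ∫⁻ τ, a τ * b (ξ - τ) ^ 2 := by
    intro ξ
    have hsub : Measurable fun τ => b (ξ - τ) := hb.comp (measurable_const.sub measurable_id)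
    have h := ENNReal.lintegral_mul_le_Lp_mul_Lq volume Real.HolderConjugate.two_two
      (f := fun τ => a τ ^ (1 / 2 : ℝ)) (g := fun τ => a τ ^ (1 / 2 : ℝ) * b (ξ - τ))
      (ha.pow_const _).aemeasurable ((ha.pow_const _).mul hsub).aemeasurable
    have hhalf : ∀ x : ℝ≥0∞, x ^ (1 / 2 : ℝ) * x ^ (1 / 2 : ℝ) = x := fun x => by
      rw [← ENNReal.rpow_add_of_nonneg _ _ (by norm_num) (by norm_num)]; norm_num
    have h1 : ∀ τ, (a τ ^ (1 / 2 : ℝ)) ^ (2 : ℝ) = a τ := fun τ => by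
      rw [← ENNReal.rpow_mul]; norm_num
    have h2 : ∀ τ, (a τ ^ (1 / 2 : ℝ) * b (ξ - τ)) ^ (2 : ℝ) = a τ * b (ξ - τ) ^ 2 := fun τ => by
      rw [ENNReal.mul_rpow_of_nonneg _ _ (by norm_num), h1]; norm_num
    simp only [Pi.mul_apply, ← mul_assoc, hhalf, h1, h2] at h
    calc (∫⁻ τ, a τ * b (ξ - τ)) ^ 2
        ≤ ((∫⁻ τ, a τ) ^ (1 / 2 : ℝ) * (∫⁻ τ, a τ * b (ξ - τ) ^ 2) ^ (1 / 2 : ℝ)) ^ 2 := by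
          gcongr
      _ = _ := by rw [mul_pow, sq, sq, hhalf, hhalf]
  have hmeas : Measurable fun p : ℝ × ℝ => a p.2 * b (p.1 - p.2) ^ 2 :=
    (ha.comp measurable_snd).mul ((hb.comp (measurable_fst.sub measurable_snd)).pow_const 2)
  calc ∫⁻ ξ, (∫⁻ τ, a τ * b (ξ - τ)) ^ 2
      ≤ ∫⁻ ξ, (∫⁻ τ, a τ) * ∫⁻ τ, a τ * b (ξ - τ) ^ 2 := lintegral_mono hpt
    _ = (∫⁻ τ, a τ) * ∫⁻ ξ, ∫⁻ τ, a τ * b (ξ - τ) ^ 2 :=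
        lintegral_const_mul _ (Measurable.lintegral_prod_right' hmeas)
    _ = (∫⁻ τ, a τ) * ∫⁻ τ, ∫⁻ ξ, a τ * b (ξ - τ) ^ 2 := by
        rw [lintegral_lintegral_swap hmeas.aemeasurable]
    _ = (∫⁻ τ, a τ) * ∫⁻ τ, a τ * ∫⁻ ξ, b ξ ^ 2 := by
        congr 1
        refine lintegral_congr fun τ => ?_
        have hsub : Measurable fun ξ => b (ξ - τ) := hb.comp (measurable_id.sub_const τ)
        rw [lintegral_const_mul _ (hsub.pow_const 2),
          lintegral_sub_right_eq_self (fun ξ => b ξ ^ 2)]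
    _ = _ := by rw [lintegral_mul_const _ ha]; ring

/-- Multiplication by a Schwartz function is bounded for the Sobolev norm. -/
theorem norm_sobEmb_mulS_le {β : ℝ} (hβ : 0 ≤ β) (η θ : 𝓢(ℝ, ℂ)) :
    ‖sobEmb β (mulS η θ)‖ ≤ (∫ τ, wt β τ * ‖𝓕 η τ‖) * ‖sobEmb β θ‖ := by
  set M := ∫ τ, wt β τ * ‖𝓕 η τ‖ with hM
  have hM0 : 0 ≤ M := integral_nonneg fun τ => mul_nonneg (wt_pos _ _).le (norm_nonneg _)
  set a : ℝ → ℝ≥0∞ := fun τ => ENNReal.ofReal (wt β τ * ‖𝓕 η τ‖) with ha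
  set b : ℝ → ℝ≥0∞ := fun τ => ENNReal.ofReal (wt β τ * ‖𝓕 θ τ‖) with hb
  have ham : Measurable a :=
    (ENNReal.continuous_ofReal.comp ((continuous_wt β).mul (𝓕 η).continuous.norm)).measurable
  have hbm : Measurable b :=
    (ENNReal.continuous_ofReal.comp ((continuous_wt β).mul (𝓕 θ).continuous.norm)).measurable
  have hia : ∫⁻ τ, a τ = ENNReal.ofReal M :=
    (ofReal_integral_eq_lintegral_ofReal (integrable_wt_mul β (𝓕 η))
      (ae_of_all _ fun τ => mul_nonneg (wt_pos _ _).le (norm_nonneg _))).symm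
  have hnorm : ∀ ζ : 𝓢(ℝ, ℂ), eLpNorm (sobEmb β ζ) 2 volume ^ 2 =
      ∫⁻ ξ, ENNReal.ofReal (wt β ξ * ‖𝓕 ζ ξ‖) ^ 2 := by
    intro ζ
    rw [eLpNorm_congr_ae (coeFn_sobEmb β ζ)]
    have := eLpNorm_nnreal_pow_eq_lintegral (p := 2) (μ := volume)
      (f := fun t => ((wt β t : ℝ) : ℂ) * 𝓕 ζ t) (by norm_num)
    simp only [ENNReal.coe_ofNat, NNReal.coe_ofNat, ENNReal.rpow_ofNat] at this
    rw [this]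
    refine lintegral_congr fun ξ => ?_
    rw [← ofReal_norm, norm_mul, Complex.norm_real, Real.norm_of_nonneg (wt_pos _ _).le]
  have hkey : eLpNorm (sobEmb β (mulS η θ)) 2 volume ^ 2 ≤
      (ENNReal.ofReal M * eLpNorm (sobEmb β θ) 2 volume) ^ 2 := by
    rw [mul_pow, hnorm, hnorm, ← hia]
    refine le_trans (lintegral_mono fun ξ => ?_) (lintegral_convolution_sq_le ham hbm)
    gcongr
    have h1 : wt β ξ * ‖𝓕 (mulS η θ) ξ‖ ≤
        ∫ τ, (wt β τ * ‖𝓕 η τ‖) * (wt β (ξ - τ) * ‖𝓕 θ (ξ - τ)‖) := by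
      have hint : Integrable fun τ => (wt β τ * ‖𝓕 η τ‖) * (wt β (ξ - τ) * ‖𝓕 θ (ξ - τ)‖) := by
        obtain ⟨C, hC⟩ := exists_wt_mul_le β (𝓕 θ)
        refine (integrable_wt_mul β (𝓕 η)).mul_bdd (c := C) ?_ (ae_of_all _ fun τ => ?_)
        · exact (((continuous_wt β).mul (𝓕 θ).continuous.norm).comp
            (continuous_const.sub continuous_id)).aestronglyMeasurable
        · rw [Real.norm_of_nonneg (mul_nonneg (wt_pos _ _).le (norm_nonneg _))]
          have hC0 : 0 ≤ C := by
            have := (mul_nonneg (wt_pos β 0).le (norm_nonneg (𝓕 θ 0))).trans (hC 0)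
            simpa using this
          exact (hC _).trans (mul_le_of_le_one_right hC0
            (inv_le_one_of_one_le₀ (by nlinarith [sq_nonneg (ξ - τ)])))
      rw [fourier_mulS]
      calc wt β ξ * ‖∫ τ, 𝓕 η τ * 𝓕 θ (ξ - τ)‖
          ≤ wt β ξ * ∫ τ, ‖𝓕 η τ * 𝓕 θ (ξ - τ)‖ := by
            gcongr
            · exact (wt_pos _ _).le
            · exact norm_integral_le_integral_norm _
        _ = ∫ τ, wt β ξ * ‖𝓕 η τ * 𝓕 θ (ξ - τ)‖ := (integral_const_mul _ _).symm
        _ ≤ _ := by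
            refine integral_mono_of_nonneg (ae_of_all _ fun τ => ?_) hint (ae_of_all _ fun τ => ?_)
            · exact mul_nonneg (wt_pos _ _).le (norm_nonneg _)
            · have h2 := wt_add_le hβ τ (ξ - τ)
              rw [add_sub_cancel] at h2
              simp only [norm_mul]
              calc wt β ξ * (‖𝓕 η τ‖ * ‖𝓕 θ (ξ - τ)‖)
                  ≤ wt β τ * wt β (ξ - τ) * (‖𝓕 η τ‖ * ‖𝓕 θ (ξ - τ)‖) := by gcongr
                _ = _ := by ring
    refine (ENNReal.ofReal_le_ofReal h1).trans ?_
    refine (ENNReal.ofReal_le_ofReal (le_abs_self _)).trans ?_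
    rw [← Real.norm_eq_abs, ofReal_norm]
    refine (enorm_integral_le_lintegral_enorm _).trans (le_of_eq (lintegral_congr fun τ => ?_))
    rw [enorm_mul, Real.enorm_of_nonneg (mul_nonneg (wt_pos _ _).le (norm_nonneg _)),
      Real.enorm_of_nonneg (mul_nonneg (wt_pos _ _).le (norm_nonneg _))]
  have h2 : eLpNorm (sobEmb β (mulS η θ)) 2 volume ≤
      ENNReal.ofReal M * eLpNorm (sobEmb β θ) 2 volume :=
    (ENNReal.pow_le_pow_left_iff (by norm_num)).1 hkey
  rw [Lp.norm_def, Lp.norm_def]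
  have h3 := ENNReal.toReal_mono
    (ENNReal.mul_ne_top ENNReal.ofReal_ne_top (Lp.eLpNorm_ne_top (sobEmb β θ))) h2
  rwa [ENNReal.toReal_mul, ENNReal.toReal_ofReal hM0] at h3

end Weight

/-! ### Uniqueness of Fourier transforms -/

section Uniqueness

open scoped SchwartzMap

/-- The Schwartz function defined by a real-valued smooth function of compact support. -/
noncomputable def bumpS (g : ℝ → ℝ) (hg : ContDiff ℝ (⊤ : ℕ∞) g) (hc : HasCompactSupport g) :
    𝓢(ℝ, ℂ) :=
  HasCompactSupport.toSchwartzMap (f := fun x => ((g x : ℝ) : ℂ))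
    (hc.comp_left (g := Complex.ofReal) rfl) (Complex.ofRealCLM.contDiff.comp hg)

@[simp]
theorem bumpS_apply (g : ℝ → ℝ) (hg : ContDiff ℝ (⊤ : ℕ∞) g) (hc : HasCompactSupport g) (x : ℝ) :
    bumpS g hg hc x = g x := rfl

theorem hasCompactSupport_bumpS (g : ℝ → ℝ) (hg : ContDiff ℝ (⊤ : ℕ∞) g)
    (hc : HasCompactSupport g) : HasCompactSupport (bumpS g hg hc) :=
  hc.comp_left (g := Complex.ofReal) rfl

theorem ae_eq_zero_of_integral_schwartz {f : ℝ → ℂ} (hf : LocallyIntegrable f)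
    (h : ∀ θ : 𝓢(ℝ, ℂ), HasCompactSupport θ → ∫ x, θ x * f x = 0) : f =ᵐ[volume] 0 := by
  refine ae_eq_zero_of_integral_contDiff_smul_eq_zero hf fun g hg hc => ?_
  have := h (bumpS g hg hc) (hasCompactSupport_bumpS g hg hc)
  simpa using this

theorem integral_fourier_mul_schwartz {f : ℝ → ℂ} (hf : Integrable f) (θ : 𝓢(ℝ, ℂ)) :
    ∫ ξ, 𝓕 f ξ * θ ξ = ∫ x, f x * 𝓕 θ x := by
  have h := VectorFourier.integral_fourierIntegral_smul_eq_flip (L := innerₗ ℝ)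
    (μ := (volume : Measure ℝ)) (ν := (volume : Measure ℝ)) Real.continuous_fourierChar
    continuous_inner hf θ.integrable
  simpa using! h

theorem ae_eq_zero_of_fourier_eq_zero {f : ℝ → ℂ} (hf : Integrable f) (h : ∀ ξ, 𝓕 f ξ = 0) :
    f =ᵐ[volume] 0 := by
  refine ae_eq_zero_of_integral_schwartz hf.locallyIntegrable fun θ _ => ?_
  have h1 := integral_fourier_mul_schwartz hf (𝓕⁻ θ)
  rw [FourierTransform.fourier_fourierInv_eq] at h1
  simp only [h, zero_mul, integral_zero] at h1
  rw [h1]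
  simp only [mul_comm]

/-- Translation of Schwartz functions, `f ↦ f (· - a)`. -/
noncomputable def translS (a : ℝ) (f : 𝓢(ℝ, ℂ)) : 𝓢(ℝ, ℂ) := SchwartzMap.compSubConstCLM ℂ a f

@[simp]
theorem translS_apply (a : ℝ) (f : 𝓢(ℝ, ℂ)) (x : ℝ) : translS a f x = f (x - a) := rfl

theorem fourier_translS (a : ℝ) (f : 𝓢(ℝ, ℂ)) (ξ : ℝ) :
    𝓕 (translS a f) ξ = Complex.exp (↑(-2 * Real.pi * a * ξ) * Complex.I) * 𝓕 f ξ := by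
  rw [SchwartzMap.fourier_coe, SchwartzMap.fourier_coe,
    Real.fourier_real_eq_integral_exp_smul, Real.fourier_real_eq_integral_exp_smul,
    ← integral_const_mul, ← integral_add_right_eq_self _ a]
  refine integral_congr_ae (ae_of_all _ fun x => ?_)
  simp only [translS_apply, add_sub_cancel_right, smul_eq_mul, ← mul_assoc, ← Complex.exp_add]
  congr 2
  push_cast
  ring

/-- Modulation of Schwartz functions, `f ↦ e^{2 π i b ·} f`, defined as translation on the side of
the Fourier transform. -/
noncomputable def modS (b : ℝ) (f : 𝓢(ℝ, ℂ)) : 𝓢(ℝ, ℂ) := 𝓕⁻ (translS b (𝓕 f))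

theorem fourier_modS (b : ℝ) (f : 𝓢(ℝ, ℂ)) (ξ : ℝ) : 𝓕 (modS b f) ξ = 𝓕 f (ξ - b) := by
  rw [modS, FourierTransform.fourier_fourierInv_eq, translS_apply]

theorem modS_apply (b : ℝ) (f : 𝓢(ℝ, ℂ)) (x : ℝ) :
    modS b f x = Complex.exp (↑(2 * Real.pi * b * x) * Complex.I) * f x := by
  rw [modS, fourierInv_eq_neg, fourier_translS, ← fourierInv_eq_neg,
    FourierTransform.fourierInv_fourier_eq]
  congr 3
  push_cast
  ring

theorem hasCompactSupport_modS {f : 𝓢(ℝ, ℂ)} (hf : HasCompactSupport f) (b : ℝ) :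
    HasCompactSupport (modS b f) := by
  refine hf.mono fun x hx => ?_
  rw [Function.mem_support, modS_apply] at hx
  exact right_ne_zero_of_mul hx

theorem hasCompactSupport_translS {f : 𝓢(ℝ, ℂ)} (hf : HasCompactSupport f) (a : ℝ) :
    HasCompactSupport (translS a f) := by
  have := hf.comp_homeomorph (Homeomorph.subRight a)
  exact this

/-- The values of a function are determined by its pairing with the Fourier transforms of smooth
functions of compact support. As this class is invariant under translations and modulations, the
uniqueness theorem for integrable functions applies. -/
theorem ae_eq_zero_of_integral_fourier_eq_zero {v : ℝ → ℂ}
    (hv : ∀ θ : 𝓢(ℝ, ℂ), Integrable fun ξ => θ ξ * v ξ)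
    (h : ∀ θ : 𝓢(ℝ, ℂ), HasCompactSupport θ → ∫ ξ, 𝓕 θ ξ * v ξ = 0) : v =ᵐ[volume] 0 := by
  obtain ⟨g, -, hgc, hgs, hgr, hg0⟩ := exists_contDiff_tsupport_subset (n := ⊤)
    (Filter.univ_mem (f := 𝓝 (0 : ℝ)))
  set θ := bumpS g hgs hgc with hθ
  have hθc : HasCompactSupport θ := hasCompactSupport_bumpS g hgs hgc
  have hg_nonneg : ∀ x, 0 ≤ g x := fun x => (hgr ⟨x, rfl⟩).1
  have h0 : 𝓕 θ 0 ≠ 0 := by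
    have h1 : 𝓕 θ 0 = ((∫ x, g x : ℝ) : ℂ) := by
      rw [SchwartzMap.fourier_coe, Real.fourier_real_eq_integral_exp_smul,
        ← integral_complex_ofReal]
      simp [hθ]
    rw [h1]
    have h2 : 0 < ∫ x, g x :=
      hgs.continuous.integral_pos_of_hasCompactSupport_nonneg_nonzero hgc hg_nonneg
        (by rw [hg0]; exact one_ne_zero)
    exact_mod_cast h2.ne'
  have hev : ∀ᶠ ξ in 𝓝 (0 : ℝ), 𝓕 θ ξ ≠ 0 := (𝓕 θ).continuous.continuousAt.eventually_ne h0
  have hprod : ∀ b : ℝ, (fun ξ => 𝓕 (modS b θ) ξ * v ξ) =ᵐ[volume] 0 := by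
    intro b
    refine ae_eq_zero_of_fourier_eq_zero (hv _) fun a => ?_
    have h1 := h (translS a (modS b θ))
      (hasCompactSupport_translS (hasCompactSupport_modS hθc b) a)
    rw [Real.fourier_real_eq_integral_exp_smul, ← h1]
    refine integral_congr_ae (ae_of_all _ fun ξ => ?_)
    simp only [fourier_translS, smul_eq_mul, ← mul_assoc]
    congr 4
    push_cast
    ring
  change ∀ᵐ x, v x = 0
  rw [ae_iff]
  refine measure_null_of_locally_null _ fun b _ => ?_
  refine ⟨{ξ | 𝓕 θ (ξ - b) ≠ 0} ∩ {a | ¬ v a = 0}, ?_, ?_⟩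
  · refine inter_mem ?_ self_mem_nhdsWithin
    refine mem_nhdsWithin_of_mem_nhds ?_
    have : Tendsto (fun ξ : ℝ => ξ - b) (𝓝 b) (𝓝 0) := by
      have := (continuous_id.sub continuous_const).tendsto (f := fun ξ : ℝ => ξ - b) b
      simpa using this
    exact this.eventually hev
  · have h2 := hprod b
    rw [Filter.EventuallyEq, ae_iff] at h2
    refine measure_mono_null (fun ξ hξ => ?_) h2
    simp only [fourier_modS, Set.mem_ofPred_eq, Pi.zero_apply]
    exact mul_ne_zero hξ.1 hξ.2

end Uniqueness

/-! ### The function `ρ` in logarithmic coordinates -/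

section Kappa

open scoped SchwartzMap

theorem hasDerivAt_sigmoid_mul (P : Polynomial ℝ) (x : ℝ) :
    HasDerivAt (fun x => Real.sigmoid x * (1 - Real.sigmoid x) * P.eval (Real.sigmoid x))
      (Real.sigmoid x * (1 - Real.sigmoid x) * ((1 - 2 * Polynomial.X) * P +
        Polynomial.X * (1 - Polynomial.X) * P.derivative).eval (Real.sigmoid x)) x := by
  have h1 := Real.hasDerivAt_sigmoid x
  have h2 := (P.hasDerivAt (Real.sigmoid x)).comp x h1
  have h3 := ((h1.mul (h1.const_sub 1)).mul h2)
  refine h3.congr_deriv ?_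
  simp
  ring

theorem exists_iteratedDeriv_sigmoid (n : ℕ) : ∃ P : Polynomial ℝ,
    iteratedDeriv n (fun x => ((Real.sigmoid x * (1 - Real.sigmoid x) : ℝ) : ℂ)) =
      fun x => ((Real.sigmoid x * (1 - Real.sigmoid x) * P.eval (Real.sigmoid x) : ℝ) : ℂ) := by
  induction n with
  | zero => exact ⟨1, by simp⟩
  | succ n ih =>
    obtain ⟨P, hP⟩ := ih
    refine ⟨(1 - 2 * Polynomial.X) * P +
      Polynomial.X * (1 - Polynomial.X) * P.derivative, ?_⟩
    rw [iteratedDeriv_succ, hP]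
    funext x
    exact (hasDerivAt_sigmoid_mul P x).ofReal_comp.deriv

theorem sigmoid_mul_eq (x : ℝ) :
    Real.sigmoid x * (1 - Real.sigmoid x) = Real.exp x / (1 + Real.exp x) ^ 2 := by
  rw [Real.sigmoid_def, Real.exp_neg]
  have := Real.exp_pos x
  field_simp
  ring

theorem sigmoid_mul_nonneg (x : ℝ) : 0 ≤ Real.sigmoid x * (1 - Real.sigmoid x) :=
  mul_nonneg (Real.sigmoid_nonneg x) (sub_nonneg.2 (Real.sigmoid_le_one x))

theorem sigmoid_mul_le (x : ℝ) : Real.sigmoid x * (1 - Real.sigmoid x) ≤ Real.exp (-|x|) := by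
  rw [sigmoid_mul_eq]
  refine le_trans ?_ (exp_div_one_add_exp_sq_le x)
  gcongr
  nlinarith [Real.exp_pos x]

/-- The function `x ↦ ρ(eˣ) = eˣ / (1 + eˣ)²`. -/
noncomputable def kappa : 𝓢(ℝ, ℂ) where
  toFun x := ((Real.sigmoid x * (1 - Real.sigmoid x) : ℝ) : ℂ)
  smooth' := by
    have h : ContDiff ℝ (⊤ : ℕ∞) Real.sigmoid := (_root_.contDiff_sigmoid).of_le le_top
    exact Complex.ofRealCLM.contDiff.comp (h.mul (contDiff_const.sub h))
  decay' k n := by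
    obtain ⟨P, hP⟩ := exists_iteratedDeriv_sigmoid n
    obtain ⟨B, hB⟩ := (isCompact_Icc (a := (0 : ℝ)) (b := 1)).exists_bound_of_continuousOn
      P.continuous.continuousOn
    have hB0 : 0 ≤ B := (norm_nonneg _).trans (hB 0 ⟨le_rfl, zero_le_one⟩)
    refine ⟨k.factorial * B, fun x => ?_⟩
    rw [norm_iteratedFDeriv_eq_norm_iteratedDeriv, hP, Complex.norm_real, norm_mul,
      Real.norm_of_nonneg (sigmoid_mul_nonneg x), Real.norm_eq_abs x]
    have h1 : |x| ^ k * Real.exp (-|x|) ≤ k.factorial := by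
      have := Real.pow_div_factorial_le_exp |x| (abs_nonneg x) k
      rw [Real.exp_neg, ← div_eq_mul_inv, div_le_iff₀ (Real.exp_pos _)]
      rwa [div_le_iff₀ (by positivity), mul_comm] at this
    calc |x| ^ k * (Real.sigmoid x * (1 - Real.sigmoid x) * ‖P.eval (Real.sigmoid x)‖)
        ≤ |x| ^ k * (Real.exp (-|x|) * B) := by
          gcongr
          · exact sigmoid_mul_le x
          · exact hB _ ⟨Real.sigmoid_nonneg x, Real.sigmoid_le_one x⟩
      _ = |x| ^ k * Real.exp (-|x|) * B := by ring
      _ ≤ _ := by gcongr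

theorem rho_exp (x : ℝ) : rho (Real.exp x) = kappa x := by
  change _ = ((Real.sigmoid x * (1 - Real.sigmoid x) : ℝ) : ℂ)
  rw [sigmoid_mul_eq, rho]
  push_cast
  rfl

/-- With `p = eˣ / (1 + eˣ)`, the Fourier transform of `κ` is a beta integral
`B(1 - 2πiξ, 1 + 2πiξ)`, hence has no zeros. -/
theorem fourier_kappa_ne_zero (ξ : ℝ) : 𝓕 kappa ξ ≠ 0 := by
  set u : ℂ := 1 - 2 * Real.pi * ξ * Complex.I with hu
  set w : ℂ := 1 + 2 * Real.pi * ξ * Complex.I with hw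
  have hure : 0 < u.re := by simp [hu]
  have hwre : 0 < w.re := by simp [hw]
  have key : 𝓕 kappa ξ = Complex.betaIntegral u w := by
    have h := integral_image_eq_integral_abs_deriv_smul (s := Set.univ) (f := Real.sigmoid)
      (f' := fun x => Real.sigmoid x * (1 - Real.sigmoid x)) MeasurableSet.univ
      (fun x _ => (Real.hasDerivAt_sigmoid x).hasDerivWithinAt) Real.sigmoid_injective.injOn
      (fun p : ℝ => (p : ℂ) ^ (u - 1) * (1 - (p : ℂ)) ^ (w - 1))
    rw [Set.image_univ, Real.range_sigmoid] at h
    rw [Complex.betaIntegral, intervalIntegral.integral_of_le zero_le_one,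
      integral_Ioc_eq_integral_Ioo, h, SchwartzMap.fourier_coe,
      Real.fourier_real_eq_integral_exp_smul, setIntegral_univ]
    refine integral_congr_ae (ae_of_all _ fun x => ?_)
    have hp := Real.sigmoid_pos x
    have hq : 0 < 1 - Real.sigmoid x := sub_pos.2 (Real.sigmoid_lt_one x)
    have hlog : Real.log (Real.sigmoid x) - Real.log (1 - Real.sigmoid x) = x := by
      rw [← Real.log_div hp.ne' hq.ne', ← Real.sigmoid_neg, ← Real.sigmoid_mul_rexp_neg,
        Real.log_div hp.ne' (mul_pos hp (Real.exp_pos _)).ne',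
        Real.log_mul hp.ne' (Real.exp_pos _).ne', Real.log_exp]
      ring
    simp only
    rw [abs_of_nonneg (sigmoid_mul_nonneg x),
      show (1 : ℂ) - (Real.sigmoid x : ℂ) = ((1 - Real.sigmoid x : ℝ) : ℂ) by push_cast; rfl,
      Complex.cpow_def_of_ne_zero (by exact_mod_cast hp.ne'),
      Complex.cpow_def_of_ne_zero (by exact_mod_cast hq.ne'), ← Complex.exp_add,
      ← Complex.ofReal_log hp.le, ← Complex.ofReal_log hq.le]
    change _ • ((Real.sigmoid x * (1 - Real.sigmoid x) : ℝ) : ℂ) = _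
    rw [smul_eq_mul, Complex.real_smul, mul_comm]
    congr 2
    conv_lhs => rw [← hlog]
    rw [hu, hw]
    push_cast
    ring
  rw [key]
  intro h0
  have h1 := Complex.Gamma_mul_Gamma_eq_betaIntegral hure hwre
  rw [h0, mul_zero, mul_eq_zero] at h1
  rcases h1 with h1 | h1
  · exact Complex.Gamma_ne_zero_of_re_pos hure h1
  · exact Complex.Gamma_ne_zero_of_re_pos hwre h1

/-- The translates of `κ` span a dense subspace of the Sobolev space, since the Fourier transform of
`κ` has no zeros. -/
theorem topologicalClosure_span_kappa (β : ℝ) :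
    ((Submodule.span ℂ (Set.range fun a => translS a kappa)).map
      (sobEmb β)).topologicalClosure = ⊤ := by
  rw [Submodule.topologicalClosure_eq_top_iff, Submodule.eq_bot_iff]
  intro v hv
  have h1 : ∀ a, inner ℂ (sobEmb β (translS a kappa)) v = 0 := fun a =>
    hv _ (Submodule.mem_map_of_mem (Submodule.subset_span ⟨a, rfl⟩))
  set f : ℝ → ℂ := fun ξ => (starRingEnd ℂ) (𝓕 kappa ξ) * wt β ξ * v ξ with hf
  have hfi : Integrable f := by
    have := (memLp_wt_mul β (𝓕 kappa)).star.integrable_mul (Lp.memLp v)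
    refine this.congr (ae_of_all _ fun ξ => ?_)
    simp [hf, mul_comm]
  have hf0 : f =ᵐ[volume] 0 := by
    refine ae_eq_zero_of_fourier_eq_zero hfi fun ξ => ?_
    rw [Real.fourier_real_eq_integral_exp_smul, ← h1 (-ξ), L2.inner_def]
    refine integral_congr_ae ?_
    filter_upwards [coeFn_sobEmb β (translS (-ξ) kappa)] with t ht
    rw [ht, fourier_translS]
    simp only [hf, RCLike.inner_apply, map_mul, Complex.conj_ofReal, ← Complex.exp_conj,
      Complex.conj_I, smul_eq_mul]
    rw [show -2 * Real.pi * -ξ * t = 2 * Real.pi * t * ξ by ring,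
      show ((-2 * Real.pi * t * ξ : ℝ) : ℂ) * Complex.I =
        ((2 * Real.pi * t * ξ : ℝ) : ℂ) * -Complex.I by push_cast; ring]
    ring
  rw [Lp.eq_zero_iff_ae_eq_zero]
  filter_upwards [hf0] with ξ hξ
  simp only [hf, Pi.zero_apply, mul_eq_zero, map_eq_zero, fourier_kappa_ne_zero, false_or,
    Complex.ofReal_eq_zero, (wt_pos β ξ).ne'] at hξ
  exact hξ

theorem denseRange_sobEmb (β : ℝ) : DenseRange (sobEmb β) := by
  have h := (Submodule.dense_iff_topologicalClosure_eq_top).2 (topologicalClosure_span_kappa β)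
  refine h.mono ?_
  rintro _ ⟨η, -, rfl⟩
  exact ⟨η, rfl⟩

/-- The approximants are linear combinations of translates of `κ`, to which the holomorphic calculus
applies. -/
theorem exists_span_kappa_approx (β : ℝ) (η : 𝓢(ℝ, ℂ)) {ε : ℝ} (hε : 0 < ε) :
    ∃ θ ∈ Submodule.span ℂ (Set.range fun a => translS a kappa), ‖sobEmb β (θ - η)‖ < ε := by
  have h := (Submodule.dense_iff_topologicalClosure_eq_top).2 (topologicalClosure_span_kappa β)
  obtain ⟨_, ⟨θ, hθ, rfl⟩, h2⟩ := h.exists_dist_lt (sobEmb β η) hε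
  refine ⟨θ, hθ, ?_⟩
  rwa [map_sub, ← dist_eq_norm, dist_comm]

/-- Functionals which are bounded for the Sobolev norm are given by functions on the side of the
Fourier transform, by the Riesz representation theorem. -/
theorem exists_density {β : ℝ} (L : 𝓢(ℝ, ℂ) →ₗ[ℂ] ℂ) {C : ℝ}
    (hL : ∀ η, ‖L η‖ ≤ C * ‖sobEmb β η‖) :
    ∃ v : ℝ → ℂ, Measurable v ∧ MemLp (fun ξ => ((wt β ξ : ℝ) : ℂ)⁻¹ * v ξ) 2 volume ∧
      ∀ η, L η = ∫ ξ, 𝓕 η ξ * v ξ := by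
  set ℓ : StrongDual ℂ (Lp ℂ 2 (volume : Measure ℝ)) := L.extendOfNorm (sobEmb β) with hℓ
  have hℓ' : ∀ η, ℓ (sobEmb β η) = L η :=
    fun η => LinearMap.extendOfNorm_eq (denseRange_sobEmb β) ⟨C, hL⟩ η
  set u := (InnerProductSpace.toDual ℂ (Lp ℂ 2 (volume : Measure ℝ))).symm ℓ with hu
  refine ⟨fun ξ => wt β ξ * (starRingEnd ℂ) (u ξ), ?_, ?_, fun η => ?_⟩
  · exact (Complex.continuous_ofReal.comp (continuous_wt β)).measurable.mul
      (Complex.continuous_conj.measurable.comp (Lp.stronglyMeasurable u).measurable)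
  · refine (Lp.memLp u).star.ae_eq (ae_of_all _ fun ξ => ?_)
    have : ((wt β ξ : ℝ) : ℂ) ≠ 0 := by exact_mod_cast (wt_pos β ξ).ne'
    simp only [inv_mul_cancel_left₀ this]
    rfl
  · rw [← hℓ', ← InnerProductSpace.toDual_symm_apply, L2.inner_def]
    refine integral_congr_ae ?_
    filter_upwards [coeFn_sobEmb β η] with ξ hξ
    rw [hξ]
    simp only [RCLike.inner_apply, ← hu]
    ring

end Kappa

/-! ### The Sobolev calculus on Schwartz functions -/

section SobNorm

theorem sobNorm_sub_le (β : ℝ) (f g : ℝ → ℂ) :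
    sobNorm β (fun x => f x - g x) ≤ sobNorm β f + sobNorm β g := by
  by_cases hf : MemLp f 2 (volume : Measure ℝ)
  swap
  · simp [sobNorm, hf]
  by_cases hg : MemLp g 2 (volume : Measure ℝ)
  swap
  · simp [sobNorm, hg]
  have hfg : MemLp (fun x => f x - g x) 2 (volume : Measure ℝ) := hf.sub hg
  rw [sobNorm, sobNorm, sobNorm, dif_pos hf, dif_pos hg, dif_pos hfg]
  have hmeas : ∀ u : Lp ℂ 2 (volume : Measure ℝ), AEStronglyMeasurable
      (fun t : ℝ => (((1 + |t|) ^ β : ℝ) : ℂ) * u t) volume := fun u =>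
    (Complex.continuous_ofReal.comp (continuous_wt β)).aestronglyMeasurable.mul
      (Lp.aestronglyMeasurable u)
  refine le_trans (le_of_eq ?_) (eLpNorm_sub_le (hmeas _) (hmeas _) one_le_two)
  refine eLpNorm_congr_ae ?_
  have h1 : hfg.toLp (fun x => f x - g x) = hf.toLp f - hg.toLp g := rfl
  rw [h1, sub_eq_add_neg, FourierTransform.fourier_add, FourierTransform.fourier_neg,
    ← sub_eq_add_neg]
  filter_upwards [Lp.coeFn_sub (𝓕 (hf.toLp f) : Lp ℂ 2 (volume : Measure ℝ))
    (𝓕 (hg.toLp g))] with t ht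
  rw [ht, Pi.sub_apply, Pi.sub_apply, mul_sub]

theorem logSobNorm_sub_le (β : ℝ) (f g h : ℝ → ℂ) :
    logSobNorm β (fun l => f l - g l) ≤
      logSobNorm β (fun l => f l - h l) + logSobNorm β (fun l => g l - h l) := by
  refine le_trans (le_of_eq ?_) (sobNorm_sub_le β (fun x => f (Real.exp x) - h (Real.exp x))
    (fun x => g (Real.exp x) - h (Real.exp x)))
  simp only [logSobNorm, sub_sub_sub_cancel_right]

end SobNorm

open scoped SchwartzMap

variable {X : Type*} [NormedAddCommGroup X] [NormedSpace ℂ X]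
  {A : X →ₗ.[ℂ] X} {β : ℝ}

/-- `S = g(A)` in the holomorphic calculus for a function `g` with `g ∘ exp = θ`. -/
def HolRep (A : X →ₗ.[ℂ] X) (θ : 𝓢(ℝ, ℂ)) (S : X →L[ℂ] X) : Prop :=
  ∃ g : ℂ → ℂ, IsHInf g ∧ (∀ x : ℝ, g (Real.exp x) = θ x) ∧
    cauchyCalc A (Real.pi / 2) (fun z => rho z * g z) = rhoOp A * S

theorem IsZeroSectorial.eq_of_rhoOp_mul_eq (hA : IsZeroSectorial A) {S T : X →L[ℂ] X}
    (h : rhoOp A * S = rhoOp A * T) : S = T := by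
  ext x
  exact hA.rhoOp_injective (DFunLike.congr_fun h x)

theorem isSobCalc_of_tendsto (hA : IsZeroSectorial A) {f : ℝ → ℂ} {η : 𝓢(ℝ, ℂ)}
    (hf : ∀ x, f (Real.exp x) = η x) {θ : ℕ → 𝓢(ℝ, ℂ)} {S : ℕ → X →L[ℂ] X} {T : X →L[ℂ] X}
    (hr : ∀ k, HolRep A (θ k) (S k)) (hθ : Tendsto (fun k => ‖sobEmb β (θ k - η)‖) atTop (𝓝 0))
    (hS : Tendsto S atTop (𝓝 T)) : IsSobCalc A β f T := by
  choose g hg hgθ hgS using hr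
  refine ⟨g, S, hg, fun k => ?_, fun k => (hA.holCalc_eq_iff _ _).2 (hgS k), ?_, hS⟩
  · rw [logSobNorm_eq (η := θ k) (hgθ k)]
    exact ENNReal.ofReal_lt_top
  · have : ∀ k, logSobNorm β (fun l => g k l - f l) = ENNReal.ofReal ‖sobEmb β (θ k - η)‖ :=
      fun k => logSobNorm_eq fun x => by rw [hgθ, hf, sub_apply]
    simp only [this]
    simpa using ENNReal.tendsto_ofReal hθ

theorem HolRep.add (hA : IsZeroSectorial A) {θ η : 𝓢(ℝ, ℂ)} {S T : X →L[ℂ] X}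
    (h : HolRep A θ S) (k : HolRep A η T) : HolRep A (θ + η) (S + T) := by
  obtain ⟨f, hf, hfθ, hfS⟩ := h
  obtain ⟨g, hg, hgη, hgT⟩ := k
  refine ⟨fun z => f z + g z, hf.add hg, fun x => ?_, ?_⟩
  · simp only [hfθ, hgη, add_apply]
  · simp only [mul_add]
    rw [cauchyCalc_add hA hf.isDecaying hg.isDecaying, hfS, hgT]

theorem HolRep.smul {θ : 𝓢(ℝ, ℂ)} {S : X →L[ℂ] X} (h : HolRep A θ S) (c : ℂ) :
    HolRep A (c • θ) (c • S) := by
  obtain ⟨f, hf, hfθ, hfS⟩ := h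
  refine ⟨fun z => c * f z, hf.smul c, fun x => ?_, ?_⟩
  · simp only [hfθ, smul_apply, smul_eq_mul]
  · simp only [mul_left_comm _ c]
    rw [cauchyCalc_smul, hfS, mul_smul_comm]

theorem HolRep.sub (hA : IsZeroSectorial A) {θ η : 𝓢(ℝ, ℂ)} {S T : X →L[ℂ] X}
    (h : HolRep A θ S) (k : HolRep A η T) : HolRep A (θ - η) (S - T) := by
  have := h.add hA (k.smul (-1))
  simpa [sub_eq_add_neg] using this

theorem rho_div_exp (a x : ℝ) :
    rho ((Real.exp x : ℂ) / (Real.exp a : ℝ)) = translS a kappa x := by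
  rw [translS_apply, ← rho_exp, Real.exp_sub, Complex.ofReal_div]

/-- The holomorphic calculus is multiplicative if one factor is a dilate of `ρ`. -/
theorem HolRep.mul_kappa [CompleteSpace X] (hA : IsZeroSectorial A) {θ : 𝓢(ℝ, ℂ)} {S : X →L[ℂ] X}
    (h : HolRep A θ S) (a : ℝ) :
    HolRep A (mulS (translS a kappa) θ) (rhoDil A (Real.exp a) * S) := by
  obtain ⟨f, hf, hfθ, hfS⟩ := h
  have ha := Real.exp_pos a
  refine ⟨fun z => rho (z / (Real.exp a : ℝ)) * f z, (isHInf_rho.comp_div ha).mul hf,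
    fun x => ?_, ?_⟩
  · simp only [hfθ, mulS_apply, rho_div_exp]
  · simp only [mul_left_comm (rho _) (rho (_ / _))]
    have h1 := (rhoDil_commute hA zero_lt_one ha).eq
    rw [rhoDil_one] at h1
    rw [← rhoDil_mul_cauchyCalc hA hf.isDecaying ha, hfS, ← mul_assoc, ← h1, mul_assoc]

theorem holRep_kappa [CompleteSpace X] (hA : IsZeroSectorial A) (a : ℝ) :
    HolRep A (translS a kappa) (rhoDil A (Real.exp a)) := by
  have ha := Real.exp_pos a
  refine ⟨fun z => rho (z / (Real.exp a : ℝ)), isHInf_rho.comp_div ha, rho_div_exp a, ?_⟩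
  have h1 := (rhoDil_commute hA zero_lt_one ha).eq
  rw [rhoDil_one] at h1
  have h2 : IsDecaying rho := by simpa using (isHInf_const 1).isDecaying
  rw [h1, ← cauchyCalc_rho hA, rhoDil_mul_cauchyCalc hA h2 ha]
  exact cauchyCalc_congr fun z _ => mul_comm _ _

theorem exp_cpow_I_mul (τ x : ℝ) : (Real.exp x : ℂ) ^ (Complex.I * (2 * Real.pi * τ : ℝ)) =
    Complex.exp (↑(2 * Real.pi * τ * x) * Complex.I) := by
  rw [Complex.cpow_def_of_ne_zero (by exact_mod_cast (Real.exp_pos x).ne'),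
    ← Complex.ofReal_log (Real.exp_pos x).le, Real.log_exp]
  congr 1
  push_cast
  ring

/-- The function `ρ(λ) λ^{2πiτ}` is `e^{2πiτx} κ(x)` in logarithmic coordinates. -/
theorem holRep_modS_kappa [CompleteSpace X] (hA : IsZeroSectorial A) (τ : ℝ) :
    HolRep A (modS τ kappa) (cauchyCalc A (Real.pi / 2)
      (fun z => rho z * z ^ (Complex.I * (2 * Real.pi * τ : ℝ)))) := by
  refine ⟨fun z => rho z * z ^ (Complex.I * (2 * Real.pi * τ : ℝ)),
    isHInf_rho.mul (isHInf_cpow _), fun x => ?_, ?_⟩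
  · simp only [rho_exp, exp_cpow_I_mul, modS_apply]
    rw [mul_comm]
  · rw [← rhoDil_one, rhoDil_mul_cauchyCalc hA (isHInf_cpow _).isDecaying zero_lt_one]
    simp

theorem exists_holRep_of_mem_span [CompleteSpace X] (hA : IsZeroSectorial A) {θ : 𝓢(ℝ, ℂ)}
    (hθ : θ ∈ Submodule.span ℂ (Set.range fun a => translS a kappa)) :
    ∃ S : X →L[ℂ] X, HolRep A θ S := by
  induction hθ using Submodule.span_induction with
  | mem _ h =>
    obtain ⟨a, rfl⟩ := h
    exact ⟨_, holRep_kappa hA a⟩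
  | zero => exact ⟨0, by simpa using (holRep_kappa hA 0).smul 0⟩
  | add _ _ _ _ h k =>
    obtain ⟨S, hS⟩ := h
    obtain ⟨T, hT⟩ := k
    exact ⟨S + T, hS.add hA hT⟩
  | smul c _ _ h =>
    obtain ⟨S, hS⟩ := h
    exact ⟨c • S, hS.smul c⟩

/-- The bounded Sobolev calculus, with the operator named. -/
theorem HasSobCalc.exists_norm_le (hA : IsZeroSectorial A) (h : HasSobCalc A β) :
    ∃ C : ℝ, 0 ≤ C ∧ ∀ (f : ℂ → ℂ) (S : X →L[ℂ] X), IsHInf f →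
      logSobNorm β (fun l => f l) < ∞ →
      cauchyCalc A (Real.pi / 2) (fun z => rho z * f z) = rhoOp A * S →
      ‖S‖ ≤ C * (logSobNorm β (fun l => f l)).toReal := by
  obtain ⟨C, hC⟩ := h
  refine ⟨max C 0, le_max_right _ _, fun f S hf hfin hS => ?_⟩
  obtain ⟨T, hT, hb⟩ := hC f hf hfin
  rw [hA.holCalc_eq_iff, hS] at hT
  rw [hA.eq_of_rhoOp_mul_eq hT]
  exact hb.trans (mul_le_mul_of_nonneg_right (le_max_left _ _) ENNReal.toReal_nonneg)

/-- The continuous extension does not depend on the approximating sequence. -/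
theorem IsSobCalc.unique [CompleteSpace X] (hA : IsZeroSectorial A) (h : HasSobCalc A β) {f : ℝ → ℂ}
    {T T' : X →L[ℂ] X} (hT : IsSobCalc A β f T) (hT' : IsSobCalc A β f T') : T = T' := by
  obtain ⟨C, hC0, hC⟩ := h.exists_norm_le hA
  obtain ⟨g, S, hg, hgf, hgS, hgt, hSt⟩ := hT
  obtain ⟨g', S', hg', hgf', hgS', hgt', hSt'⟩ := hT'
  have hsub : ∀ k, IsHInf fun z => g k z + -1 * g' k z := fun k => (hg k).add ((hg' k).smul _)
  have hle : ∀ k, logSobNorm β (fun l => g k l + -1 * g' k l) ≤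
      logSobNorm β (fun l => g k l - f l) + logSobNorm β (fun l => g' k l - f l) := fun k => by
    simpa [sub_eq_add_neg] using
      logSobNorm_sub_le β (fun l => g k l) (fun l => g' k l) f
  have hlim : Tendsto (fun k => logSobNorm β (fun l => g k l + -1 * g' k l)) atTop (𝓝 0) := by
    refine tendsto_of_tendsto_of_tendsto_of_le_of_le tendsto_const_nhds ?_ (fun _ => zero_le) hle
    simpa using hgt.add hgt'
  have hev : ∀ᶠ k in atTop, ‖S k - S' k‖ ≤
      C * (logSobNorm β (fun l => g k l + -1 * g' k l)).toReal := by
    filter_upwards [hlim.eventually_lt_const ENNReal.zero_lt_top] with k hk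
    refine hC _ _ (hsub k) hk ?_
    have h1 := (hA.holCalc_eq_iff (g k) (S k)).1 (hgS k)
    have h2 := (hA.holCalc_eq_iff (g' k) (S' k)).1 (hgS' k)
    simp only [mul_add, mul_left_comm _ (-1 : ℂ)]
    rw [cauchyCalc_add hA (hg k).isDecaying ((hg' k).isDecaying.smul _), cauchyCalc_smul, h1, h2,
      mul_sub, neg_one_smul, sub_eq_add_neg]
  have h0 : Tendsto (fun k => ‖S k - S' k‖) atTop (𝓝 0) := by
    refine squeeze_zero' (Eventually.of_forall fun _ => norm_nonneg _) hev ?_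
    have := (ENNReal.tendsto_toReal ENNReal.zero_ne_top).comp hlim
    simpa using this.const_mul C
  have h1 := tendsto_nhds_unique h0 (hSt.sub hSt').norm
  exact sub_eq_zero.1 (norm_eq_zero.1 h1.symm)

theorem IsSobCalc.sobCalc_eq [CompleteSpace X] (hA : IsZeroSectorial A) (h : HasSobCalc A β)
    {f : ℝ → ℂ}
    {T : X →L[ℂ] X} (hT : IsSobCalc A β f T) : sobCalc A β f = T := by
  have hex : ∃ T, IsSobCalc A β f T := ⟨T, hT⟩
  rw [sobCalc, dif_pos hex]
  exact hex.choose_spec.unique hA h hT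

theorem HolRep.norm_le (hA : IsZeroSectorial A) (h : HasSobCalc A β) :
    ∃ C : ℝ, 0 ≤ C ∧ ∀ (θ : 𝓢(ℝ, ℂ)) (S : X →L[ℂ] X), HolRep A θ S → ‖S‖ ≤ C * ‖sobEmb β θ‖ := by
  obtain ⟨C, hC0, hC⟩ := h.exists_norm_le hA
  refine ⟨C, hC0, fun θ S ⟨g, hg, hgθ, hgS⟩ => ?_⟩
  have h1 : logSobNorm β (fun l => g l) = ENNReal.ofReal ‖sobEmb β θ‖ := logSobNorm_eq hgθ
  have := hC g S hg (by rw [h1]; exact ENNReal.ofReal_lt_top) hgS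
  rwa [h1, ENNReal.toReal_ofReal (norm_nonneg _)] at this

/-- Every Schwartz function (in logarithmic coordinates) is in the domain of the Sobolev calculus,
since it is a limit of linear combinations of the functions `ρ(· / b)`. -/
theorem exists_holRep_tendsto [CompleteSpace X] (hA : IsZeroSectorial A) (h : HasSobCalc A β)
    (η : 𝓢(ℝ, ℂ)) :
    ∃ (θ : ℕ → 𝓢(ℝ, ℂ)) (S : ℕ → X →L[ℂ] X) (T : X →L[ℂ] X), (∀ k, HolRep A (θ k) (S k)) ∧
      Tendsto (fun k => ‖sobEmb β (θ k - η)‖) atTop (𝓝 0) ∧ Tendsto S atTop (𝓝 T) := by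
  obtain ⟨C, hC0, hC⟩ := HolRep.norm_le hA h
  have h1 : ∀ k : ℕ, ∃ θ ∈ Submodule.span ℂ (Set.range fun a => translS a kappa),
      ‖sobEmb β (θ - η)‖ < 1 / ((k : ℝ) + 1) := fun k =>
    exists_span_kappa_approx β η (by positivity)
  choose θ hθ hθη using h1
  choose S hS using fun k => exists_holRep_of_mem_span hA (hθ k)
  have hlim : Tendsto (fun k => ‖sobEmb β (θ k - η)‖) atTop (𝓝 0) :=
    squeeze_zero (fun _ => norm_nonneg _) (fun k => (hθη k).le)
      tendsto_one_div_add_atTop_nhds_zero_nat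
  have hlim' : Tendsto (fun k => sobEmb β (θ k)) atTop (𝓝 (sobEmb β η)) := by
    rw [tendsto_iff_norm_sub_tendsto_zero]
    simpa only [← map_sub] using hlim
  have hcau : CauchySeq S := by
    have h2 := hlim'.cauchySeq
    rw [Metric.cauchySeq_iff'] at h2 ⊢
    intro e he
    obtain ⟨N, hN⟩ := h2 (e / (C + 1)) (by positivity)
    refine ⟨N, fun n hn => ?_⟩
    have h3 := hC _ _ ((hS n).sub hA (hS N))
    have h4 := hN n hn
    rw [dist_eq_norm, ← map_sub] at h4
    rw [dist_eq_norm]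
    rw [lt_div_iff₀ (by positivity)] at h4
    nlinarith [norm_nonneg (sobEmb β (θ n - θ N))]
  obtain ⟨T, hT⟩ := cauchySeq_tendsto_of_complete hcau
  exact ⟨θ, S, T, hS, hlim, hT⟩

/-- The properties of the Sobolev calculus `Φ(η) = f(A)`, `η = f ∘ exp`, on Schwartz functions. -/
structure IsSobRep (A : X →ₗ.[ℂ] X) (β : ℝ) (Φ : 𝓢(ℝ, ℂ) →ₗ[ℂ] (X →L[ℂ] X)) : Prop where
  bound : ∃ C : ℝ, 0 ≤ C ∧ ∀ η, ‖Φ η‖ ≤ C * ‖sobEmb β η‖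
  sobCalc_eq : ∀ (f : ℝ → ℂ) (η : 𝓢(ℝ, ℂ)), (∀ x, f (Real.exp x) = η x) → sobCalc A β f = Φ η
  map_mul : ∀ η θ, Φ (mulS η θ) = Φ η * Φ θ
  map_kappa : Φ kappa = rhoOp A
  map_modS_kappa : ∀ τ : ℝ, Φ (modS τ kappa) = cauchyCalc A (Real.pi / 2)
    (fun z => rho z * z ^ (Complex.I * (2 * Real.pi * τ : ℝ)))

theorem mulS_comm (η θ : 𝓢(ℝ, ℂ)) : mulS η θ = mulS θ η := by
  ext x
  rw [mulS_apply, mulS_apply, mul_comm]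

theorem mulS_sub (η θ θ' : 𝓢(ℝ, ℂ)) : mulS η (θ - θ') = mulS η θ - mulS η θ' := by
  ext x
  rw [mulS_apply, sub_apply, sub_apply, mulS_apply, mulS_apply, mul_sub]

theorem mulS_add (η θ θ' : 𝓢(ℝ, ℂ)) : mulS η (θ + θ') = mulS η θ + mulS η θ' := by
  ext x
  rw [mulS_apply, add_apply, add_apply, mulS_apply, mulS_apply, mul_add]

theorem mulS_smul (c : ℂ) (η θ : 𝓢(ℝ, ℂ)) : mulS η (c • θ) = c • mulS η θ := by
  ext x
  rw [mulS_apply, smul_apply, smul_apply, mulS_apply, smul_eq_mul,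
    smul_eq_mul, mul_left_comm]

/-- The extension of the holomorphic calculus by continuity. It is multiplicative, since it is so
when one factor is a translate of `κ` and these span a dense subspace. -/
theorem exists_isSobRep [CompleteSpace X] (hA : IsZeroSectorial A) (hβ : 0 ≤ β)
    (h : HasSobCalc A β) :
    ∃ Φ : 𝓢(ℝ, ℂ) →ₗ[ℂ] (X →L[ℂ] X), IsSobRep A β Φ := by
  choose θ S T hr hθ hS using exists_holRep_tendsto (X := X) hA h
  have huniq : ∀ (η : 𝓢(ℝ, ℂ)) (θ' : ℕ → 𝓢(ℝ, ℂ)) (S' : ℕ → X →L[ℂ] X) (T' : X →L[ℂ] X),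
      (∀ k, HolRep A (θ' k) (S' k)) → Tendsto (fun k => ‖sobEmb β (θ' k - η)‖) atTop (𝓝 0) →
      Tendsto S' atTop (𝓝 T') → T' = T η := by
    intro η θ' S' T' hr' hθ' hS'
    have hf : ∀ x, (fun l => η (Real.log l)) (Real.exp x) = η x := fun x => by
      simp only [Real.log_exp]
    exact (isSobCalc_of_tendsto (f := fun l => η (Real.log l)) hA hf hr' hθ' hS').unique hA h
      (isSobCalc_of_tendsto hA hf (hr η) (hθ η) (hS η))
  have hrep : ∀ (η : 𝓢(ℝ, ℂ)) (S' : X →L[ℂ] X), HolRep A η S' → T η = S' := fun η S' h' =>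
    (huniq η (fun _ => η) (fun _ => S') S' (fun _ => h') (by simp) tendsto_const_nhds).symm
  let Φ : 𝓢(ℝ, ℂ) →ₗ[ℂ] (X →L[ℂ] X) :=
    { toFun := T
      map_add' := fun η η' => by
        refine (huniq (η + η') (fun k => θ η k + θ η' k) (fun k => S η k + S η' k) _
          (fun k => (hr η k).add hA (hr η' k)) ?_ ((hS η).add (hS η'))).symm
        refine squeeze_zero (fun _ => norm_nonneg _) (fun k => ?_)
          (by simpa only [add_zero] using (hθ η).add (hθ η'))
        rw [add_sub_add_comm, map_add (sobEmb β)]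
        exact norm_add_le _ _
      map_smul' := fun c η => by
        refine (huniq (c • η) (fun k => c • θ η k) (fun k => c • S η k) _
          (fun k => (hr η k).smul c) ?_ ((hS η).const_smul c)).symm
        simp only [← smul_sub, map_smul, norm_smul]
        simpa using (hθ η).const_mul ‖c‖ }
  obtain ⟨C, hC0, hC⟩ := HolRep.norm_le hA h
  have hemb : ∀ η, Tendsto (fun k => sobEmb β (θ η k)) atTop (𝓝 (sobEmb β η)) := fun η => by
    rw [tendsto_iff_norm_sub_tendsto_zero]
    simpa only [← map_sub] using hθ η
  have hbound : ∀ η, ‖Φ η‖ ≤ C * ‖sobEmb β η‖ := fun η =>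
    le_of_tendsto_of_tendsto' (hS η).norm ((hemb η).norm.const_mul C) fun k => hC _ _ (hr η k)
  -- The bound makes `Φ` continuous for the Sobolev norm.
  have hcont : ∀ (η : 𝓢(ℝ, ℂ)) (η' : ℕ → 𝓢(ℝ, ℂ)),
      Tendsto (fun k => ‖sobEmb β (η' k - η)‖) atTop (𝓝 0) →
      Tendsto (fun k => Φ (η' k)) atTop (𝓝 (Φ η)) := by
    intro η η' hη
    rw [tendsto_iff_norm_sub_tendsto_zero]
    refine squeeze_zero (fun _ => norm_nonneg _) (fun k => ?_)
      (by simpa only [mul_zero] using hη.const_mul C)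
    rw [← map_sub]
    exact hbound _
  have hmulcont : ∀ (ζ η : 𝓢(ℝ, ℂ)) (η' : ℕ → 𝓢(ℝ, ℂ)),
      Tendsto (fun k => ‖sobEmb β (η' k - η)‖) atTop (𝓝 0) →
      Tendsto (fun k => ‖sobEmb β (mulS ζ (η' k) - mulS ζ η)‖) atTop (𝓝 0) := by
    intro ζ η η' hη
    refine squeeze_zero (fun _ => norm_nonneg _) (fun k => ?_)
      (by simpa only [mul_zero] using hη.const_mul (∫ τ, wt β τ * ‖𝓕 ζ τ‖))
    rw [← mulS_sub]
    exact norm_sobEmb_mulS_le hβ _ _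
  have hk : ∀ a, Φ (translS a kappa) = rhoDil A (Real.exp a) := fun a =>
    hrep _ _ (holRep_kappa hA a)
  have hmul1 : ∀ (a : ℝ) (η : 𝓢(ℝ, ℂ)),
      Φ (mulS η (translS a kappa)) = Φ η * Φ (translS a kappa) := by
    intro a η
    have h1 : Tendsto (fun k => Φ (mulS (translS a kappa) (θ η k))) atTop
        (𝓝 (Φ (mulS (translS a kappa) η))) := hcont _ _ (hmulcont _ _ _ (hθ η))
    have h2 : ∀ k, Φ (mulS (translS a kappa) (θ η k)) = rhoDil A (Real.exp a) * Φ (θ η k) := by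
      intro k
      rw [show Φ (θ η k) = S η k from hrep _ _ (hr η k)]
      exact hrep _ _ ((hr η k).mul_kappa hA a)
    have h3 := tendsto_nhds_unique h1 (by
      simp only [h2]
      exact (hcont _ _ (hθ η)).const_mul _)
    have h4 : Commute (rhoDil A (Real.exp a)) (Φ η) := by
      have h5 : ∀ ζ ∈ Submodule.span ℂ (Set.range fun a => translS a kappa),
          Commute (rhoDil A (Real.exp a)) (Φ ζ) := by
        intro ζ hζ
        induction hζ using Submodule.span_induction with
        | mem _ h =>
          obtain ⟨b, rfl⟩ := h
          simp only [hk]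
          exact rhoDil_commute hA (Real.exp_pos _) (Real.exp_pos _)
        | zero => rw [map_zero]; exact Commute.zero_right _
        | add _ _ _ _ h k => rw [map_add]; exact h.add_right k
        | smul c _ _ h => rw [map_smul]; exact h.smul_right c
      have h6 : ∀ k : ℕ, ∃ ζ ∈ Submodule.span ℂ (Set.range fun a => translS a kappa),
          ‖sobEmb β (ζ - η)‖ < 1 / ((k : ℝ) + 1) := fun k =>
        exists_span_kappa_approx β η (by positivity)
      choose ζ hζ hζη using h6
      have h7 : Tendsto (fun k => ‖sobEmb β (ζ k - η)‖) atTop (𝓝 0) :=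
        squeeze_zero (fun _ => norm_nonneg _) (fun k => (hζη k).le)
          tendsto_one_div_add_atTop_nhds_zero_nat
      refine tendsto_nhds_unique ((hcont _ _ h7).const_mul _) ?_
      simp only [(h5 _ (hζ _)).eq]
      exact (hcont _ _ h7).mul_const _
    rw [mulS_comm, h3, hk, h4.eq]
  refine ⟨Φ, ⟨C, hC0, hbound⟩, fun f η hf =>
    (isSobCalc_of_tendsto hA hf (hr η) (hθ η) (hS η)).sobCalc_eq hA h, fun η ζ => ?_, ?_,
    fun τ => hrep _ _ (holRep_modS_kappa hA τ)⟩
  · have h1 : ∀ ξ ∈ Submodule.span ℂ (Set.range fun a => translS a kappa),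
        Φ (mulS η ξ) = Φ η * Φ ξ := by
      intro ξ hξ
      induction hξ using Submodule.span_induction with
      | mem _ h =>
        obtain ⟨b, rfl⟩ := h
        exact hmul1 b η
      | zero => rw [show mulS η 0 = 0 by ext x; simp [mulS_apply], map_zero, mul_zero]
      | add _ _ _ _ h k => rw [mulS_add, map_add, map_add, h, k, mul_add]
      | smul c _ _ h => rw [mulS_smul, map_smul, map_smul, h, mul_smul_comm]
    have h6 : ∀ k : ℕ, ∃ ξ ∈ Submodule.span ℂ (Set.range fun a => translS a kappa),
        ‖sobEmb β (ξ - ζ)‖ < 1 / ((k : ℝ) + 1) := fun k =>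
      exists_span_kappa_approx β ζ (by positivity)
    choose ξ hξ hξζ using h6
    have h7 : Tendsto (fun k => ‖sobEmb β (ξ k - ζ)‖) atTop (𝓝 0) :=
      squeeze_zero (fun _ => norm_nonneg _) (fun k => (hξζ k).le)
        tendsto_one_div_add_atTop_nhds_zero_nat
    refine tendsto_nhds_unique (hcont _ _ (hmulcont η _ _ h7)) ?_
    simp only [h1 _ (hξ _)]
    exact (hcont _ _ h7).const_mul _
  · have h1 := hk 0
    rw [Real.exp_zero, rhoDil_one] at h1
    rw [← h1]
    congr 1
    ext x
    rw [translS_apply, sub_zero]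

theorem integrable_schwartz_mul {v : ℝ → ℂ}
    (hv : MemLp (fun ξ => ((wt β ξ : ℝ) : ℂ)⁻¹ * v ξ) 2 volume) (θ : 𝓢(ℝ, ℂ)) :
    Integrable fun ξ => θ ξ * v ξ := by
  refine ((memLp_wt_mul β θ).integrable_mul hv).congr (ae_of_all _ fun ξ => ?_)
  have : ((wt β ξ : ℝ) : ℂ) ≠ 0 := by exact_mod_cast (wt_pos β ξ).ne'
  simp only [Pi.mul_apply]
  field_simp

/-- The functional `η ↦ ⟨Φ(η) x, x'⟩`. -/
noncomputable def matCoeff (Φ : 𝓢(ℝ, ℂ) →ₗ[ℂ] (X →L[ℂ] X)) (x : X) (x' : StrongDual ℂ X) :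
    𝓢(ℝ, ℂ) →ₗ[ℂ] ℂ where
  toFun η := x' (Φ η x)
  map_add' η θ := by simp
  map_smul' c η := by simp

theorem matCoeff_apply (Φ : 𝓢(ℝ, ℂ) →ₗ[ℂ] (X →L[ℂ] X)) (x : X) (x' : StrongDual ℂ X)
    (η : 𝓢(ℝ, ℂ)) : matCoeff Φ x x' η = x' (Φ η x) := rfl

theorem IsSobRep.matCoeff_le {Φ : 𝓢(ℝ, ℂ) →ₗ[ℂ] (X →L[ℂ] X)} (hΦ : IsSobRep A β Φ) (x : X)
    (x' : StrongDual ℂ X) : ∃ C : ℝ, 0 ≤ C ∧ ∀ η, ‖matCoeff Φ x x' η‖ ≤ C * ‖sobEmb β η‖ := by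
  obtain ⟨C, hC0, hC⟩ := hΦ.bound
  refine ⟨‖x'‖ * C * ‖x‖, by positivity, fun η => ?_⟩
  calc ‖x' (Φ η x)‖ ≤ ‖x'‖ * (‖Φ η‖ * ‖x‖) :=
        (x'.le_opNorm _).trans (by gcongr; exact (Φ η).le_opNorm x)
    _ ≤ ‖x'‖ * (C * ‖sobEmb β η‖ * ‖x‖) := by gcongr; exact hC η
    _ = _ := by ring

/-- A vector is determined by the operators of the calculus which belong to smooth functions of
compact support. -/
theorem IsSobRep.eq_zero {Φ : 𝓢(ℝ, ℂ) →ₗ[ℂ] (X →L[ℂ] X)} (hΦ : IsSobRep A β Φ)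
    (hA : IsZeroSectorial A) {y : X} (h : ∀ η : 𝓢(ℝ, ℂ), HasCompactSupport η → Φ η y = 0) :
    y = 0 := by
  refine hA.rhoOp_injective ?_
  rw [map_zero, ← hΦ.map_kappa]
  refine SeparatingDual.eq_zero_of_forall_dual_eq_zero (R := ℂ) fun x' => ?_
  obtain ⟨C, -, hC⟩ := hΦ.matCoeff_le y x'
  obtain ⟨v, -, hv2, hv⟩ := exists_density _ hC
  have h0 := ae_eq_zero_of_integral_fourier_eq_zero (integrable_schwartz_mul hv2) fun θ hθ => by
    rw [← hv, matCoeff_apply, h θ hθ, map_zero]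
  rw [← matCoeff_apply, hv]
  refine integral_eq_zero_of_ae ?_
  filter_upwards [h0] with ξ hξ
  rw [hξ, Pi.zero_apply, mul_zero]

/-! ### The calculus core -/

section Core

open scoped SchwartzMap

variable {X : Type*} [NormedAddCommGroup X] [NormedSpace ℂ X]
  {A : X →ₗ.[ℂ] X} {β : ℝ} {ψ : ℝ → ℂ} {Φ : 𝓢(ℝ, ℂ) →ₗ[ℂ] (X →L[ℂ] X)}

theorem exists_schwartz_mul {w : ℝ → ℂ} (hw : ContDiff ℝ (⊤ : ℕ∞) w) {η : 𝓢(ℝ, ℂ)}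
    (hη : HasCompactSupport η) :
    ∃ θ : 𝓢(ℝ, ℂ), HasCompactSupport θ ∧ ∀ x, θ x = w x * η x :=
  ⟨HasCompactSupport.toSchwartzMap (f := fun x => w x * η x) hη.mul_left
    (hw.mul (η.smooth ⊤)), hη.mul_left, fun _ => rfl⟩

theorem IsDyadic.eq_zero_of_abs (hψ : IsDyadic ψ) {n : ℤ} {x : ℝ}
    (h : Real.log 2 < |x - n * Real.log 2|) : dyad ψ n (Real.exp x) = 0 := by
  by_contra hne
  have h1 : (2 : ℝ) ^ (-n) * Real.exp x ∈ Set.Icc (1 / 2 : ℝ) 2 :=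
    hψ.supp (subset_tsupport _ hne)
  have h2 : (2 : ℝ) ^ (-n) * Real.exp x = Real.exp (x - n * Real.log 2) := by
    rw [sub_eq_neg_add, Real.exp_add, ← Real.rpow_intCast, Real.rpow_def_of_pos two_pos]
    congr 2
    push_cast
    ring
  rw [h2] at h1
  have h3 := Real.log_le_log (by norm_num) h1.1
  have h4 := Real.log_le_log (Real.exp_pos _) h1.2
  rw [Real.log_exp] at h3 h4
  rw [one_div, Real.log_inv] at h3
  exact absurd (abs_le.2 ⟨h3, h4⟩) (not_le.2 h)

/-- The functions `ψ_n ∘ exp` as Schwartz functions. -/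
theorem IsDyadic.exists_schwartz (hψ : IsDyadic ψ) (n : ℤ) :
    ∃ η : 𝓢(ℝ, ℂ), HasCompactSupport η ∧ ∀ x, η x = dyad ψ n (Real.exp x) := by
  have hc : HasCompactSupport fun x => dyad ψ n (Real.exp x) := by
    refine HasCompactSupport.intro (isCompact_Icc (a := n * Real.log 2 - Real.log 2)
      (b := n * Real.log 2 + Real.log 2)) fun x hx => hψ.eq_zero_of_abs ?_
    by_contra h
    rw [not_lt, abs_le] at h
    exact hx ⟨by linarith [h.1], by linarith [h.2]⟩
  have hs : ContDiff ℝ (⊤ : ℕ∞) fun x => dyad ψ n (Real.exp x) :=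
    hψ.smooth.comp (contDiff_const.mul Real.contDiff_exp)
  exact ⟨hc.toSchwartzMap hs, hc, fun _ => rfl⟩

/-- On a compact set the partition of unity is a finite sum. -/
theorem IsDyadic.exists_sum_eq_one (hψ : IsDyadic ψ) (R : ℝ) : ∃ M : ℕ, ∀ K : ℕ, M ≤ K →
    ∀ x : ℝ, |x| ≤ R → ∑ n ∈ Finset.Icc (-(K : ℤ)) K, dyad ψ n (Real.exp x) = 1 := by
  have hl : 0 < Real.log 2 := Real.log_pos one_lt_two
  obtain ⟨M, hM⟩ := exists_nat_gt (R / Real.log 2 + 1)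
  refine ⟨M, fun K hK x hx => ?_⟩
  refine HasSum.unique (hasSum_sum_of_ne_finset_zero fun n hn => ?_)
    (hψ.sum_eq_one (Real.exp x) (Real.exp_pos x))
  refine hψ.eq_zero_of_abs ?_
  rw [← lt_sub_iff_add_lt, div_lt_iff₀ hl] at hM
  have h1 : (K : ℤ) < |n| := by
    rw [Finset.mem_Icc, ← abs_le, not_le] at hn
    exact hn
  have h2 : (K : ℝ) < |(n : ℝ)| := by exact_mod_cast h1
  have h3 : (M : ℝ) ≤ K := by exact_mod_cast hK
  have h4 : |(n : ℝ) * Real.log 2| = |(n : ℝ)| * Real.log 2 := by rw [abs_mul, abs_of_pos hl]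
  have h5 := abs_sub_abs_le_abs_sub ((n : ℝ) * Real.log 2) x
  rw [abs_sub_comm] at h5
  nlinarith

theorem mulS_sum {ι : Type*} (s : Finset ι) (η : 𝓢(ℝ, ℂ)) (θ : ι → 𝓢(ℝ, ℂ)) :
    mulS η (∑ i ∈ s, θ i) = ∑ i ∈ s, mulS η (θ i) := by
  ext x
  simp only [mulS_apply, sum_apply, Finset.mul_sum]

theorem IsSobRep.mul_apply (hΦ : IsSobRep A β Φ) (η θ : 𝓢(ℝ, ℂ)) (x : X) :
    Φ (mulS η θ) x = Φ η (Φ θ x) := by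
  rw [hΦ.map_mul]
  rfl

/-- A vector of the core is localized by a smooth function `φ` of compact support, a finite sum of
members of the partition of unity: it is fixed by `φ(A)`, and the finite sums which define `f(A)` on
the core all have the value `(f φ)(A) x`. -/
theorem IsSobRep.exists_localization (hΦ : IsSobRep A β Φ) (hA : IsZeroSectorial A)
    (hψ : IsDyadic ψ) {x : X} (hx : x ∈ calcCore A β ψ) :
    ∃ φ : 𝓢(ℝ, ℂ), HasCompactSupport φ ∧ Φ φ x = x ∧
      ∀ (f : ℝ → ℂ) (θ : 𝓢(ℝ, ℂ)), ContDiff ℝ (⊤ : ℕ∞) (fun x => f (Real.exp x)) →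
        (∀ x, θ x = f (Real.exp x) * φ x) → ∃ N : ℕ, ∀ K : ℕ, N ≤ K →
          ∑ n ∈ Finset.Icc (-(K : ℤ)) K, sobCalc A β (fun l => f l * dyad ψ n l) x = Φ θ x := by
  obtain ⟨N, hN⟩ := hx
  choose p hpc hp using hψ.exists_schwartz
  have hp0 : ∀ n : ℤ, (N : ℤ) ≤ |n| → Φ (p n) x = 0 := fun n hn => by
    rw [← hΦ.sobCalc_eq (dyad ψ n) (p n) (fun y => (hp n y).symm)]
    exact hN n hn
  have hunit : ∀ η : 𝓢(ℝ, ℂ), HasCompactSupport η → ∃ M : ℕ, ∀ K : ℕ, M ≤ K →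
      mulS η (∑ n ∈ Finset.Icc (-(K : ℤ)) K, p n) = η := by
    intro η hη
    obtain ⟨R, hR⟩ := hη.isCompact.isBounded.exists_norm_le
    obtain ⟨M, hM⟩ := hψ.exists_sum_eq_one R
    refine ⟨M, fun K hK => ?_⟩
    ext y
    rw [mulS_apply]
    by_cases hy : η y = 0
    · rw [hy, zero_mul]
    · rw [sum_apply]
      simp only [hp]
      rw [hM K hK y (hR y (subset_tsupport _ hy)), mul_one]
  -- Members of the partition with large index do not contribute.
  have hshrink : ∀ (F : ℤ → X), (∀ n : ℤ, (N : ℤ) ≤ |n| → F n = 0) → ∀ K : ℕ, N ≤ K →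
      ∑ n ∈ Finset.Icc (-(K : ℤ)) K, F n = ∑ n ∈ Finset.Icc (-(N : ℤ)) N, F n := by
    intro F hF K hK
    have hK' : (N : ℤ) ≤ K := by exact_mod_cast hK
    symm
    refine Finset.sum_subset (Finset.Icc_subset_Icc (by omega) hK') fun n _ hn => hF n ?_
    rw [Finset.mem_Icc, ← abs_le, not_le] at hn
    exact hn.le
  set φ : 𝓢(ℝ, ℂ) := ∑ n ∈ Finset.Icc (-(N : ℤ)) N, p n with hφ
  have hφc : HasCompactSupport φ := by
    rw [hφ]
    refine Finset.sum_induction p (fun η : 𝓢(ℝ, ℂ) => HasCompactSupport η)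
      (fun a b ha hb => ha.add hb) HasCompactSupport.zero fun n _ => hpc n
  refine ⟨φ, hφc, ?_, fun f θ hf hθ => ⟨N, fun K hK => ?_⟩⟩
  · rw [← sub_eq_zero]
    refine hΦ.eq_zero hA fun η hη => ?_
    obtain ⟨M, hM⟩ := hunit η hη
    have h1 := hM (max M N) (le_max_left _ _)
    rw [map_sub, ← hΦ.mul_apply]
    conv_lhs => rw [← h1]
    rw [hφ, h1, mulS_sum, map_sum, sum_apply]
    have h2 := hshrink (fun n => Φ (mulS η (p n)) x)
      (fun n hn => by rw [hΦ.mul_apply, hp0 n hn, map_zero]) (max M N) (le_max_right _ _)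
    rw [← h2, ← sum_apply, ← map_sum, ← mulS_sum, h1, sub_self]
  · choose q hqc hq using fun n => exists_schwartz_mul hf (hpc n)
    have hs : ∀ n, sobCalc A β (fun l => f l * dyad ψ n l) = Φ (q n) := fun n =>
      hΦ.sobCalc_eq _ _ fun y => by rw [hq, hp]
    simp only [hs]
    rw [hshrink (fun n => Φ (q n) x) (fun n hn => ?_) K hK, ← sum_apply, ← map_sum]
    · congr 2
      ext y
      simp only [sum_apply, hq, hθ, hφ, Finset.mul_sum]
    · obtain ⟨M, hM⟩ := hunit (p n) (hpc n)
      have h1 := hM M le_rfl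
      set P : 𝓢(ℝ, ℂ) := ∑ k ∈ Finset.Icc (-(M : ℤ)) M, p k with hP
      have hPc : HasCompactSupport P := by
        rw [hP]
        refine Finset.sum_induction p (fun η : 𝓢(ℝ, ℂ) => HasCompactSupport η)
          (fun a b ha hb => ha.add hb) HasCompactSupport.zero fun n _ => hpc n
      obtain ⟨r, -, hr⟩ := exists_schwartz_mul hf hPc
      have h2 : q n = mulS r (p n) := by
        ext y
        rw [mulS_apply, hq, hr, mul_assoc, mul_comm (P y), ← mulS_apply, h1]
      rw [h2, hΦ.mul_apply, hp0 n hn, map_zero]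

/-- The operator `f(A)` for a function `f` which is smooth on `(0, ∞)`: it is closable on the core,
since `η(A) f(A) x = (η f)(A) x` for every smooth `η` of compact support. -/
theorem IsSobRep.unbddCalc_single (hΦ : IsSobRep A β Φ) (hA : IsZeroSectorial A)
    (hψ : IsDyadic ψ) {f : ℝ → ℂ} (hf : ContDiff ℝ (⊤ : ℕ∞) (fun x => f (Real.exp x))) :
    ∀ p ∈ (coreGraph A β ψ f).topologicalClosure, p.1 = 0 → p.2 = 0 := by
  intro p hp hp0
  refine hΦ.eq_zero hA fun η hη => ?_
  obtain ⟨r, -, hr⟩ := exists_schwartz_mul hf hη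
  have hcl : IsClosed {q : X × X | Φ η q.2 = Φ r q.1} :=
    isClosed_eq (by fun_prop) (by fun_prop)
  have hsub : ((coreGraph A β ψ f : Submodule ℂ (X × X)) : Set (X × X)) ⊆
      {q : X × X | Φ η q.2 = Φ r q.1} := by
    rintro q ⟨hq, N, hN⟩
    obtain ⟨φ, hφc, hφ, hsum⟩ := hΦ.exists_localization hA hψ hq
    obtain ⟨θ, -, hθ⟩ := exists_schwartz_mul hf hφc
    obtain ⟨M, hM⟩ := hsum f θ hf hθ
    have h1 := hN (max M N) (le_max_right _ _)
    rw [hM _ (le_max_left _ _)] at h1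
    rw [Set.mem_ofPred_eq, ← h1, ← hΦ.mul_apply]
    conv_rhs => rw [← hφ]
    rw [← hΦ.mul_apply]
    congr 2
    ext y
    rw [mulS_apply, mulS_apply, hθ, hr]
    ring
  have h2 : p ∈ {q : X × X | Φ η q.2 = Φ r q.1} := closure_minimal hsub hcl hp
  rw [Set.mem_ofPred_eq, hp0, map_zero] at h2
  exact h2

theorem IsSobRep.unbddCalc_graph (hΦ : IsSobRep A β Φ) (hA : IsZeroSectorial A)
    (hψ : IsDyadic ψ) {f : ℝ → ℂ} (hf : ContDiff ℝ (⊤ : ℕ∞) (fun x => f (Real.exp x))) :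
    (unbddCalc A β ψ f).graph = (coreGraph A β ψ f).topologicalClosure :=
  Submodule.toLinearPMap_graph_eq _ (hΦ.unbddCalc_single hA hψ hf)

theorem IsSobRep.unbddCalc_isClosed (hΦ : IsSobRep A β Φ) (hA : IsZeroSectorial A)
    (hψ : IsDyadic ψ) {f : ℝ → ℂ} (hf : ContDiff ℝ (⊤ : ℕ∞) (fun x => f (Real.exp x))) :
    (unbddCalc A β ψ f).IsClosed := by
  rw [LinearPMap.IsClosed, hΦ.unbddCalc_graph hA hψ hf]
  exact Submodule.isClosed_topologicalClosure _

theorem mem_domain_opVal {P : X →ₗ.[ℂ] X} {x y : X} (h : (x, y) ∈ P.graph) :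
    x ∈ P.domain ∧ opVal P x = y := by
  obtain ⟨⟨z, hz⟩, hzx, hzy⟩ := (LinearPMap.mem_graph_iff P).1 h
  dsimp only at hzx hzy
  subst hzx
  exact ⟨hz, by rw [opVal, dif_pos hz, hzy]⟩

/-- The operators of the theorem on a vector of the core, in terms of one localizing function. -/
theorem IsSobRep.exists_core_rep [CompleteSpace X] (hΦ : IsSobRep A β Φ) (hA : IsZeroSectorial A)
    (hψ : IsDyadic ψ) {x : X} (hx : x ∈ calcCore A β ψ) :
    ∃ φ : 𝓢(ℝ, ℂ), HasCompactSupport φ ∧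
      (∀ (f : ℝ → ℂ) (θ : 𝓢(ℝ, ℂ)), ContDiff ℝ (⊤ : ℕ∞) (fun x => f (Real.exp x)) →
        (∀ x, θ x = f (Real.exp x) * φ x) →
          x ∈ (unbddCalc A β ψ f).domain ∧ opVal (unbddCalc A β ψ f) x = Φ θ x) ∧
      ∀ τ : ℝ, x ∈ (imagPow A (2 * Real.pi * τ)).domain ∧
        opVal (imagPow A (2 * Real.pi * τ)) x = Φ (modS τ φ) x := by
  obtain ⟨φ, hφc, hφ, hsum⟩ := hΦ.exists_localization hA hψ hx
  refine ⟨φ, hφc, fun f θ hf hθ => ?_, fun τ => ?_⟩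
  · refine mem_domain_opVal ?_
    rw [hΦ.unbddCalc_graph hA hψ hf]
    exact Submodule.le_topologicalClosure _ ⟨hx, hsum f θ hf hθ⟩
  · refine hA.opVal_holCalc ?_
    rw [← hΦ.map_modS_kappa, ← hΦ.map_kappa, ← hΦ.mul_apply]
    conv_lhs => rw [← hφ]
    rw [← hΦ.mul_apply]
    congr 2
    ext y
    simp only [mulS_apply, modS_apply]
    ring

theorem contDiff_waveFun_exp (ε α : ℝ) (m : ℕ) {s : ℝ} (hs : 0 < s) :
    ContDiff ℝ (⊤ : ℕ∞) (fun x => waveFun ε α m s (Real.exp x)) := by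
  unfold waveFun
  have h1 : ContDiff ℝ (⊤ : ℕ∞) fun x : ℝ => (s * Real.exp x) ^ (1 / 2 - α) :=
    (contDiff_const.mul Real.contDiff_exp).rpow_const_of_ne fun x =>
      (mul_pos hs (Real.exp_pos x)).ne'
  have h2 : ContDiff ℝ (⊤ : ℕ∞) fun x : ℝ => ((Real.exp x : ℝ) : ℂ) :=
    Complex.ofRealCLM.contDiff.comp Real.contDiff_exp
  exact (Complex.ofRealCLM.contDiff.comp h1).mul
    (((contDiff_const.mul h2).cexp.sub contDiff_const).pow m)

end Core

/-! ### The Mellin transform of `(e^{εis} - 1)^m` -/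

section WaveMellin

theorem integrableOn_rpow_mul_exp {σ b : ℝ} (hσ : -1 < σ) (hb : 0 < b) :
    IntegrableOn (fun t : ℝ => t ^ σ * Real.exp (-b * t)) (Set.Ioi 0) := by
  have := integrableOn_rpow_mul_exp_neg_mul_rpow hσ one_pos hb
  simpa using this

theorem norm_cpow_mul_exp {z r : ℂ} {t : ℝ} (ht : 0 < t) :
    ‖(t : ℂ) ^ (z - 1) * Complex.exp (-(r * t))‖ = t ^ (z.re - 1) * Real.exp (-r.re * t) := by
  rw [norm_mul, Complex.norm_cpow_eq_rpow_re_of_pos ht, Complex.norm_exp]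
  simp

theorem measurable_cpow_mul_exp (z r : ℂ) :
    AEStronglyMeasurable (fun t : ℝ => (t : ℂ) ^ (z - 1) * Complex.exp (-(r * t)))
      (volume.restrict (Set.Ioi 0)) := by
  refine ContinuousOn.aestronglyMeasurable (fun t ht => ?_) measurableSet_Ioi
  have h1 : ContinuousAt (fun t : ℝ => (t : ℂ) ^ (z - 1)) t :=
    Complex.continuousAt_ofReal_cpow_const t _ (Or.inr (ne_of_gt ht))
  exact (h1.mul (by fun_prop)).continuousWithinAt

theorem integrable_cpow_mul_exp {z r : ℂ} (hz : 0 < z.re) (hr : 0 < r.re) :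
    IntegrableOn (fun t : ℝ => (t : ℂ) ^ (z - 1) * Complex.exp (-(r * t))) (Set.Ioi 0) := by
  refine Integrable.mono' (integrableOn_rpow_mul_exp (σ := z.re - 1) (by linarith) hr)
    (measurable_cpow_mul_exp z r) ?_
  filter_upwards [ae_restrict_mem measurableSet_Ioi] with t ht
  exact (norm_cpow_mul_exp ht).le

/-- Euler's integral `∫ t^{z-1} e^{-rt} dt = Γ(z) r^{-z}` for complex `r`, by analytic continuation
in `r`. -/
theorem integral_cpow_mul_exp {z r : ℂ} (hz : 0 < z.re) (hr : 0 < r.re) :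
    ∫ t in Set.Ioi (0 : ℝ), (t : ℂ) ^ (z - 1) * Complex.exp (-(r * t)) =
      Complex.Gamma z * r ^ (-z) := by
  set U : Set ℂ := {r | 0 < r.re} with hU
  have hUo : IsOpen U := isOpen_lt continuous_const Complex.continuous_re
  have hUc : IsPreconnected U := (convex_halfSpace_re_gt 0).isPreconnected
  have hd1 : DifferentiableOn ℂ
      (fun r : ℂ => ∫ t in Set.Ioi (0 : ℝ), (t : ℂ) ^ (z - 1) * Complex.exp (-(r * t))) U := by
    intro w hw
    have hw' : 0 < w.re := hw
    have h := hasDerivAt_integral_of_dominated_loc_of_deriv_le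
      (μ := volume.restrict (Set.Ioi (0 : ℝ))) (x₀ := w)
      (F := fun (r : ℂ) (t : ℝ) => (t : ℂ) ^ (z - 1) * Complex.exp (-(r * t)))
      (F' := fun (r : ℂ) (t : ℝ) => (t : ℂ) ^ (z - 1) * (Complex.exp (-(r * t)) * -t))
      (s := {r : ℂ | w.re / 2 < r.re})
      (bound := fun t => t ^ z.re * Real.exp (-(w.re / 2) * t))
      ((isOpen_lt continuous_const Complex.continuous_re).mem_nhds (by simp; linarith))
      (Eventually.of_forall fun r => measurable_cpow_mul_exp z r)
      (integrable_cpow_mul_exp hz hw')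
      ?_ ?_ (integrableOn_rpow_mul_exp (by linarith) (by linarith)) ?_
    · exact h.2.differentiableAt.differentiableWithinAt
    · have := (measurable_cpow_mul_exp z w).mul
        (Complex.continuous_ofReal.neg.aestronglyMeasurable (μ := volume.restrict (Set.Ioi 0)))
      refine this.congr (ae_of_all _ fun t => ?_)
      simp only [Pi.mul_apply, Pi.neg_apply, mul_assoc]
    · filter_upwards [ae_restrict_mem measurableSet_Ioi] with t ht r hr
      have ht' : (0 : ℝ) < t := ht
      have hr' : w.re / 2 < r.re := hr
      rw [← mul_assoc, norm_mul, norm_cpow_mul_exp ht', norm_neg, Complex.norm_real,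
        Real.norm_of_nonneg ht'.le, mul_right_comm]
      have : t ^ (z.re - 1) * t = t ^ z.re := by
        rw [Real.rpow_sub_one ht'.ne', div_mul_cancel₀ _ ht'.ne']
      rw [this]
      gcongr
    · refine ae_of_all _ fun t r _ => HasDerivAt.const_mul _ ?_
      have : HasDerivAt (fun r : ℂ => -(r * t)) (-t) r :=
        ((hasDerivAt_id r).mul_const (t : ℂ)).neg.congr_deriv (by rw [one_mul])
      exact this.cexp
  have hd2 : DifferentiableOn ℂ (fun r : ℂ => Complex.Gamma z * r ^ (-z)) U := fun w hw =>
    ((differentiableAt_id.cpow_const (Or.inl hw)).const_mul _).differentiableWithinAt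
  refine (hd1.analyticOnNhd hUo).eqOn_of_preconnected_of_frequently_eq (hd2.analyticOnNhd hUo) hUc
    (z₀ := 1) (by simp [hU]) ?_ hr
  have h3 : Tendsto ((↑) : ℝ → ℂ) (𝓝[≠] 1) (𝓝[≠] 1) := by
    rw [tendsto_nhdsWithin_iff]
    refine ⟨tendsto_nhdsWithin_of_tendsto_nhds (Complex.continuous_ofReal.tendsto' 1 1 (by simp)),
      ?_⟩
    filter_upwards [self_mem_nhdsWithin] with t ht
    exact fun h => ht (by simpa using h)
  refine h3.frequently (Eventually.frequently ?_)
  have h4 : ∀ᶠ t : ℝ in 𝓝[≠] 1, 0 < t := nhdsWithin_le_nhds (lt_mem_nhds zero_lt_one)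
  filter_upwards [h4] with t ht
  rw [Complex.integral_cpow_mul_exp_neg_mul_Ioi hz ht, mul_comm, one_div,
    Complex.inv_cpow _ _ (by rw [Complex.arg_ofReal_of_nonneg ht.le]; exact Real.pi_pos.ne),
    Complex.cpow_neg]

theorem norm_exp_sub_one_le {ε : ℝ} (hε : ε = 1 ∨ ε = -1) (s : ℝ) :
    ‖Complex.exp (ε * Complex.I * s) - 1‖ ≤ |s| := by
  have h := Real.norm_exp_I_mul_ofReal_sub_one_le (x := ε * s)
  rw [show ((ε : ℂ) * Complex.I * s) = Complex.I * ((ε * s : ℝ) : ℂ) by push_cast; ring]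
  refine h.trans (le_of_eq ?_)
  rcases hε with rfl | rfl <;> simp

theorem norm_exp_sub_one_le_two (ε s : ℝ) : ‖Complex.exp (ε * Complex.I * s) - 1‖ ≤ 2 := by
  refine (norm_sub_le _ _).trans ?_
  rw [show ((ε : ℂ) * Complex.I * s) = ((ε * s : ℝ) : ℂ) * Complex.I by push_cast; ring,
    Complex.norm_exp_ofReal_mul_I, norm_one]
  norm_num

theorem isBigO_exp_sub_one {ε : ℝ} (hε : ε = 1 ∨ ε = -1) (m : ℕ) :
    (fun s : ℝ => (Complex.exp (ε * Complex.I * s) - 1) ^ m)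
      =O[𝓝[>] 0] (fun s : ℝ => s ^ (-(-(m : ℝ)))) := by
  refine Asymptotics.IsBigO.of_bound 1 ?_
  filter_upwards [self_mem_nhdsWithin] with s hs
  have hs' : (0 : ℝ) < s := hs
  rw [neg_neg, Real.rpow_natCast, norm_pow, norm_pow, one_mul]
  gcongr
  exact norm_exp_sub_one_le hε s

/-- The Mellin transform of `e^{-δs} (e^{εis} - 1)^m` in its half plane of convergence: Euler's
integral for `Re z > 0`, and analytic continuation to `Re z > -m`. -/
theorem mellin_damped {ε : ℝ} (hε : ε = 1 ∨ ε = -1) (m : ℕ) {δ : ℝ} (hδ : 0 < δ) {z : ℂ}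
    (hz : -(m : ℝ) < z.re) (hz0 : ∀ k : ℕ, z ≠ -k) :
    mellin (fun s => Complex.exp (-(δ * s)) * (Complex.exp (ε * Complex.I * s) - 1) ^ m) z =
      Complex.Gamma z * ∑ k ∈ Finset.range (m + 1),
        (m.choose k : ℂ) * (-1) ^ (m - k) * (δ - k * (ε * Complex.I)) ^ (-z) := by
  set g : ℝ → ℂ := fun s => Complex.exp (-(δ * s)) * (Complex.exp (ε * Complex.I * s) - 1) ^ m
    with hg
  set U : Set ℂ := {w | -(m : ℝ) < w.re} with hU
  have hUo : IsOpen U := isOpen_lt continuous_const Complex.continuous_re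
  have hUc : IsPreconnected U := (convex_halfSpace_re_gt _).isPreconnected
  have hgc : Continuous g := by fun_prop
  have hnorm : ∀ s : ℝ, ‖Complex.exp (-((δ : ℂ) * s))‖ = Real.exp (-δ * s) := fun s => by
    rw [Complex.norm_exp]; simp
  have hd1 : DifferentiableOn ℂ (fun w => mellin g w * (Complex.Gamma w)⁻¹) U := by
    intro w hw
    refine DifferentiableAt.differentiableWithinAt (DifferentiableAt.mul ?_
      (Complex.differentiable_one_div_Gamma w))
    refine mellin_differentiableAt_of_isBigO_rpow_exp hδ (b := -(m : ℝ))
      (hgc.locallyIntegrable.locallyIntegrableOn _) ?_ ?_ hw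
    · refine Asymptotics.IsBigO.of_bound (2 ^ m) (Eventually.of_forall fun s => ?_)
      rw [hg, norm_mul, hnorm, norm_pow, Real.norm_of_nonneg (Real.exp_pos _).le, mul_comm]
      gcongr
      exact norm_exp_sub_one_le_two ε s
    · have h1 : (fun s : ℝ => Complex.exp (-((δ : ℂ) * s))) =O[𝓝[>] 0] fun _ => (1 : ℝ) := by
        refine Asymptotics.IsBigO.of_bound 1 ?_
        filter_upwards [self_mem_nhdsWithin] with s hs
        have hs' : (0 : ℝ) < s := hs
        rw [hnorm, norm_one, one_mul, Real.exp_le_one_iff]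
        nlinarith
      simpa using h1.mul (isBigO_exp_sub_one hε m)
  have hne : ∀ k : ℕ, (δ - k * (ε * Complex.I) : ℂ) ≠ 0 := fun k h => by
    have := congrArg Complex.re h
    simp at this
    exact hδ.ne' this
  have hd2 : DifferentiableOn ℂ (fun w => ∑ k ∈ Finset.range (m + 1),
      (m.choose k : ℂ) * (-1) ^ (m - k) * (δ - k * (ε * Complex.I)) ^ (-w)) U := by
    refine DifferentiableOn.fun_sum fun k _ => ?_
    exact ((differentiable_id.neg.const_cpow (Or.inl (hne k))).const_mul _).differentiableOn
  have key := (hd1.analyticOnNhd hUo).eqOn_of_preconnected_of_eventuallyEq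
    (hd2.analyticOnNhd hUo) hUc (z₀ := 1)
    (by simp only [hU, Set.mem_ofPred_eq, Complex.one_re]
        have : (0 : ℝ) ≤ m := m.cast_nonneg
        linarith) ?_ hz
  · have hG : Complex.Gamma z ≠ 0 := Complex.Gamma_ne_zero hz0
    simp only at key
    rw [← key, mul_comm (mellin g z), mul_inv_cancel_left₀ hG]
  · have h1 : ∀ᶠ w : ℂ in 𝓝 1, 0 < w.re :=
      (isOpen_lt continuous_const Complex.continuous_re).mem_nhds (by simp)
    filter_upwards [h1] with w hw
    have hG : Complex.Gamma w ≠ 0 := Complex.Gamma_ne_zero_of_re_pos hw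
    have hre : ∀ k : ℕ, 0 < (δ - k * (ε * Complex.I) : ℂ).re := fun k => by simpa using hδ
    rw [mul_inv_eq_iff_eq_mul₀ hG, mul_comm, Finset.mul_sum, mellin]
    have h2 : ∀ k : ℕ, Complex.Gamma w *
        ((m.choose k : ℂ) * (-1) ^ (m - k) * (δ - k * (ε * Complex.I)) ^ (-w)) =
        ∫ t in Set.Ioi (0 : ℝ), (m.choose k : ℂ) * (-1) ^ (m - k) *
          ((t : ℂ) ^ (w - 1) * Complex.exp (-((δ - k * (ε * Complex.I)) * t))) := fun k => by
      rw [integral_const_mul, integral_cpow_mul_exp hw (hre k)]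
      ring
    simp only [h2]
    rw [← integral_finsetSum _ fun k _ => (integrable_cpow_mul_exp hw (hre k)).const_mul _]
    refine integral_congr_ae (ae_of_all _ fun t => ?_)
    simp only [hg, smul_eq_mul, sub_eq_add_neg _ (1 : ℂ), add_pow, Finset.mul_sum]
    refine Finset.sum_congr rfl fun k _ => ?_
    rw [← Complex.exp_nat_mul, show -((δ - k * (ε * Complex.I)) * t) =
      -(δ * t) + k * ((ε : ℂ) * Complex.I * t) by ring, Complex.exp_add]
    ring

theorem mellinConvergent_wave {ε : ℝ} (hε : ε = 1 ∨ ε = -1) (m : ℕ) {z : ℂ}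
    (hz : -(m : ℝ) < z.re) (hz' : z.re < 0) :
    MellinConvergent (fun s : ℝ => (Complex.exp (ε * Complex.I * s) - 1) ^ m) z := by
  refine mellinConvergent_of_isBigO_rpow (a := 0) (b := -(m : ℝ)) ?_ ?_ hz'
    (isBigO_exp_sub_one hε m) hz
  · exact (show Continuous _ by fun_prop).locallyIntegrable.locallyIntegrableOn _
  · refine Asymptotics.IsBigO.of_bound (2 ^ m) (Eventually.of_forall fun s => ?_)
    rw [norm_pow, neg_zero, Real.rpow_zero, norm_one, mul_one]
    gcongr
    exact norm_exp_sub_one_le_two ε s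

/-- With the principal branch, `(∓ik)^{-z} = k^{-z} e^{±iπz/2}`. -/
theorem cpow_neg_mul_I {ε : ℝ} (hε : ε = 1 ∨ ε = -1) {k : ℕ} (hk : k ≠ 0) (z : ℂ) :
    ((0 : ℂ) - k * (ε * Complex.I)) ^ (-z) =
      (k : ℂ) ^ (-z) * Complex.exp (ε * Complex.I * (Real.pi / 2) * z) := by
  have hk' : (k : ℂ) ≠ 0 := Nat.cast_ne_zero.2 hk
  have hk0 : (0 : ℝ) < k := by positivity
  have hlog : Complex.log (-(ε * Complex.I)) = -(ε * Complex.I * (Real.pi / 2)) := by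
    rcases hε with rfl | rfl
    · simp [Complex.log_neg_I, mul_comm]
    · simp [Complex.log_I, mul_comm]
  have hne : -(ε * Complex.I) ≠ 0 := by
    rcases hε with rfl | rfl <;> simp
  rw [show (0 : ℂ) - k * (ε * Complex.I) = ((k : ℝ) : ℂ) * -(ε * Complex.I) by push_cast; ring,
    Complex.cpow_def_of_ne_zero (mul_ne_zero (by exact_mod_cast hk') hne),
    Complex.log_ofReal_mul hk0 hne, hlog, Complex.cpow_def_of_ne_zero hk', ← Complex.exp_add,
    Complex.ofReal_log hk0.le]
  congr 1
  push_cast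
  ring

/-- The Mellin transform of `(e^{εis} - 1)^m` on the strip `-m < Re z < 0`, as the limit `δ → 0` of
the damped integrals. -/
theorem mellin_wave {ε : ℝ} (hε : ε = 1 ∨ ε = -1) (m : ℕ) {z : ℂ}
    (hz : -(m : ℝ) < z.re) (hz' : z.re < 0) (hz0 : ∀ k : ℕ, z ≠ -k) :
    mellin (fun s : ℝ => (Complex.exp (ε * Complex.I * s) - 1) ^ m) z =
      Complex.Gamma z * (fSum m z * Complex.exp (ε * Complex.I * (Real.pi / 2) * z)) := by
  have hzne : z ≠ 0 := by simpa using hz0 0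
  have hδ : Tendsto (fun δ : ℝ => δ) (𝓝[>] 0) (𝓝 0) := tendsto_nhdsWithin_of_tendsto_nhds tendsto_id
  have h1 : Tendsto (fun δ : ℝ => mellin (fun s => Complex.exp (-(δ * s)) *
      (Complex.exp (ε * Complex.I * s) - 1) ^ m) z) (𝓝[>] 0)
      (𝓝 (mellin (fun s : ℝ => (Complex.exp (ε * Complex.I * s) - 1) ^ m) z)) := by
    have hconv := mellinConvergent_wave hε m hz hz'
    refine tendsto_integral_filter_of_dominated_convergence _ (Eventually.of_forall fun δ => ?_) ?_
      hconv.norm ?_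
    · have := (show Continuous fun s : ℝ => Complex.exp (-((δ : ℂ) * s)) by fun_prop
        ).aestronglyMeasurable (μ := volume.restrict (Set.Ioi 0)) |>.mul hconv.aestronglyMeasurable
      refine this.congr (ae_of_all _ fun s => ?_)
      simp only [Pi.mul_apply, smul_eq_mul]
      ring
    · filter_upwards [self_mem_nhdsWithin] with δ hδ0
      filter_upwards [ae_restrict_mem measurableSet_Ioi] with s hs
      have hδ' : (0 : ℝ) < δ := hδ0
      have hs' : (0 : ℝ) < s := hs
      rw [smul_eq_mul, mul_left_comm, norm_mul, smul_eq_mul, Complex.norm_exp]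
      refine mul_le_of_le_one_left (norm_nonneg _) ?_
      rw [Real.exp_le_one_iff]
      simp only [Complex.neg_re, Complex.mul_re, Complex.ofReal_re, Complex.ofReal_im, mul_zero,
        sub_zero]
      nlinarith
    · refine ae_of_all _ fun s => ?_
      refine Tendsto.const_smul ?_ _
      have : Tendsto (fun δ : ℝ => Complex.exp (-((δ : ℂ) * s))) (𝓝[>] 0) (𝓝 1) := by
        refine tendsto_nhdsWithin_of_tendsto_nhds ?_
        exact (show Continuous fun δ : ℝ => Complex.exp (-((δ : ℂ) * s)) by fun_prop).tendsto'
          0 1 (by simp)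
      simpa using this.mul_const ((Complex.exp (ε * Complex.I * s) - 1) ^ m)
  have h2 : Tendsto (fun δ : ℝ => Complex.Gamma z * ∑ k ∈ Finset.range (m + 1),
      (m.choose k : ℂ) * (-1) ^ (m - k) * (δ - k * (ε * Complex.I)) ^ (-z)) (𝓝[>] 0)
      (𝓝 (Complex.Gamma z * ∑ k ∈ Finset.range (m + 1),
        (m.choose k : ℂ) * (-1) ^ (m - k) * ((0 : ℂ) - k * (ε * Complex.I)) ^ (-z))) := by
    refine Tendsto.const_mul _ (tendsto_finsetSum _ fun k _ => Tendsto.const_mul _ ?_)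
    refine tendsto_nhdsWithin_of_tendsto_nhds ?_
    by_cases hk : k = 0
    · subst hk
      have hc : ContinuousAt (fun w : ℝ => (w : ℂ) ^ (-z)) 0 :=
        Complex.continuousAt_ofReal_cpow_const 0 _ (Or.inl (by simpa using hz'))
      simpa using hc.tendsto
    · have hc : ContinuousAt (fun δ : ℝ => ((δ : ℂ) - k * (ε * Complex.I)) ^ (-z)) 0 := by
        refine ContinuousAt.cpow (by fun_prop) continuousAt_const ?_
        rw [Complex.mem_slitPlane_iff]
        right
        rcases hε with rfl | rfl <;> simp [hk]
      simpa using hc.tendsto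
  have h3 : ∀ᶠ δ : ℝ in 𝓝[>] 0, mellin (fun s => Complex.exp (-(δ * s)) *
      (Complex.exp (ε * Complex.I * s) - 1) ^ m) z = Complex.Gamma z *
      ∑ k ∈ Finset.range (m + 1),
        (m.choose k : ℂ) * (-1) ^ (m - k) * (δ - k * (ε * Complex.I)) ^ (-z) := by
    filter_upwards [self_mem_nhdsWithin] with δ hδ0
    exact mellin_damped hε m hδ0 hz hz0
  rw [tendsto_nhds_unique (h1.congr' h3) h2, fSum, Finset.sum_mul]
  congr 1
  rw [Finset.range_eq_Ico, Finset.sum_eq_sum_Ico_succ_bot (Nat.succ_pos m),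
    show Finset.Ico (0 + 1) (m + 1) = Finset.Icc 1 m by ext; simp]
  simp only [Nat.cast_zero, zero_mul, sub_zero, Complex.zero_cpow (neg_ne_zero.2 hzne), mul_zero,
    zero_add]
  refine Finset.sum_congr rfl fun k hk => ?_
  have hk1 : k ≠ 0 := by
    have := (Finset.mem_Icc.1 hk).1
    omega
  rw [cpow_neg_mul_I hε hk1 z]
  ring

/-- The function `h` is the Mellin transform of `s^{1/2-α} (e^{εis} - 1)^m`. -/
theorem mellin_wave_eq_hFun {ε α : ℝ} (hε : ε = 1 ∨ ε = -1) {m : ℕ} (hα : 1 / 2 < α)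
    (hm : α - 1 / 2 < m) {t : ℝ} (ht : ∀ k : ℕ, (1 / 2 - α + Complex.I * t : ℂ) ≠ -k) :
    mellin (fun s : ℝ => (Complex.exp (ε * Complex.I * s) - 1) ^ m)
      (1 / 2 - α + Complex.I * t) = hFun ε α m t := by
  have hre : (1 / 2 - α + Complex.I * t : ℂ).re = 1 / 2 - α := by simp
  rw [mellin_wave hε m (by rw [hre]; linarith) (by rw [hre]; linarith) ht, hFun]
  have : Complex.exp (ε * Complex.I * (Real.pi / 2) * (1 / 2 - α + Complex.I * t)) =
      Complex.exp (ε * Complex.I * (Real.pi / 2) * (1 / 2 - α)) *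
        Complex.exp (-(ε * (Real.pi / 2) * t)) := by
    rw [← Complex.exp_add]
    congr 1
    linear_combination (ε * (Real.pi / 2) * t : ℂ) * Complex.I_mul_I
  rw [this]
  ring

end WaveMellin

/-! ### Decay of the Gamma function on vertical lines -/

section GammaDecay

/-- On the critical line the decay is explicit, by the reflection formula. -/
theorem norm_Gamma_half_le {z : ℂ} (hz : z.re = 1 / 2) :
    ‖Complex.Gamma z‖ ≤ Real.sqrt (2 * Real.pi) * Real.exp (-(Real.pi / 2) * |z.im|) := by
  have h1 : (starRingEnd ℂ) z = 1 - z := by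
    apply Complex.ext <;> simp [hz]
    norm_num
  have h2 := Complex.Gamma_mul_Gamma_one_sub z
  rw [← h1, Complex.Gamma_conj, Complex.mul_conj] at h2
  have h3 : Complex.sin (Real.pi * z) = (Real.cosh (Real.pi * z.im) : ℂ) := by
    have : (Real.pi * z : ℂ) = Real.pi / 2 - -(((Real.pi * z.im : ℝ) : ℂ) * Complex.I) := by
      conv_lhs => rw [← Complex.re_add_im z, hz]
      push_cast
      ring
    rw [this, Complex.sin_pi_div_two_sub, Complex.cos_neg, Complex.cos_mul_I, Complex.ofReal_cosh]
  rw [h3, ← Complex.ofReal_div, Complex.ofReal_inj, Complex.normSq_eq_norm_sq] at h2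
  have h4 : Real.exp (Real.pi * |z.im|) / 2 ≤ Real.cosh (Real.pi * z.im) := by
    rw [← Real.cosh_abs, abs_mul, abs_of_pos Real.pi_pos, Real.cosh_eq]
    have := Real.exp_pos (-(Real.pi * |z.im|))
    linarith
  refine (sq_le_sq₀ (norm_nonneg _) (by positivity)).1 ?_
  rw [h2, mul_pow, Real.sq_sqrt (by positivity), ← Real.exp_nat_mul]
  calc Real.pi / Real.cosh (Real.pi * z.im) ≤ Real.pi / (Real.exp (Real.pi * |z.im|) / 2) := by
        gcongr
    _ = 2 * Real.pi * Real.exp (-(Real.pi * |z.im|)) := by rw [Real.exp_neg]; field_simp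
    _ = _ := by congr 2; push_cast; ring

theorem norm_Gamma_le_Gamma_re {z : ℂ} (hz : 0 < z.re) : ‖Complex.Gamma z‖ ≤ Real.Gamma z.re := by
  rw [Complex.Gamma_eq_integral hz, Real.Gamma_eq_integral hz, Complex.GammaIntegral]
  refine (norm_integral_le_integral_norm _).trans (le_of_eq ?_)
  refine setIntegral_congr_fun measurableSet_Ioi fun t ht => ?_
  rw [norm_mul, Complex.norm_cpow_eq_rpow_re_of_pos ht, Complex.norm_real,
    Real.norm_of_nonneg (Real.exp_pos _).le, Complex.sub_re, Complex.one_re]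

/-- In the strip `1/2 ≤ Re z ≤ 3/2` the Phragmén–Lindelöf principle interpolates between the two
boundary lines. It is applied to the function `Γ(z) e^{-iπz/2} t^{1/2-z} / (z + 1 - it)`, whose
denominator allows a bound at the height `t` only. -/
theorem norm_Gamma_strip_le {σ t : ℝ} (hσ : 1 / 2 ≤ σ) (hσ' : σ ≤ 3 / 2) (ht : 1 ≤ t) :
    ‖Complex.Gamma (σ + t * Complex.I)‖ ≤
      2 * Real.sqrt (2 * Real.pi) * (σ + 1) *
        (t ^ (σ - 1 / 2) * Real.exp (-(Real.pi / 2) * t)) := by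
  have ht0 : 0 < t := by linarith
  set C := 2 * Real.sqrt (2 * Real.pi) with hC
  have hC0 : 0 < Real.sqrt (2 * Real.pi) := by positivity
  set F : ℂ → ℂ := fun z => Complex.Gamma z * Complex.exp (-(Complex.I * (Real.pi / 2) * z)) *
    (t : ℂ) ^ (-(z - 1 / 2)) / (z + 1 - t * Complex.I) with hF
  have hden : ∀ z : ℂ, (z + 1 - t * Complex.I).re = z.re + 1 := fun z => by simp
  have hden' : ∀ z : ℂ, (z + 1 - t * Complex.I).im = z.im - t := fun z => by simp
  have hne : ∀ z : ℂ, 0 < z.re → z + 1 - t * Complex.I ≠ 0 := fun z hz h => by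
    have := congrArg Complex.re h
    rw [hden, Complex.zero_re] at this
    linarith
  have hnorm : ∀ z : ℂ, ‖F z‖ = ‖Complex.Gamma z‖ * Real.exp (Real.pi / 2 * z.im) *
      t ^ (-(z.re - 1 / 2)) / ‖z + 1 - t * Complex.I‖ := fun z => by
    rw [hF, norm_div, norm_mul, norm_mul, Complex.norm_exp,
      Complex.norm_cpow_eq_rpow_re_of_pos ht0]
    congr 4
    · simp
    · simp
  have hden1 : ∀ z : ℂ, 0 < z.re → 1 ≤ ‖z + 1 - t * Complex.I‖ := fun z hz => by
    have := Complex.re_le_norm (z + 1 - t * Complex.I)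
    rw [hden] at this
    linarith
  have hexp : ∀ y : ℝ, Real.exp (-(Real.pi / 2) * |y|) * Real.exp (Real.pi / 2 * y) ≤ 1 := by
    intro y
    rw [← Real.exp_add, Real.exp_le_one_iff]
    nlinarith [le_abs_self y, Real.pi_pos]
  have hdiff : ∀ z : ℂ, 0 < z.re → DifferentiableAt ℂ F z := by
    intro z hz
    have h1 : DifferentiableAt ℂ Complex.Gamma z := Complex.differentiableAt_Gamma z fun k h => by
      rw [h] at hz
      simp at hz
      have : (0 : ℝ) ≤ k := k.cast_nonneg
      linarith
    have h2 : DifferentiableAt ℂ (fun z : ℂ => (t : ℂ) ^ (-(z - 1 / 2))) z :=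
      DifferentiableAt.const_cpow (by fun_prop) (Or.inl (by exact_mod_cast ht0.ne'))
    exact ((h1.mul (by fun_prop)).mul h2).div (by fun_prop) (hne z hz)
  have key : ‖F (σ + t * Complex.I)‖ ≤ C := by
    refine PhragmenLindelof.vertical_strip (a := 1 / 2) (b := 3 / 2) ?_ ?_ ?_ ?_ ?_ ?_
    · refine DifferentiableOn.diffContOnCl fun z hz => (hdiff z ?_).differentiableWithinAt
      have h1 : z ∈ Complex.re ⁻¹' Set.Icc (1 / 2 : ℝ) (3 / 2) :=
        closure_minimal (Set.preimage_mono Set.Ioo_subset_Icc_self)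
          (isClosed_Icc.preimage Complex.continuous_re) hz
      have := h1.1
      linarith
    · obtain ⟨B, hB⟩ := (isCompact_Icc (a := (1 / 2 : ℝ)) (b := 3 / 2)).exists_bound_of_continuousOn
        (f := Real.Gamma) fun s hs => (Real.differentiableAt_Gamma fun k h => by
          have h1 := hs.1
          rw [h] at h1
          have : (0 : ℝ) ≤ k := k.cast_nonneg
          linarith).continuousAt.continuousWithinAt
      refine ⟨1, by norm_num; linarith [Real.pi_gt_three], Real.pi / 2, ?_⟩
      refine Asymptotics.IsBigO.of_bound B ?_
      refine Filter.eventually_inf_principal.2 (Eventually.of_forall fun z hz => ?_)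
      have hz1 : 1 / 2 < z.re := hz.1
      have hz2 : z.re < 3 / 2 := hz.2
      have hzpos : 0 < z.re := by linarith
      have hG : ‖Complex.Gamma z‖ ≤ B := (norm_Gamma_le_Gamma_re hzpos).trans
        ((le_abs_self _).trans (hB _ ⟨hz1.le, hz2.le⟩))
      have hB0 : 0 ≤ B := (norm_nonneg _).trans hG
      rw [hnorm, Real.norm_of_nonneg (Real.exp_pos _).le, one_mul]
      calc ‖Complex.Gamma z‖ * Real.exp (Real.pi / 2 * z.im) * t ^ (-(z.re - 1 / 2)) /
            ‖z + 1 - t * Complex.I‖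
          ≤ B * Real.exp (Real.pi / 2 * Real.exp |z.im|) * 1 / 1 := by
            gcongr
            · exact (le_abs_self z.im).trans ((by linarith : |z.im| ≤ |z.im| + 1).trans
                (Real.add_one_le_exp _))
            · exact Real.rpow_le_one_of_one_le_of_nonpos ht (by linarith)
            · exact hden1 z hzpos
        _ = _ := by ring
    · intro z hz
      rw [hnorm, hz]
      have h1 := norm_Gamma_half_le hz
      have h2 := hden1 z (by rw [hz]; norm_num)
      calc ‖Complex.Gamma z‖ * Real.exp (Real.pi / 2 * z.im) * t ^ (-((1 : ℝ) / 2 - 1 / 2)) /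
            ‖z + 1 - t * Complex.I‖
          ≤ Real.sqrt (2 * Real.pi) * Real.exp (-(Real.pi / 2) * |z.im|) *
            Real.exp (Real.pi / 2 * z.im) * 1 / 1 := by
            gcongr
            simp
        _ = Real.sqrt (2 * Real.pi) * (Real.exp (-(Real.pi / 2) * |z.im|) *
            Real.exp (Real.pi / 2 * z.im)) := by ring
        _ ≤ Real.sqrt (2 * Real.pi) * 1 := by gcongr; exact hexp _
        _ ≤ C := by rw [hC]; linarith
    · intro z hz
      have hz1 : z - 1 ≠ 0 := fun h => by
        have := congrArg Complex.re h
        simp [hz] at this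
        norm_num at this
      have hG : Complex.Gamma z = (z - 1) * Complex.Gamma (z - 1) := by
        rw [← Complex.Gamma_add_one _ hz1, sub_add_cancel]
      have h1 := norm_Gamma_half_le (z := z - 1) (by simp [hz]; norm_num)
      rw [Complex.sub_im, Complex.one_im, sub_zero] at h1
      have h2 : ‖z - 1‖ ≤ 1 / 2 + |z.im| := by
        refine (Complex.norm_le_abs_re_add_abs_im _).trans (le_of_eq ?_)
        simp [hz]
        norm_num
      have h3 : 5 / 2 ≤ ‖z + 1 - t * Complex.I‖ := by
        have := Complex.re_le_norm (z + 1 - t * Complex.I)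
        rw [hden, hz] at this
        linarith
      have h4 : |z.im - t| ≤ ‖z + 1 - t * Complex.I‖ := by
        rw [← hden']
        exact Complex.abs_im_le_norm _
      have h5 : 1 / 2 + |z.im| ≤ 2 * t * ‖z + 1 - t * Complex.I‖ := by
        have h6 : |z.im| ≤ |z.im - t| + t := by
          have := abs_add_le (z.im - t) t
          rwa [sub_add_cancel, abs_of_pos ht0] at this
        nlinarith
      rw [hnorm, hz, hG, norm_mul, show -((3 : ℝ) / 2 - 1 / 2) = -1 by norm_num, Real.rpow_neg_one,
        div_le_iff₀ (by linarith)]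
      calc ‖z - 1‖ * ‖Complex.Gamma (z - 1)‖ * Real.exp (Real.pi / 2 * z.im) * t⁻¹
          ≤ (2 * t * ‖z + 1 - t * Complex.I‖) *
            (Real.sqrt (2 * Real.pi) * Real.exp (-(Real.pi / 2) * |z.im|)) *
            Real.exp (Real.pi / 2 * z.im) * t⁻¹ := by
            gcongr
            exact h2.trans h5
        _ = C * ‖z + 1 - t * Complex.I‖ * (Real.exp (-(Real.pi / 2) * |z.im|) *
            Real.exp (Real.pi / 2 * z.im)) := by rw [hC]; field_simp
        _ ≤ C * ‖z + 1 - t * Complex.I‖ * 1 := by gcongr; exact hexp _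
        _ = _ := mul_one _
    · simpa using hσ
    · simpa using hσ'
  have hden2 : ‖(σ + t * Complex.I) + 1 - t * Complex.I‖ = σ + 1 := by
    rw [show ((σ : ℂ) + t * Complex.I) + 1 - t * Complex.I = ((σ + 1 : ℝ) : ℂ) by push_cast; ring,
      Complex.norm_real, Real.norm_of_nonneg (by linarith)]
  rw [hnorm, hden2] at key
  simp only [Complex.add_re, Complex.ofReal_re, Complex.mul_re, Complex.I_re, mul_zero,
    Complex.ofReal_im, Complex.I_im, mul_one, sub_self, add_zero, Complex.add_im, Complex.mul_im,
    zero_add] at key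
  rw [div_le_iff₀ (by linarith), Real.rpow_neg ht0.le] at key
  have hp : 0 < t ^ (σ - 1 / 2) := Real.rpow_pos_of_pos ht0 _
  have he : 0 < Real.exp (Real.pi / 2 * t) := Real.exp_pos _
  rw [neg_mul, Real.exp_neg]
  rw [← div_eq_mul_inv, div_le_iff₀ hp, ← le_div_iff₀ he] at key
  refine key.trans (le_of_eq ?_)
  field_simp

theorem norm_Gamma_conj (σ t : ℝ) :
    ‖Complex.Gamma (σ + t * Complex.I)‖ = ‖Complex.Gamma (σ + |t| * Complex.I)‖ := by
  rcases abs_cases t with ⟨h, -⟩ | ⟨h, -⟩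
  · rw [h]
  · rw [h, ← Complex.norm_conj, ← Complex.Gamma_conj]
    congr 2
    simp

/-- Stirling's bound on vertical lines to the left of `3/2`, from the strip by the functional
equation. -/
theorem exists_norm_Gamma_le (n : ℕ) : ∀ σ : ℝ, 1 / 2 - n ≤ σ → σ ≤ 3 / 2 →
    ∃ C : ℝ, 0 ≤ C ∧ ∀ t : ℝ, 1 ≤ |t| → ‖Complex.Gamma (σ + t * Complex.I)‖ ≤
      C * (|t| ^ (σ - 1 / 2) * Real.exp (-(Real.pi / 2) * |t|)) := by
  have base : ∀ σ : ℝ, 1 / 2 ≤ σ → σ ≤ 3 / 2 →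
      ∃ C : ℝ, 0 ≤ C ∧ ∀ t : ℝ, 1 ≤ |t| → ‖Complex.Gamma (σ + t * Complex.I)‖ ≤
        C * (|t| ^ (σ - 1 / 2) * Real.exp (-(Real.pi / 2) * |t|)) := fun σ h1 h2 =>
    ⟨2 * Real.sqrt (2 * Real.pi) * (σ + 1), by positivity, fun t ht => by
      rw [norm_Gamma_conj]
      exact norm_Gamma_strip_le h1 h2 ht⟩
  induction n with
  | zero => exact fun σ h1 h2 => base σ (by simpa using h1) h2
  | succ n ih =>
    intro σ h1 h2
    by_cases h : 1 / 2 ≤ σ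
    · exact base σ h h2
    · push Not at h
      obtain ⟨C, hC0, hC⟩ := ih (σ + 1) (by push_cast at h1; linarith) (by linarith)
      refine ⟨C, hC0, fun t ht => ?_⟩
      have ht0 : 0 < |t| := by linarith
      have him : |t| ≤ ‖(σ + t * Complex.I : ℂ)‖ := by
        have := Complex.abs_im_le_norm (σ + t * Complex.I : ℂ)
        simpa using this
      have hz : (σ + t * Complex.I : ℂ) ≠ 0 := norm_pos_iff.1 (ht0.trans_le him)
      have h3 := hC t ht
      rw [show ((σ + 1 : ℝ) : ℂ) + t * Complex.I = (σ + t * Complex.I) + 1 by push_cast; ring,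
        Complex.Gamma_add_one _ hz, norm_mul,
        show σ + 1 - 1 / 2 = (σ - 1 / 2) + 1 by ring, Real.rpow_add_one ht0.ne'] at h3
      have h4 : |t| * ‖Complex.Gamma (σ + t * Complex.I)‖ ≤
          |t| * (C * (|t| ^ (σ - 1 / 2) * Real.exp (-(Real.pi / 2) * |t|))) := by
        refine (mul_le_mul_of_nonneg_right him (norm_nonneg _)).trans (h3.trans (le_of_eq ?_))
        ring
      exact le_of_mul_le_mul_left h4 ht0

theorem exists_norm_fSum_le (m : ℕ) (σ : ℝ) :
    ∃ C : ℝ, 0 ≤ C ∧ ∀ t : ℝ, ‖fSum m (σ + t * Complex.I)‖ ≤ C := by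
  refine ⟨∑ k ∈ Finset.Icc 1 m, (m.choose k : ℝ) * (k : ℝ) ^ (-σ), by positivity, fun t => ?_⟩
  refine (norm_sum_le _ _).trans (Finset.sum_le_sum fun k hk => le_of_eq ?_)
  have hk : 0 < k := (Finset.mem_Icc.1 hk).1
  rw [norm_mul, norm_mul, norm_pow, norm_neg, norm_one, one_pow, mul_one, Complex.norm_natCast,
    Complex.norm_natCast_cpow_of_pos hk]
  simp

theorem norm_hFun {ε : ℝ} (α : ℝ) (m : ℕ) (t : ℝ) :
    ‖hFun ε α m t‖ = Real.exp (-(ε * (Real.pi / 2) * t)) *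
      ‖Complex.Gamma ((1 / 2 - α : ℝ) + t * Complex.I)‖ *
        ‖fSum m ((1 / 2 - α : ℝ) + t * Complex.I)‖ := by
  have h1 : (1 / 2 - α + Complex.I * t : ℂ) = ((1 / 2 - α : ℝ) : ℂ) + t * Complex.I := by
    push_cast
    ring
  rw [hFun, h1, norm_mul, norm_mul, norm_mul, Complex.norm_exp, Complex.norm_exp]
  have h2 : (ε * Complex.I * (Real.pi / 2) * (1 / 2 - α) : ℂ).re = 0 := by
    rw [show (ε * Complex.I * (Real.pi / 2) * (1 / 2 - α) : ℂ) =
      ((ε * (Real.pi / 2) * (1 / 2 - α) : ℝ) : ℂ) * Complex.I by push_cast; ring]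
    simp
  have h3 : (-(ε * (Real.pi / 2) * t) : ℂ).re = -(ε * (Real.pi / 2) * t) := by
    rw [show (-(ε * (Real.pi / 2) * t) : ℂ) = ((-(ε * (Real.pi / 2) * t) : ℝ) : ℂ) by
        push_cast; ring,
      Complex.ofReal_re]
  rw [h2, h3, Real.exp_zero, one_mul]

/-- For `|t| ≥ 1` the bound is Stirling's; near `t = 0` the function is a Mellin transform on a
fixed vertical line, except at a pole of `Γ`. -/
theorem exists_norm_hFun_le {ε α : ℝ} (hε : ε = 1 ∨ ε = -1) {m : ℕ} (hα : 1 / 2 < α)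
    (hm : α - 1 / 2 < m) : ∃ C : ℝ, ∀ t : ℝ, ‖hFun ε α m t‖ ≤ C * bracket t ^ (-α) := by
  obtain ⟨n, hn⟩ := exists_nat_ge α
  obtain ⟨C, hC0, hC⟩ := exists_norm_Gamma_le n (1 / 2 - α) (by linarith) (by linarith)
  obtain ⟨D, hD0, hD⟩ := exists_norm_fSum_le m (1 / 2 - α)
  set E := ∫ s in Set.Ioi (0 : ℝ),
    s ^ ((1 / 2 - α) - 1) * ‖(Complex.exp (ε * Complex.I * s) - 1) ^ m‖ with hE
  have hE0 : 0 ≤ E := setIntegral_nonneg measurableSet_Ioi fun s hs => by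
    have : (0 : ℝ) < s := hs
    positivity
  have hall : ∀ t, ‖hFun ε α m t‖ ≤ E := by
    intro t
    by_cases ht : ∀ k : ℕ, (1 / 2 - α + Complex.I * t : ℂ) ≠ -k
    · rw [← mellin_wave_eq_hFun hε hα hm ht, mellin]
      refine (norm_integral_le_integral_norm _).trans (le_of_eq ?_)
      refine setIntegral_congr_fun measurableSet_Ioi fun s hs => ?_
      have hs' : (0 : ℝ) < s := hs
      rw [norm_smul, Complex.norm_cpow_eq_rpow_re_of_pos hs']
      congr 2
      simp
    · push Not at ht
      obtain ⟨k, hk⟩ := ht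
      rw [hFun, hk, Complex.Gamma_neg_nat_eq_zero]
      simpa using hE0
  have hb : ∀ t : ℝ, 0 < 1 + t ^ 2 := fun t => by positivity
  have hα0 : 0 < α := by linarith
  have h2 : 0 < Real.sqrt 2 := by positivity
  -- `⟨t⟩ ≤ √2 max(1, |t|)`
  have hb1 : ∀ t : ℝ, |t| ≤ 1 → Real.sqrt 2 ^ (-α) ≤ bracket t ^ (-α) := fun t ht => by
    refine Real.rpow_le_rpow_of_nonpos (Real.sqrt_pos.2 (hb t)) ?_ (by linarith)
    refine Real.sqrt_le_sqrt ?_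
    rw [← sq_abs]
    nlinarith [abs_nonneg t]
  have hb2 : ∀ t : ℝ, 1 ≤ |t| → |t| ^ (-α) ≤ Real.sqrt 2 ^ α * bracket t ^ (-α) := fun t ht => by
    have h3 : bracket t ≤ Real.sqrt 2 * |t| := by
      rw [bracket, ← Real.sqrt_sq_eq_abs, ← Real.sqrt_mul zero_le_two]
      refine Real.sqrt_le_sqrt ?_
      rw [← sq_abs]
      nlinarith
    have h4 : (Real.sqrt 2 * |t|) ^ (-α) ≤ bracket t ^ (-α) :=
      Real.rpow_le_rpow_of_nonpos (Real.sqrt_pos.2 (hb t)) h3 (by linarith)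
    rw [Real.mul_rpow h2.le (abs_nonneg t), Real.rpow_neg h2.le] at h4
    have h5 : 0 < Real.sqrt 2 ^ α := Real.rpow_pos_of_pos h2 _
    rwa [inv_mul_le_iff₀ h5] at h4
  refine ⟨E * Real.sqrt 2 ^ α + C * D * Real.sqrt 2 ^ α, fun t => ?_⟩
  have hp : 0 < Real.sqrt 2 ^ α := Real.rpow_pos_of_pos h2 _
  have hbr : 0 < bracket t ^ (-α) := Real.rpow_pos_of_pos (Real.sqrt_pos.2 (hb t)) _
  rcases le_total |t| 1 with ht | ht
  · have h3 := hb1 t ht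
    rw [Real.rpow_neg h2.le, inv_le_iff_one_le_mul₀ hp] at h3
    calc ‖hFun ε α m t‖ ≤ E * 1 := by rw [mul_one]; exact hall t
      _ ≤ E * (bracket t ^ (-α) * Real.sqrt 2 ^ α) := by gcongr
      _ ≤ E * (bracket t ^ (-α) * Real.sqrt 2 ^ α) +
          C * D * Real.sqrt 2 ^ α * bracket t ^ (-α) := le_add_of_nonneg_right (by positivity)
      _ = _ := by ring
  · rw [norm_hFun]
    have h3 : Real.exp (-(ε * (Real.pi / 2) * t)) ≤ Real.exp (Real.pi / 2 * |t|) := by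
      gcongr
      have : -(ε * t) ≤ |t| := by
        rcases hε with rfl | rfl
        · simpa using neg_le_abs t
        · simpa using le_abs_self t
      nlinarith [Real.pi_pos]
    have h4 : Real.exp (Real.pi / 2 * |t|) * Real.exp (-(Real.pi / 2) * |t|) = 1 := by
      rw [← Real.exp_add]
      simp
    have h5 := hC t ht
    rw [show (1 / 2 - α - 1 / 2 : ℝ) = -α by ring] at h5
    calc Real.exp (-(ε * (Real.pi / 2) * t)) * ‖Complex.Gamma ((1 / 2 - α : ℝ) + t * Complex.I)‖ *
          ‖fSum m ((1 / 2 - α : ℝ) + t * Complex.I)‖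
        ≤ Real.exp (Real.pi / 2 * |t|) *
          (C * (|t| ^ (-α) * Real.exp (-(Real.pi / 2) * |t|))) * D := by
          gcongr
          exact hD t
      _ = C * D * |t| ^ (-α) * (Real.exp (Real.pi / 2 * |t|) *
          Real.exp (-(Real.pi / 2) * |t|)) := by ring
      _ = C * D * |t| ^ (-α) := by rw [h4, mul_one]
      _ ≤ C * D * (Real.sqrt 2 ^ α * bracket t ^ (-α)) := by gcongr; exact hb2 t ht
      _ ≤ E * Real.sqrt 2 ^ α * bracket t ^ (-α) +
          C * D * (Real.sqrt 2 ^ α * bracket t ^ (-α)) := le_add_of_nonneg_left (by positivity)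
      _ = _ := by ring

end GammaDecay

/-! ### The Fourier transform on `L²` -/

section FourierL2

open scoped SchwartzMap

theorem integral_fourier_Lp (u : Lp ℂ 2 (volume : Measure ℝ)) (θ : 𝓢(ℝ, ℂ)) :
    ∫ ξ, θ ξ * (𝓕 u : Lp ℂ 2 (volume : Measure ℝ)) ξ = ∫ x, 𝓕 θ x * u x := by
  have h := DFunLike.congr_fun (Lp.fourier_toTemperedDistribution_eq u) θ
  rw [TemperedDistribution.fourier_apply, Lp.toTemperedDistribution_apply,
    Lp.toTemperedDistribution_apply] at h
  exact h.symm

theorem integrable_schwartz_mul_of_memLp {f : ℝ → ℂ} (hf : MemLp f 2 volume) (θ : 𝓢(ℝ, ℂ)) :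
    Integrable fun ξ => θ ξ * f ξ :=
  (θ.memLp 2).integrable_mul hf

theorem continuous_fourier {f : ℝ → ℂ} (hf : Integrable f) : Continuous (𝓕 f) :=
  VectorFourier.fourierIntegral_continuous Real.continuous_fourierChar continuous_inner hf

theorem norm_fourier_le {f : ℝ → ℂ} (ξ : ℝ) : ‖𝓕 f ξ‖ ≤ ∫ x, ‖f x‖ :=
  VectorFourier.norm_fourierIntegral_le_integral_norm _ _ _ _ _

/-- The `L²` Fourier transform is given by the Fourier integral on `L¹ ∩ L²`. -/
theorem fourier_toLp_ae_eq {f : ℝ → ℂ} (hf : Integrable f) (hf2 : MemLp f 2 volume) :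
    (𝓕 (hf2.toLp f) : Lp ℂ 2 (volume : Measure ℝ)) =ᵐ[volume] 𝓕 f := by
  set u : Lp ℂ 2 (volume : Measure ℝ) := 𝓕 (hf2.toLp f) with hu
  have hc := continuous_fourier hf
  have h0 : (fun ξ => u ξ - 𝓕 f ξ) =ᵐ[volume] 0 := by
    refine ae_eq_zero_of_integral_schwartz
      (((Lp.memLp u).locallyIntegrable one_le_two).sub hc.locallyIntegrable) fun θ _ => ?_
    have hi : Integrable fun ξ => θ ξ * 𝓕 f ξ :=
      θ.integrable.mul_bdd (c := ∫ x, ‖f x‖) hc.aestronglyMeasurable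
        (ae_of_all _ fun ξ => norm_fourier_le ξ)
    simp only [mul_sub]
    rw [integral_sub (integrable_schwartz_mul_of_memLp (Lp.memLp u) θ) hi, sub_eq_zero, hu,
      integral_fourier_Lp]
    have h1 := integral_fourier_mul_schwartz hf θ
    simp only [mul_comm (θ _)]
    rw [h1]
    refine integral_congr_ae ?_
    filter_upwards [hf2.coeFn_toLp] with x hx
    rw [hx, mul_comm]
  filter_upwards [h0] with ξ hξ
  exact sub_eq_zero.1 hξ

/-- Two functions `F`, `H` which form a Fourier pair in the sense of distributions, tested only
against smooth functions of compact support on the side of `F`. If one of them is in `L²`, then so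
is the other one, and they form a Fourier pair in `L²`. -/
theorem fourier_pair_of_memLp {F H : ℝ → ℂ} (hF : LocallyIntegrable F)
    (hH : ∀ θ : 𝓢(ℝ, ℂ), Integrable fun ξ => θ ξ * H ξ)
    (hpair : ∀ θ : 𝓢(ℝ, ℂ), HasCompactSupport θ → ∫ y, θ y * F y = ∫ ξ, 𝓕⁻ θ ξ * H ξ)
    (h : MemLp F 2 volume ∨ MemLp H 2 volume) :
    MemLp H 2 volume ∧ ∃ hF2 : MemLp F 2 volume,
      (𝓕 (hF2.toLp F) : Lp ℂ 2 (volume : Measure ℝ)) =ᵐ[volume] H := by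
  rcases h with h | h
  · set K : Lp ℂ 2 (volume : Measure ℝ) := 𝓕 (h.toLp F) with hK
    have h0 : (fun ξ => K ξ - H ξ) =ᵐ[volume] 0 := by
      refine ae_eq_zero_of_integral_fourier_eq_zero (fun θ => ?_) fun θ hθ => ?_
      · simp only [mul_sub]
        exact (integrable_schwartz_mul_of_memLp (Lp.memLp K) θ).sub (hH θ)
      · set θ' : 𝓢(ℝ, ℂ) := 𝓕 (𝓕 θ) with hθ'
        have h1 : ∀ x, θ' x = θ (-x) := fun x => by
          have h2 := fourierInv_eq_neg (𝓕 θ) (-x)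
          rw [neg_neg, FourierTransform.fourierInv_fourier_eq] at h2
          rw [hθ', h2]
        have h3 : HasCompactSupport θ' := by
          have := hθ.comp_homeomorph (Homeomorph.neg ℝ)
          refine this.mono fun x hx => ?_
          rw [Function.mem_support, h1] at hx
          exact hx
        have h4 := hpair θ' h3
        rw [hθ', FourierTransform.fourierInv_fourier_eq] at h4
        simp only [mul_sub]
        rw [integral_sub (integrable_schwartz_mul_of_memLp (Lp.memLp K) _) (hH _), ← h4, hK,
          integral_fourier_Lp, sub_eq_zero]
        refine integral_congr_ae ?_
        filter_upwards [h.coeFn_toLp] with x hx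
        rw [hx]
    have h1 : K =ᵐ[volume] H := by
      filter_upwards [h0] with ξ hξ
      exact sub_eq_zero.1 hξ
    exact ⟨(Lp.memLp K).ae_eq h1, h, h1⟩
  · set K : Lp ℂ 2 (volume : Measure ℝ) := 𝓕⁻ (h.toLp H) with hK
    have h0 : (fun x => K x - F x) =ᵐ[volume] 0 := by
      refine ae_eq_zero_of_integral_schwartz
        (((Lp.memLp K).locallyIntegrable one_le_two).sub hF) fun θ hθ => ?_
      have h1 : Integrable fun x => θ x * F x := by
        have := hF.integrable_smul_left_of_hasCompactSupport θ.continuous hθ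
        simpa using this
      simp only [mul_sub]
      rw [integral_sub (integrable_schwartz_mul_of_memLp (Lp.memLp K) θ) h1, hpair θ hθ,
        sub_eq_zero]
      have h2 := integral_fourier_Lp K (𝓕⁻ θ)
      rw [FourierTransform.fourier_fourierInv_eq, hK, FourierTransform.fourier_fourierInv_eq,
        ← hK] at h2
      rw [← h2]
      refine integral_congr_ae ?_
      filter_upwards [h.coeFn_toLp] with x hx
      rw [hx]
    have h1 : K =ᵐ[volume] F := by
      filter_upwards [h0] with ξ hξ
      exact sub_eq_zero.1 hξ
    have hF2 : MemLp F 2 volume := (Lp.memLp K).ae_eq h1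
    refine ⟨h, hF2, ?_⟩
    have h2 : hF2.toLp F = K := by
      rw [Lp.ext_iff]
      exact hF2.coeFn_toLp.trans h1.symm
    rw [h2, hK, FourierTransform.fourier_fourierInv_eq]
    exact h.coeFn_toLp

theorem tendsto_eLpNorm_indicator_sub {F : ℝ → ℂ} (hF : MemLp F 2 volume) :
    Tendsto (fun r : ℝ => eLpNorm (fun x => (Set.Ioc (-r) r).indicator F x - F x) 2 volume) atTop
      (𝓝 0) := by
  have h2 : Tendsto (fun r : ℝ => ∫⁻ x, ‖(Set.Ioc (-r) r).indicator F x - F x‖ₑ ^ (2 : ℝ)) atTop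
      (𝓝 (∫⁻ _ : ℝ, 0)) := by
    refine tendsto_lintegral_filter_of_dominated_convergence'
      (fun x => ‖F x‖ₑ ^ (2 : ℝ)) ?_ ?_ ?_ ?_
    · exact Eventually.of_forall fun r =>
        (((hF.1.indicator measurableSet_Ioc).sub hF.1).enorm.pow_const _)
    · refine Eventually.of_forall fun r => ae_of_all _ fun x => ?_
      by_cases hx : x ∈ Set.Ioc (-r) r
      · rw [Set.indicator_of_mem hx, sub_self, enorm_zero, ENNReal.zero_rpow_of_pos two_pos]
        exact zero_le
      · rw [Set.indicator_of_notMem hx, zero_sub, enorm_neg]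
    · have := lintegral_rpow_enorm_lt_top_of_eLpNorm_lt_top two_ne_zero ENNReal.ofNat_ne_top hF.2
      simpa using this.ne
    · refine ae_of_all _ fun x => tendsto_const_nhds.congr' ?_
      filter_upwards [eventually_gt_atTop |x|] with r hr
      have hx : x ∈ Set.Ioc (-r) r := ⟨(abs_lt.1 hr).1, (abs_lt.1 hr).2.le⟩
      rw [Set.indicator_of_mem hx, sub_self, enorm_zero, ENNReal.zero_rpow_of_pos two_pos]
  rw [lintegral_zero] at h2
  have h3 := (ENNReal.continuous_rpow_const (y := 1 / 2)).tendsto 0 |>.comp h2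
  rw [ENNReal.zero_rpow_of_pos (by norm_num)] at h3
  refine h3.congr fun r => ?_
  rw [eLpNorm_eq_lintegral_rpow_enorm_toReal two_ne_zero ENNReal.ofNat_ne_top]
  simp

/-- The Fourier transforms of the truncations of an `L²` function converge in `L²`. -/
theorem tendsto_eLpNorm_fourier_indicator {F : ℝ → ℂ} (hF : MemLp F 2 volume) :
    Tendsto (fun r : ℝ => eLpNorm (fun ξ => 𝓕 ((Set.Ioc (-r) r).indicator F) ξ -
      (𝓕 (hF.toLp F) : Lp ℂ 2 (volume : Measure ℝ)) ξ) 2 volume) atTop (𝓝 0) := by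
  refine (tendsto_eLpNorm_indicator_sub hF).congr fun r => ?_
  have h2 : MemLp ((Set.Ioc (-r) r).indicator F) 2 volume := hF.indicator measurableSet_Ioc
  have h1 : Integrable ((Set.Ioc (-r) r).indicator F) := by
    rw [integrable_indicator_iff measurableSet_Ioc]
    exact ((hF.locallyIntegrable one_le_two).integrableOn_isCompact isCompact_Icc).mono_set
      Set.Ioc_subset_Icc_self
  have h3 : eLpNorm (fun x => (Set.Ioc (-r) r).indicator F x - F x) 2 volume =
      ‖h2.toLp _ - hF.toLp F‖ₑ := by
    rw [← MemLp.toLp_sub, Lp.enorm_toLp]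
    rfl
  have h4 : ‖h2.toLp _ - hF.toLp F‖ₑ =
      ‖(𝓕 (h2.toLp _) : Lp ℂ 2 (volume : Measure ℝ)) - 𝓕 (hF.toLp F)‖ₑ := by
    have h5 := Lp.norm_fourier_eq (h2.toLp _ - hF.toLp F)
    rw [sub_eq_add_neg, FourierTransform.fourier_add, FourierTransform.fourier_neg,
      ← sub_eq_add_neg, ← sub_eq_add_neg] at h5
    rw [← ofReal_norm, ← ofReal_norm, h5]
  rw [h3, h4, Lp.enorm_def]
  refine eLpNorm_congr_ae ?_
  filter_upwards [fourier_toLp_ae_eq h1 h2, Lp.coeFn_sub (𝓕 (h2.toLp _) : Lp ℂ 2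
    (volume : Measure ℝ)) (𝓕 (hF.toLp F))] with ξ hξ hξ'
  rw [hξ', Pi.sub_apply, hξ]

theorem eLpNorm_comp_mul_left {c : ℝ} (hc : c ≠ 0) (f : ℝ → ℂ) :
    eLpNorm (fun t => f (c * t)) 2 volume =
      ENNReal.ofReal |c⁻¹| ^ (1 / (2 : ℝ≥0∞)).toReal • eLpNorm f 2 volume := by
  have he : MeasurableEmbedding fun t : ℝ => c * t :=
    (Homeomorph.mulLeft₀ c hc).measurableEmbedding
  rw [← eLpNorm_smul_measure_of_ne_top (by simp), ← Real.map_volume_mul_left hc,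
    he.eLpNorm_map_measure]
  rfl

theorem memLp_comp_mul_left {c : ℝ} (hc : c ≠ 0) {f : ℝ → ℂ} (hf : MemLp f 2 volume) :
    MemLp (fun t => f (c * t)) 2 volume := by
  have he : MeasurableEmbedding fun t : ℝ => c * t :=
    (Homeomorph.mulLeft₀ c hc).measurableEmbedding
  have h := (he.memLp_map_measure_iff (μ := volume) (g := f) (p := 2)).1
  rw [Real.map_volume_mul_left hc] at h
  exact h (hf.smul_measure ENNReal.ofReal_ne_top)

end FourierL2

/-! ### The multiplicative group in logarithmic coordinates -/

section Haar

theorem measurableEmbedding_exp : MeasurableEmbedding Real.exp :=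
  Real.continuous_exp.measurableEmbedding Real.exp_injective

theorem haarPos_eq_map_exp : haarPos = Measure.map Real.exp volume := by
  ext s hs
  rw [haarPos, withDensity_apply _ hs, Measure.restrict_restrict hs,
    measurableEmbedding_exp.map_apply]
  have h1 : s ∩ Set.Ioi 0 = Real.exp '' (Real.exp ⁻¹' s) := by
    rw [Set.image_preimage_eq_inter_range, Real.range_exp]
  rw [h1, lintegral_image_eq_lintegral_abs_deriv_mul (Real.continuous_exp.measurable hs)
    (fun x _ => (Real.hasDerivAt_exp x).hasDerivWithinAt) Real.exp_injective.injOn]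
  have h2 : ∀ x : ℝ, ENNReal.ofReal |Real.exp x| * ENNReal.ofReal (Real.exp x)⁻¹ = 1 := fun x => by
    rw [abs_of_pos (Real.exp_pos x), ← ENNReal.ofReal_mul (Real.exp_pos x).le,
      mul_inv_cancel₀ (Real.exp_pos x).ne', ENNReal.ofReal_one]
  simp only [h2, setLIntegral_const, one_mul]

theorem eLpNorm_haarPos (f : ℝ → ℂ) :
    eLpNorm f 2 haarPos = eLpNorm (fun y => f (Real.exp y)) 2 volume := by
  rw [haarPos_eq_map_exp, measurableEmbedding_exp.eLpNorm_map_measure]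
  rfl

theorem memLp_haarPos_iff {f : ℝ → ℂ} :
    MemLp f 2 haarPos ↔ MemLp (fun y => f (Real.exp y)) 2 volume := by
  rw [haarPos_eq_map_exp, measurableEmbedding_exp.memLp_map_measure_iff]
  rfl

/-- The Mellin transform on an imaginary line is the Fourier transform in logarithmic
coordinates. -/
theorem mellin_eq_fourier (f : ℝ → ℂ) (σ ξ : ℝ) :
    mellin f (σ + Complex.I * ((-2 * Real.pi * ξ : ℝ) : ℂ)) =
      𝓕 (fun y : ℝ => ((Real.exp y ^ σ : ℝ) : ℂ) * f (Real.exp y)) ξ := by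
  rw [mellin, integral_Ioi_eq_integral_exp, Real.fourier_real_eq_integral_exp_smul]
  refine integral_congr_ae (ae_of_all _ fun y => ?_)
  have hy : (Real.exp y : ℂ) ≠ 0 := by exact_mod_cast (Real.exp_pos y).ne'
  simp only [Complex.real_smul, smul_eq_mul]
  rw [Complex.cpow_sub _ _ hy, Complex.cpow_one, Complex.cpow_add _ _ hy, ← mul_assoc, ← mul_assoc,
    mul_div_cancel₀ _ hy, Complex.ofReal_cpow (Real.exp_pos y).le, mul_comm (_ ^ _)]
  congr 2
  rw [Complex.cpow_def_of_ne_zero hy, ← Complex.ofReal_log (Real.exp_pos y).le, Real.log_exp]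
  congr 1
  push_cast
  ring

/-- If `F ∘ exp` and `H` form a Fourier pair in `L²`, then `F` and `H(-· / 2π)` form a Mellin
pair. -/
theorem isMellinL2_of_fourier {F G H : ℝ → ℂ} (hF : MemLp (fun y => F (Real.exp y)) 2 volume)
    (hH : (𝓕 (hF.toLp _) : Lp ℂ 2 (volume : Measure ℝ)) =ᵐ[volume] H)
    (hG : ∀ t, t ≠ 0 → G t = H (-(2 * Real.pi)⁻¹ * t)) : IsMellinL2 F G := by
  set c : ℝ := -(2 * Real.pi)⁻¹ with hc
  have hc0 : c ≠ 0 := by rw [hc]; exact neg_ne_zero.2 (inv_ne_zero (by positivity))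
  have hct : ∀ t, -2 * Real.pi * (c * t) = t := fun t => by
    rw [hc]
    field_simp
  have hHL : MemLp H 2 volume := (Lp.memLp _).ae_eq hH
  have hGH : (fun t => H (c * t)) =ᵐ[volume] G := by
    have : ∀ᵐ t : ℝ, t ≠ 0 := by simp [ae_iff]
    filter_upwards [this] with t ht
    rw [hG t ht]
  refine ⟨memLp_haarPos_iff.2 hF, (memLp_comp_mul_left hc0 hHL).ae_eq hGH, ?_⟩
  have h1 := (tendsto_eLpNorm_fourier_indicator hF).comp Real.tendsto_log_atTop
  have h2 := ENNReal.Tendsto.const_mul (a := ENNReal.ofReal |c⁻¹| ^ (1 / (2 : ℝ≥0∞)).toReal) h1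
    (Or.inr (ENNReal.rpow_ne_top_of_nonneg ENNReal.toReal_nonneg ENNReal.ofReal_ne_top))
  rw [mul_zero] at h2
  refine h2.congr' ?_
  filter_upwards [eventually_gt_atTop 0] with R hR
  simp only [Function.comp_apply]
  rw [← smul_eq_mul, ← eLpNorm_comp_mul_left hc0]
  refine eLpNorm_congr_ae ?_
  have h3 : (fun t => (𝓕 (hF.toLp _) : Lp ℂ 2 (volume : Measure ℝ)) (c * t)) =ᵐ[volume]
      fun t => H (c * t) := by
    have hq : Measure.QuasiMeasurePreserving (fun t : ℝ => c * t) volume volume := by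
      refine ⟨measurable_const_mul c, ?_⟩
      rw [Real.map_volume_mul_left hc0]
      exact Measure.smul_absolutelyContinuous
    exact hq.ae_eq_comp hH
  filter_upwards [h3, hGH] with t ht ht'
  rw [ht, ht']
  congr 1
  have h4 := mellin_eq_fourier ((Set.Ioc R⁻¹ R).indicator F) 0 (c * t)
  rw [hct, Complex.ofReal_zero, zero_add] at h4
  have h5 : ((Set.Ioc (-Real.log R) (Real.log R)).indicator fun y => F (Real.exp y)) =
      fun y => ((Real.exp y ^ (0 : ℝ) : ℝ) : ℂ) * (Set.Ioc R⁻¹ R).indicator F (Real.exp y) := by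
    funext y
    have h6 : Real.exp y ∈ Set.Ioc R⁻¹ R ↔ y ∈ Set.Ioc (-Real.log R) (Real.log R) := by
      rw [Set.mem_Ioc, Set.mem_Ioc, ← Real.log_inv, Real.log_lt_iff_lt_exp (inv_pos.2 hR),
        Real.le_log_iff_exp_le hR]
    rw [Real.rpow_zero, Complex.ofReal_one, one_mul]
    by_cases hy : y ∈ Set.Ioc (-Real.log R) (Real.log R)
    · rw [Set.indicator_of_mem hy, Set.indicator_of_mem (h6.2 hy)]
    · rw [Set.indicator_of_notMem hy, Set.indicator_of_notMem fun h => hy (h6.1 h)]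
  rw [h4, h5]

end Haar

/-! ### Functionals on the Sobolev space -/

section Functional

open scoped SchwartzMap

variable {β : ℝ}

theorem ofReal_norm_sobEmb (β : ℝ) (η : 𝓢(ℝ, ℂ)) : ENNReal.ofReal ‖sobEmb β η‖ =
    eLpNorm (fun t => ((wt β t : ℝ) : ℂ) * 𝓕 η t) 2 volume := by
  rw [Lp.norm_def, ENNReal.ofReal_toReal (Lp.eLpNorm_ne_top _)]
  exact eLpNorm_congr_ae (coeFn_sobEmb β η)

theorem integral_norm_fourier_mul_le {v : ℝ → ℂ}
    (hv : MemLp (fun ξ => ((wt β ξ : ℝ) : ℂ)⁻¹ * v ξ) 2 volume) (η : 𝓢(ℝ, ℂ)) :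
    ∫ ξ, ‖𝓕 η ξ * v ξ‖ ≤ ‖sobEmb β η‖ *
      (eLpNorm (fun ξ => ((wt β ξ : ℝ) : ℂ)⁻¹ * v ξ) 2 volume).toReal := by
  have h1 := integrable_schwartz_mul hv (𝓕 η)
  have h2 : (fun ξ => 𝓕 η ξ * v ξ) = (fun ξ => ((wt β ξ : ℝ) : ℂ) * 𝓕 η ξ) •
      (fun ξ => ((wt β ξ : ℝ) : ℂ)⁻¹ * v ξ) := by
    funext ξ
    have : ((wt β ξ : ℝ) : ℂ) ≠ 0 := by exact_mod_cast (wt_pos β ξ).ne'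
    simp only [Pi.smul_apply', smul_eq_mul]
    field_simp
  have h3 : eLpNorm (fun ξ => 𝓕 η ξ * v ξ) 1 volume ≤ ENNReal.ofReal ‖sobEmb β η‖ *
      eLpNorm (fun ξ => ((wt β ξ : ℝ) : ℂ)⁻¹ * v ξ) 2 volume := by
    rw [h2, ofReal_norm_sobEmb]
    exact eLpNorm_smul_le_mul_eLpNorm hv.1 (memLp_wt_mul β (𝓕 η)).1
  rw [integral_norm_eq_lintegral_enorm h1.1, ← eLpNorm_one_eq_lintegral_enorm]
  refine (ENNReal.toReal_mono (ENNReal.mul_ne_top ENNReal.ofReal_ne_top hv.2.ne) h3).trans ?_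
  rw [ENNReal.toReal_mul, ENNReal.toReal_ofReal (norm_nonneg _)]

/-- A modulation of `φ` is a translation on the side of the Fourier transform, and the weight is
submultiplicative. -/
theorem norm_sobEmb_modS_le (hβ : 0 ≤ β) (τ : ℝ) (φ : 𝓢(ℝ, ℂ)) :
    ‖sobEmb β (modS τ φ)‖ ≤ wt β τ * ‖sobEmb β φ‖ := by
  have hτ := (wt_pos β τ).le
  rw [← ENNReal.ofReal_le_ofReal_iff (by positivity), ENNReal.ofReal_mul hτ, ofReal_norm_sobEmb,
    ofReal_norm_sobEmb]
  set g : ℝ → ℂ := fun t => ((wt β t : ℝ) : ℂ) * 𝓕 φ t with hg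
  have h1 : eLpNorm (g ∘ fun t => t - τ) 2 volume = eLpNorm g 2 volume :=
    eLpNorm_comp_measurePreserving (memLp_wt_mul β (𝓕 φ)).1 (measurePreserving_sub_right volume τ)
  rw [← h1]
  refine eLpNorm_le_mul_eLpNorm_of_ae_le_mul (ae_of_all _ fun t => ?_) 2
  have h2 := wt_add_le hβ τ (t - τ)
  rw [add_sub_cancel] at h2
  have h3 : ‖g (t - τ)‖ = wt β (t - τ) * ‖𝓕 φ (t - τ)‖ := by
    rw [hg, norm_mul, Complex.norm_real, Real.norm_of_nonneg (wt_pos _ _).le]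
  rw [Function.comp_apply, h3, fourier_modS, norm_mul, Complex.norm_real,
    Real.norm_of_nonneg (wt_pos _ _).le, ← mul_assoc]
  exact mul_le_mul_of_nonneg_right h2 (norm_nonneg _)

/-- A cutoff of `W` shows that the localized translates of a smooth function are bounded in the
Sobolev space, uniformly for translations in a compact interval. -/
theorem exists_norm_sobEmb_window (hβ : 0 ≤ β) {W : ℝ → ℂ} (hW : ContDiff ℝ (⊤ : ℕ∞) W)
    {φ : 𝓢(ℝ, ℂ)} (hφ : HasCompactSupport φ) (R : ℝ) :
    ∃ B : ℝ, 0 ≤ B ∧ ∀ y : ℝ, |y| ≤ R → ∀ η : 𝓢(ℝ, ℂ), (∀ x, η x = W (y + x) * φ x) →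
      ‖sobEmb β η‖ ≤ B := by
  obtain ⟨R', hR'⟩ := hφ.isCompact.isBounded.exists_norm_le
  set b : ContDiffBump (0 : ℝ) :=
    ⟨|R| + |R'| + 1, |R| + |R'| + 2, by positivity, by linarith⟩ with hb
  obtain ⟨W₁, -, hW₁⟩ := exists_schwartz_mul hW
    (hasCompactSupport_bumpS b b.contDiff b.hasCompactSupport)
  refine ⟨(∫ τ, wt β τ * ‖𝓕 W₁ τ‖) * ‖sobEmb β φ‖, mul_nonneg (integral_nonneg fun τ =>
    mul_nonneg (wt_pos _ _).le (norm_nonneg _)) (norm_nonneg _), fun y hy η hη => ?_⟩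
  have h1 : η = mulS (translS (-y) W₁) φ := by
    ext x
    rw [hη, mulS_apply, translS_apply, hW₁, bumpS_apply, sub_neg_eq_add, add_comm x y]
    by_cases hx : φ x = 0
    · rw [hx, mul_zero, mul_zero]
    · have h2 : |x| ≤ R' := hR' x (subset_tsupport _ hx)
      rw [b.one_of_mem_closedBall, Complex.ofReal_one, mul_one]
      rw [mem_closedBall_zero_iff, Real.norm_eq_abs]
      change |y + x| ≤ |R| + |R'| + 1
      have h3 := abs_add_le y x
      have h4 := le_abs_self R
      have h5 := le_abs_self R'
      linarith
  rw [h1]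
  refine (norm_sobEmb_mulS_le hβ _ _).trans (le_of_eq ?_)
  congr 2
  funext τ
  rw [fourier_translS, norm_mul, Complex.norm_exp_ofReal_mul_I, one_mul]

variable {L : 𝓢(ℝ, ℂ) →ₗ[ℂ] ℂ} {v : ℝ → ℂ}

theorem stronglyMeasurable_functional (hvm : Measurable v)
    (hL : ∀ η, L η = ∫ ξ, 𝓕 η ξ * v ξ) {η : ℝ → 𝓢(ℝ, ℂ)}
    (hη : StronglyMeasurable fun p : ℝ × ℝ => 𝓕 (η p.1) p.2) :
    StronglyMeasurable fun y => L (η y) := by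
  simp only [hL]
  exact (hη.mul (hvm.stronglyMeasurable.comp_measurable measurable_snd)).integral_prod_right

/-- A functional which is bounded for the Sobolev norm may be interchanged with the integration of a
family of Schwartz functions. -/
theorem integral_mul_functional (hvm : Measurable v)
    (hv : MemLp (fun ξ => ((wt β ξ : ℝ) : ℂ)⁻¹ * v ξ) 2 volume)
    (hL : ∀ η, L η = ∫ ξ, 𝓕 η ξ * v ξ) {η : ℝ → 𝓢(ℝ, ℂ)}
    (hη : StronglyMeasurable fun p : ℝ × ℝ => 𝓕 (η p.1) p.2) {a : ℝ → ℂ} (ha : Continuous a)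
    {B : ℝ → ℝ} (hB : ∀ y, a y ≠ 0 → ‖sobEmb β (η y)‖ ≤ B y)
    (hint : Integrable fun y => ‖a y‖ * B y) :
    ∫ y, a y * L (η y) = ∫ ξ, (∫ y, a y * 𝓕 (η y) ξ) * v ξ := by
  set V := (eLpNorm (fun ξ => ((wt β ξ : ℝ) : ℂ)⁻¹ * v ξ) 2 volume).toReal with hV
  have hm : StronglyMeasurable fun p : ℝ × ℝ => a p.1 * (𝓕 (η p.1) p.2 * v p.2) :=
    (ha.comp continuous_fst).stronglyMeasurable.mul
      (hη.mul (hvm.stronglyMeasurable.comp_measurable measurable_snd))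
  have hi : Integrable (fun p : ℝ × ℝ => a p.1 * (𝓕 (η p.1) p.2 * v p.2))
      (volume.prod volume) := by
    rw [integrable_prod_iff hm.aestronglyMeasurable]
    refine ⟨ae_of_all _ fun y => (integrable_schwartz_mul hv (𝓕 (η y))).const_mul (a y), ?_⟩
    refine Integrable.mono' (hint.mul_const V)
      hm.norm.integral_prod_right.aestronglyMeasurable (ae_of_all _ fun y => ?_)
    rw [Real.norm_of_nonneg (integral_nonneg fun _ => norm_nonneg _)]
    simp only [norm_mul (a y)]
    rw [integral_const_mul]
    by_cases hy : a y = 0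
    · simp [hy]
    · rw [mul_assoc]
      refine mul_le_mul_of_nonneg_left ?_ (norm_nonneg _)
      exact (integral_norm_fourier_mul_le hv _).trans
        (mul_le_mul_of_nonneg_right (hB y hy) ENNReal.toReal_nonneg)
  simp only [hL]
  calc ∫ y, a y * ∫ ξ, 𝓕 (η y) ξ * v ξ = ∫ y, ∫ ξ, a y * (𝓕 (η y) ξ * v ξ) := by
        simp only [integral_const_mul]
    _ = ∫ ξ, ∫ y, a y * (𝓕 (η y) ξ * v ξ) := integral_integral_swap hi
    _ = _ := by simp only [← mul_assoc, integral_mul_const]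

end Functional

/-! ### Superpositions of translates and of modulations -/

section Superposition

open scoped SchwartzMap

variable {β : ℝ} {W : ℝ → ℂ} {φ : 𝓢(ℝ, ℂ)} {η : ℝ → 𝓢(ℝ, ℂ)}
  {L : 𝓢(ℝ, ℂ) →ₗ[ℂ] ℂ} {v : ℝ → ℂ}

theorem fourier_family (hη : ∀ y x, η y x = W (y + x) * φ x) (y ξ : ℝ) :
    𝓕 (η y) ξ = ∫ x, Complex.exp (↑(-2 * Real.pi * x * ξ) * Complex.I) * (W (y + x) * φ x) := by
  rw [SchwartzMap.fourier_coe, Real.fourier_real_eq_integral_exp_smul]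
  simp only [hη, smul_eq_mul]

theorem stronglyMeasurable_fourier_family (hW : Continuous W)
    (hη : ∀ y x, η y x = W (y + x) * φ x) :
    StronglyMeasurable fun p : ℝ × ℝ => 𝓕 (η p.1) p.2 := by
  simp only [fourier_family hη]
  have hφ := φ.continuous
  have hc : Continuous fun q : (ℝ × ℝ) × ℝ =>
      Complex.exp (↑(-2 * Real.pi * q.2 * q.1.2) * Complex.I) * (W (q.1.1 + q.2) * φ q.2) := by
    fun_prop
  exact hc.stronglyMeasurable.integral_prod_right

theorem stronglyMeasurable_fourier_modS (φ : 𝓢(ℝ, ℂ)) :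
    StronglyMeasurable fun p : ℝ × ℝ => 𝓕 (modS p.1 φ) p.2 := by
  simp only [fourier_modS]
  exact ((𝓕 φ).continuous.comp (continuous_snd.sub continuous_fst)).stronglyMeasurable

/-- On the side of the Fourier transform, `∫ θ(y) W(y + ·) φ dy` is a superposition of
modulations of `φ`. -/
theorem integral_mul_fourier_family (hWc : Continuous W) (hWi : Integrable W) {b : ℝ}
    (hWb : ∀ x, ‖W x‖ ≤ b) (hη : ∀ y x, η y x = W (y + x) * φ x) (θ : 𝓢(ℝ, ℂ)) (ξ : ℝ) :
    ∫ y, θ y * 𝓕 (η y) ξ = ∫ τ, 𝓕⁻ θ τ * 𝓕 W τ * 𝓕 (modS τ φ) ξ := by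
  set e : ℝ → ℂ := fun x => Complex.exp (↑(-2 * Real.pi * x * ξ) * Complex.I) with he
  have hec : Continuous e := by fun_prop
  have hen : ∀ x, ‖e x‖ = 1 := fun x => Complex.norm_exp_ofReal_mul_I _
  have hφc := φ.continuous
  have hθc := θ.continuous
  have hi1 : Integrable (fun p : ℝ × ℝ => θ p.1 * (e p.2 * (W (p.1 + p.2) * φ p.2)))
      (volume.prod volume) := by
    have h1 := (θ.integrable (μ := volume)).mul_prod (φ.integrable (μ := volume))
    have h2 := h1.mul_bdd (g := fun p : ℝ × ℝ => e p.2 * W (p.1 + p.2)) (c := b)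
      (by fun_prop : Continuous fun p : ℝ × ℝ => e p.2 * W (p.1 + p.2)).aestronglyMeasurable
      (ae_of_all _ fun p => by rw [norm_mul, hen, one_mul]; exact hWb _)
    refine h2.congr (ae_of_all _ fun p => ?_)
    simp only
    ring
  have hi2 : Integrable (fun p : ℝ × ℝ => W p.1 * (θ (p.1 - p.2) * (e p.2 * φ p.2)))
      (volume.prod volume) := by
    have h1 := hWi.mul_prod (φ.integrable (μ := volume))
    have h2 := h1.mul_bdd (g := fun p : ℝ × ℝ => e p.2 * θ (p.1 - p.2))
      (c := SchwartzMap.seminorm ℝ 0 0 θ)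
      (by fun_prop : Continuous fun p : ℝ × ℝ => e p.2 * θ (p.1 - p.2)).aestronglyMeasurable
      (ae_of_all _ fun p => by
        rw [norm_mul, hen, one_mul]; exact SchwartzMap.norm_le_seminorm ℝ θ _)
    refine h2.congr (ae_of_all _ fun p => ?_)
    simp only
    ring
  set ζ : 𝓢(ℝ, ℂ) := mulS (𝓕⁻ θ) (translS ξ (𝓕⁻ φ)) with hζ
  have hζ1 : ∀ τ, ζ τ = 𝓕⁻ θ τ * 𝓕 (modS τ φ) ξ := fun τ => by
    rw [hζ, mulS_apply, translS_apply, fourierInv_eq_neg φ, fourier_modS, neg_sub]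
  have hζ2 : ∀ u, 𝓕 ζ u = ∫ x, θ (u - x) * (e x * φ x) := fun u => by
    rw [hζ, fourier_mulS, FourierTransform.fourier_fourierInv_eq,
      ← integral_sub_left_eq_self _ volume u]
    refine integral_congr_ae (ae_of_all _ fun x => ?_)
    simp only [fourier_translS, FourierTransform.fourier_fourierInv_eq, sub_sub_cancel, he]
    congr 3
    push_cast
    ring
  calc ∫ y, θ y * 𝓕 (η y) ξ = ∫ y, ∫ x, θ y * (e x * (W (y + x) * φ x)) := by
        simp only [fourier_family hη, integral_const_mul, he]
    _ = ∫ x, ∫ y, θ y * (e x * (W (y + x) * φ x)) := integral_integral_swap hi1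
    _ = ∫ x, ∫ u, W u * (θ (u - x) * (e x * φ x)) := by
        congr 1
        funext x
        rw [← integral_sub_right_eq_self _ x]
        refine integral_congr_ae (ae_of_all _ fun u => ?_)
        simp only [sub_add_cancel]
        ring
    _ = ∫ u, ∫ x, W u * (θ (u - x) * (e x * φ x)) := (integral_integral_swap hi2).symm
    _ = ∫ u, W u * 𝓕 ζ u := by simp only [hζ2, integral_const_mul]
    _ = ∫ τ, 𝓕 W τ * ζ τ := (integral_fourier_mul_schwartz hWi ζ).symm
    _ = _ := by
        refine integral_congr_ae (ae_of_all _ fun τ => ?_)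
        simp only [hζ1]
        ring

/-- For a functional `L` which is bounded for the Sobolev norm, the functions
`y ↦ L(W(y + ·) φ)` and `ξ ↦ Ŵ(ξ) L(e^{2πiξ·} φ)` form a Fourier pair in the sense of
distributions. -/
theorem integral_mul_functional_family (hβ : 0 ≤ β) (hvm : Measurable v)
    (hv : MemLp (fun ξ => ((wt β ξ : ℝ) : ℂ)⁻¹ * v ξ) 2 volume)
    (hL : ∀ η, L η = ∫ ξ, 𝓕 η ξ * v ξ) (hW : ContDiff ℝ (⊤ : ℕ∞) W) (hWi : Integrable W) {b : ℝ}
    (hWb : ∀ x, ‖W x‖ ≤ b) (hφ : HasCompactSupport φ) (hη : ∀ y x, η y x = W (y + x) * φ x)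
    {θ : 𝓢(ℝ, ℂ)} (hθ : HasCompactSupport θ) :
    ∫ y, θ y * L (η y) = ∫ ξ, 𝓕⁻ θ ξ * (𝓕 W ξ * L (modS ξ φ)) := by
  obtain ⟨R, hR⟩ := hθ.isCompact.isBounded.exists_norm_le
  obtain ⟨B, -, hB⟩ := exists_norm_sobEmb_window hβ hW hφ R
  rw [integral_mul_functional hvm hv hL (stronglyMeasurable_fourier_family hW.continuous hη)
    θ.continuous (B := fun _ => B) (fun y hy => hB y (hR y (subset_tsupport _ hy)) _ (hη y))
    (θ.integrable.norm.mul_const B)]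
  simp only [integral_mul_fourier_family hW.continuous hWi hWb hη, ← mul_assoc]
  have hc := continuous_fourier hWi
  refine (integral_mul_functional (η := fun τ => modS τ φ) hvm hv hL
    (stronglyMeasurable_fourier_modS φ)
    (a := fun τ => 𝓕⁻ θ τ * 𝓕 W τ) ((𝓕⁻ θ).continuous.mul hc)
    (B := fun τ => wt β τ * ‖sobEmb β φ‖) (fun τ _ => norm_sobEmb_modS_le hβ τ φ) ?_).symm
  have h1 := (((integrable_wt_mul β (𝓕⁻ θ)).mul_bdd (c := ∫ x, ‖W x‖) hc.norm.aestronglyMeasurable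
    (ae_of_all _ fun τ => by rw [norm_norm]; exact norm_fourier_le τ))).mul_const ‖sobEmb β φ‖
  refine h1.congr (ae_of_all _ fun τ => ?_)
  simp only [norm_mul]
  ring

theorem locallyIntegrable_functional_family (hβ : 0 ≤ β) {C : ℝ} (hC : 0 ≤ C)
    (hb : ∀ η, ‖L η‖ ≤ C * ‖sobEmb β η‖) (hvm : Measurable v)
    (hL : ∀ η, L η = ∫ ξ, 𝓕 η ξ * v ξ) (hW : ContDiff ℝ (⊤ : ℕ∞) W)
    (hφ : HasCompactSupport φ) (hη : ∀ y x, η y x = W (y + x) * φ x) :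
    LocallyIntegrable fun y => L (η y) := by
  rw [locallyIntegrable_iff]
  intro k hk
  obtain ⟨R, hR⟩ := hk.isBounded.exists_norm_le
  obtain ⟨B, -, hB⟩ := exists_norm_sobEmb_window hβ hW hφ R
  refine Measure.integrableOn_of_bounded (M := C * B) hk.measure_lt_top.ne
    (stronglyMeasurable_functional hvm hL
      (stronglyMeasurable_fourier_family hW.continuous hη)).aestronglyMeasurable ?_
  filter_upwards [ae_restrict_mem hk.measurableSet] with y hy
  exact (hb _).trans (mul_le_mul_of_nonneg_left (hB y (hR y hy) _ (hη y)) hC)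

theorem integrable_schwartz_mul_functional (hβ : 0 ≤ β) {C : ℝ} (hC : 0 ≤ C)
    (hb : ∀ η, ‖L η‖ ≤ C * ‖sobEmb β η‖) (hvm : Measurable v)
    (hL : ∀ η, L η = ∫ ξ, 𝓕 η ξ * v ξ) (hWi : Integrable W) (φ θ : 𝓢(ℝ, ℂ)) :
    Integrable fun ξ => θ ξ * (𝓕 W ξ * L (modS ξ φ)) := by
  have hc := continuous_fourier hWi
  have hm := stronglyMeasurable_functional (η := fun ξ => modS ξ φ) hvm hL
    (stronglyMeasurable_fourier_modS φ)
  refine Integrable.mono' ((integrable_wt_mul β θ).mul_const ((∫ x, ‖W x‖) * (C * ‖sobEmb β φ‖)))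
    (θ.continuous.aestronglyMeasurable.mul (hc.aestronglyMeasurable.mul hm.aestronglyMeasurable))
    (ae_of_all _ fun ξ => ?_)
  rw [norm_mul, norm_mul]
  calc ‖θ ξ‖ * (‖𝓕 W ξ‖ * ‖L (modS ξ φ)‖)
      ≤ ‖θ ξ‖ * ((∫ x, ‖W x‖) * (C * (wt β ξ * ‖sobEmb β φ‖))) := by
        gcongr
        · exact norm_fourier_le ξ
        · exact (hb _).trans (mul_le_mul_of_nonneg_left (norm_sobEmb_modS_le hβ ξ φ) hC)
    _ = _ := by ring

end Superposition

/-! ### The wave function in logarithmic coordinates -/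

section WaveLog

/-- The function `x ↦ w(eˣ)`, where `w(s) = s^{1/2-α} (e^{εis} - 1)^m`. -/
noncomputable def waveLog (ε α : ℝ) (m : ℕ) (x : ℝ) : ℂ := waveFun ε α m 1 (Real.exp x)

theorem waveLog_eq (ε α : ℝ) (m : ℕ) (x : ℝ) : waveLog ε α m x =
    ((Real.exp x ^ (1 / 2 - α) : ℝ) : ℂ) *
      (Complex.exp (ε * Complex.I * (Real.exp x : ℝ)) - 1) ^ m := by
  rw [waveLog, waveFun, one_mul, Complex.ofReal_one, mul_one]

theorem contDiff_waveLog (ε α : ℝ) (m : ℕ) : ContDiff ℝ (⊤ : ℕ∞) (waveLog ε α m) :=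
  contDiff_waveFun_exp ε α m one_pos

theorem waveFun_exp (ε α : ℝ) (m : ℕ) (y x : ℝ) :
    waveFun ε α m (Real.exp y) (Real.exp x) = waveLog ε α m (y + x) := by
  rw [waveLog_eq, waveFun, ← Real.exp_add, mul_assoc _ ((Real.exp y : ℝ) : ℂ),
    ← Complex.ofReal_mul, ← Real.exp_add]

theorem norm_waveLog_le {ε α : ℝ} (hε : ε = 1 ∨ ε = -1) {m : ℕ} (hα : 1 / 2 < α)
    (hm : α - 1 / 2 < m) (x : ℝ) : ‖waveLog ε α m x‖ ≤ 2 ^ m := by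
  set s := Real.exp x with hs
  have hs0 : 0 < s := Real.exp_pos x
  rw [waveLog_eq, norm_mul, norm_pow, Complex.norm_real,
    Real.norm_of_nonneg (Real.rpow_nonneg hs0.le _)]
  have h1 := norm_exp_sub_one_le hε s
  rw [abs_of_pos hs0] at h1
  have h2 := norm_exp_sub_one_le_two ε s
  rcases le_total s 1 with h | h
  · calc s ^ (1 / 2 - α) * ‖Complex.exp (ε * Complex.I * s) - 1‖ ^ m
        ≤ s ^ (1 / 2 - α) * s ^ m := by gcongr
      _ = s ^ (1 / 2 - α + m) := by rw [Real.rpow_add hs0, Real.rpow_natCast]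
      _ ≤ 1 := Real.rpow_le_one hs0.le h (by linarith)
      _ ≤ 2 ^ m := one_le_pow₀ one_le_two
  · calc s ^ (1 / 2 - α) * ‖Complex.exp (ε * Complex.I * s) - 1‖ ^ m
        ≤ 1 * 2 ^ m := by
          gcongr
          exact Real.rpow_le_one_of_one_le_of_nonpos h (by linarith)
      _ = 2 ^ m := one_mul _

theorem integrable_waveLog {ε α : ℝ} (hε : ε = 1 ∨ ε = -1) {m : ℕ} (hα : 1 / 2 < α)
    (hm : α - 1 / 2 < m) : Integrable (waveLog ε α m) := by
  have h := mellinConvergent_wave hε m (z := ((1 / 2 - α : ℝ) : ℂ))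
    (by rw [Complex.ofReal_re]; linarith) (by rw [Complex.ofReal_re]; linarith)
  rw [MellinConvergent, integrableOn_Ioi_iff_integrable_exp] at h
  refine h.congr (ae_of_all _ fun x => ?_)
  have hx : (Real.exp x : ℂ) ≠ 0 := by exact_mod_cast (Real.exp_pos x).ne'
  simp only [Complex.real_smul, smul_eq_mul]
  rw [Complex.cpow_sub _ _ hx, Complex.cpow_one, ← mul_assoc, mul_div_cancel₀ _ hx, waveLog_eq,
    Complex.ofReal_cpow (Real.exp_pos x).le]

/-- The Fourier transform of `w ∘ exp` is the Mellin transform of `w`, that is `h`. At `ξ = 0` the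
formula may fail, by the value of `Γ` at a pole. -/
theorem fourier_waveLog {ε α : ℝ} (hε : ε = 1 ∨ ε = -1) {m : ℕ} (hα : 1 / 2 < α)
    (hm : α - 1 / 2 < m) {ξ : ℝ} (hξ : ξ ≠ 0) :
    𝓕 (waveLog ε α m) ξ = hFun ε α m (-2 * Real.pi * ξ) := by
  set g : ℝ → ℂ := fun s => (Complex.exp (ε * Complex.I * s) - 1) ^ m with hg
  have h1 : waveLog ε α m = fun y : ℝ => ((Real.exp y ^ (1 / 2 - α) : ℝ) : ℂ) * g (Real.exp y) :=
    funext fun y => waveLog_eq ε α m y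
  have h2 : ((1 / 2 - α : ℝ) : ℂ) = 1 / 2 - α := by push_cast; ring
  rw [h1, ← mellin_eq_fourier g, h2, hg, mellin_wave_eq_hFun hε hα hm]
  intro k hk
  have := congrArg Complex.im hk
  simp at this
  exact hξ this

theorem bracket_nonneg (t : ℝ) : 0 ≤ bracket t := Real.sqrt_nonneg _

theorem bracket_neg (t : ℝ) : bracket (-t) = bracket t := by rw [bracket, bracket, neg_sq]

end WaveLog

end WaveBIP

open WaveBIP in
theorem mainTheorem4 {X : Type*} [NormedAddCommGroup X] [NormedSpace ℂ X] [CompleteSpace X]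
    (A : X →ₗ.[ℂ] X) (hA : WaveBIP.IsZeroSectorial A)
    (β : ℝ) (hβ : 1 / 2 < β) (hcalc : WaveBIP.HasSobCalc A β)
    (ψ : ℝ → ℂ) (hψ : WaveBIP.IsDyadic ψ)
    (α : ℝ) (hα : 1 / 2 < α) (m : ℕ) (hm : α - 1 / 2 < m)
    (ε : ℝ) (hε : ε = 1 ∨ ε = -1) :
    -- the operators are closed, and everything is defined on the calculus core
    (∀ s : ℝ, 0 < s → (WaveBIP.waveOp A β ψ ε α m s).IsClosed ∧
      WaveBIP.calcCore A β ψ ≤ (WaveBIP.waveOp A β ψ ε α m s).domain) ∧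
    (∀ t : ℝ, WaveBIP.calcCore A β ψ ≤ (WaveBIP.imagPow A t).domain) ∧
    -- growth of `h`
    (∃ C : ℝ, ∀ t : ℝ, ‖WaveBIP.hFun ε α m t‖ ≤ C * WaveBIP.bracket t ^ (-α)) ∧
    -- the Mellin transform, under either of the two weak `L²` bounds
    (((∃ C : ℝ, ∀ x ∈ WaveBIP.calcCore A β ψ, ∀ x' : StrongDual ℂ X,
          eLpNorm (fun t : ℝ => ((WaveBIP.bracket t ^ (-α) : ℝ) : ℂ) *
            x' (WaveBIP.opVal (WaveBIP.imagPow A t) x)) 2 volume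
              ≤ ENNReal.ofReal (C * ‖x‖ * ‖x'‖)) ∨
      (∃ C : ℝ, ∀ x ∈ WaveBIP.calcCore A β ψ, ∀ x' : StrongDual ℂ X,
          eLpNorm (fun s : ℝ => x' (WaveBIP.opVal (WaveBIP.waveOp A β ψ ε α m s) x)) 2
            WaveBIP.haarPos ≤ ENNReal.ofReal (C * ‖x‖ * ‖x'‖))) →
      ∀ x ∈ WaveBIP.calcCore A β ψ, ∀ x' : StrongDual ℂ X,
        WaveBIP.IsMellinL2
          (fun s : ℝ => x' (WaveBIP.opVal (WaveBIP.waveOp A β ψ ε α m s) x))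
          (fun t : ℝ => WaveBIP.hFun ε α m t * x' (WaveBIP.opVal (WaveBIP.imagPow A (-t)) x))) := by
  have hβ0 : 0 ≤ β := by linarith
  obtain ⟨Φ, hΦ⟩ := exists_isSobRep hA hβ0 hcalc
  have hsmooth : ∀ s : ℝ, 0 < s → ContDiff ℝ (⊤ : ℕ∞) (fun x => waveFun ε α m s (Real.exp x)) :=
    fun s hs => contDiff_waveFun_exp ε α m hs
  refine ⟨fun s hs => ⟨hΦ.unbddCalc_isClosed hA hψ (hsmooth s hs), fun x hx => ?_⟩,
    fun t x hx => ?_, exists_norm_hFun_le hε hα hm, fun h x hx x' => ?_⟩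
  · obtain ⟨φ, hφc, hw, -⟩ := hΦ.exists_core_rep hA hψ hx
    obtain ⟨θ, -, hθ⟩ := exists_schwartz_mul (hsmooth s hs) hφc
    exact (hw _ θ (hsmooth s hs) hθ).1
  · obtain ⟨φ, hφc, -, hp⟩ := hΦ.exists_core_rep hA hψ hx
    have h1 := (hp ((2 * Real.pi)⁻¹ * t)).1
    rwa [mul_inv_cancel_left₀ (by positivity)] at h1
  · obtain ⟨φ, hφc, hw, hp⟩ := hΦ.exists_core_rep hA hψ hx
    -- `F(y) = L(W(y + ·) φ)` and `H(ξ) = Ŵ(ξ) L(e^{2πiξ·} φ)` are the two matrix coefficients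
    set L := matCoeff Φ x x' with hLdef
    obtain ⟨C, hC0, hC⟩ := hΦ.matCoeff_le x x'
    obtain ⟨v, hvm, hv, hL⟩ := exists_density L hC
    have hWs := contDiff_waveLog ε α m
    have hWi := integrable_waveLog hε hα hm
    have hWb := norm_waveLog_le hε hα hm
    choose η _ hη using fun y : ℝ =>
      exists_schwartz_mul (hWs.comp (contDiff_const.add contDiff_id) :
        ContDiff ℝ (⊤ : ℕ∞) fun x => waveLog ε α m (y + x)) hφc
    have hη' : ∀ y x, η y x = waveLog ε α m (y + x) * φ x := hη
    have hF : ∀ y, x' (opVal (waveOp A β ψ ε α m (Real.exp y)) x) = L (η y) := fun y => by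
      rw [hLdef, matCoeff_apply, ← (hw _ (η y) (hsmooth _ (Real.exp_pos y))
        fun z => by rw [hη', waveFun_exp]).2]
      rfl
    have hU : ∀ τ, x' (opVal (imagPow A (2 * Real.pi * τ)) x) = L (modS τ φ) := fun τ => by
      rw [(hp τ).2, hLdef, matCoeff_apply]
    set H : ℝ → ℂ := fun ξ => 𝓕 (waveLog ε α m) ξ * L (modS ξ φ) with hH
    have hUm : StronglyMeasurable fun ξ => L (modS ξ φ) :=
      stronglyMeasurable_functional (η := fun ξ => modS ξ φ) hvm hL
        (stronglyMeasurable_fourier_modS φ)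
    have hor : MemLp (fun y => L (η y)) 2 volume ∨ MemLp H 2 volume := by
      rcases h with ⟨D, hD⟩ | ⟨D, hD⟩
      · -- the decay of `h` makes up for the weight in the bound on the imaginary powers
        right
        obtain ⟨E, hE⟩ := exists_norm_hFun_le hε hα hm
        set q : ℝ → ℂ := fun t => ((bracket t ^ (-α) : ℝ) : ℂ) * x' (opVal (imagPow A t) x) with hq
        refine ⟨((continuous_fourier hWi).aestronglyMeasurable.mul hUm.aestronglyMeasurable), ?_⟩
        have h2π : (2 * Real.pi : ℝ) ≠ 0 := by positivity
        have h1 : eLpNorm (fun ξ => q (2 * Real.pi * ξ)) 2 volume < ∞ := by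
          rw [eLpNorm_comp_mul_left h2π, smul_eq_mul]
          exact ENNReal.mul_lt_top (ENNReal.rpow_lt_top_of_nonneg ENNReal.toReal_nonneg
            ENNReal.ofReal_ne_top) ((hD x hx x').trans_lt ENNReal.ofReal_lt_top)
        refine (eLpNorm_le_mul_eLpNorm_of_ae_le_mul (c := E)
          (g := fun ξ => q (2 * Real.pi * ξ)) ?_ 2).trans_lt
          (ENNReal.mul_lt_top ENNReal.ofReal_lt_top h1)
        have h2 : ∀ᵐ ξ : ℝ, ξ ≠ 0 := by simp [ae_iff]
        filter_upwards [h2] with ξ hξ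
        simp only [hH, hq]
        rw [hU, fourier_waveLog hε hα hm hξ, norm_mul, norm_mul, Complex.norm_real,
          Real.norm_of_nonneg (Real.rpow_nonneg (bracket_nonneg _) _), ← mul_assoc]
        refine mul_le_mul_of_nonneg_right ((hE _).trans (le_of_eq ?_)) (norm_nonneg _)
        rw [← bracket_neg (2 * Real.pi * ξ), neg_mul, neg_mul]
      · left
        refine ⟨(stronglyMeasurable_functional hvm hL (stronglyMeasurable_fourier_family
          hWs.continuous hη')).aestronglyMeasurable, ?_⟩
        have h1 := (hD x hx x').trans_lt ENNReal.ofReal_lt_top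
        rw [eLpNorm_haarPos] at h1
        simpa only [hF] using h1
    obtain ⟨-, hF2, hFH⟩ := fourier_pair_of_memLp
      (locallyIntegrable_functional_family hβ0 hC0 hC hvm hL hWs hφc hη')
      (integrable_schwartz_mul_functional hβ0 hC0 hC hvm hL hWi φ)
      (fun θ hθ => integral_mul_functional_family hβ0 hvm hv hL hWs hWi hWb hφc hη' hθ) hor
    have hF3 : (fun y => x' (opVal (waveOp A β ψ ε α m (Real.exp y)) x)) = fun y => L (η y) :=
      funext hF
    have hF4 : MemLp (fun y => x' (opVal (waveOp A β ψ ε α m (Real.exp y)) x)) 2 volume :=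
      hF3 ▸ hF2
    refine isMellinL2_of_fourier (H := H) hF4 ?_ fun t ht => ?_
    · simpa only [hF3] using hFH
    · -- for `t ≠ 0`, `H(-t / 2π) = h(t) ⟨A^{-it} x, x'⟩`
      have h2 : -(2 * Real.pi)⁻¹ * t ≠ 0 :=
        mul_ne_zero (neg_ne_zero.2 (inv_ne_zero (by positivity))) ht
      have h3 : 2 * Real.pi * (-(2 * Real.pi)⁻¹ * t) = -t := by field_simp
      simp only [hH]
      rw [← hU, h3, fourier_waveLog hε hα hm h2, neg_mul, neg_mul, h3, neg_neg]
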